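/- Let $\Gamma$ be a divisible totally ordered abelian group, and let $F$ be a field with a valuation $v\colon F\to\Gamma\cup\{\infty\}$; write $\overline F$ for its residue field. Let $A$ be a finite-dimensional simple $F$-algebra with center $Z(A)$, and let $\sigma$ be an $F$-linear involution on $A$ (an $F$-linear anti-automorphism with $\sigma^2=\mathrm{id}$) such that $F$ is the subfield of $Z(A)$ fixed under $\sigma$. A surmultiplicative $v$-value function on $A$ is a map $g\colon A\to\Gamma\cup\{\infty\}$ such that $g(x)=\infty$ if and only if $x=0$, $g(x+y)\ge\min(g(x),g(y))$, $g(xc)=g(x)+v(c)$, $g(1)=0$ and $g(xy)\ge g(x)+g(y)$ for all $x,y\in A$, $c\in F$. Its associated graded ring is $\operatorname{gr}_g(A)=\bigoplus_{\gamma\in\Gamma}A^{\ge\gamma}/A^{>\gamma}$, where $A^{\ge\gamma}=\{x\mid g(x)\ge\gamma\}$ and $A^{>\gamma}=\{x\mid g(x)>\gamma\}$; it is a graded algebra over the graded field $\operatorname{gr}(F)$ defined in the same way from $v$. The function $g$ is a $v$-gauge if $A$ has an $F$-base $(e_i)$ with $g(\sum_i e_ic_i)=\min_i g(e_ic_i)$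 for all $c_i\in F$, and $\operatorname{gr}_g(A)$ contains no nonzero nilpotent homogeneous two-sided ideal. A gauge is tame if $Z(\operatorname{gr}_g(A))=\operatorname{gr}_g(Z(A))$ and this is a separable $\operatorname{gr}(F)$-algebra. Assume that $g$ is a tame $v$-gauge on $A$ with $g(\sigma(x))=g(x)$ for all $x\in A$, and let $\tilde\sigma$ be the involution on $\operatorname{gr}_g(A)$ that maps the class of $x$ in $A^{\ge\gamma}/A^{>\gamma}$ to the class of $\sigma(x)$. A graded algebra is graded simple if it is nonzero and has no homogeneous two-sided ideals other than $0$ and itself; it is graded central simple over $\operatorname{gr}(F)$ if moreover it is finite-dimensional over $\operatorname{gr}(F)$ with center $\operatorname{gr}(F)$. An involution $\tau$ on a simple (or graded simple) algebra $B$ with $\dim_{Z(B)}B=n^2$ is unitary if it is not the identity on $Z(B)$. Otherwise it is symplectic if either $\operatorname{char}B\ne2$ and $\dim_{Z(B)}\{x\mid\tau(x)=x\}=\frac12n(n-1)$, or $\operatorname{char}B=2$ and $1=x+\tau(x)$ for some $x\in B$; and it is orthogonal if it is the identity on $Z(B)$ and not symplectic. 1. Suppose $\sigma$ is unitary. Then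 $v$ has either one or two extensions to a valuation $Z(A)\to\Gamma\cup\{\infty\}$. If $v$ extends uniquely to $Z(A)$, then $\operatorname{gr}_g(A)$ is a graded simple $\operatorname{gr}(F)$-algebra and $\tilde\sigma$ is a unitary involution. If $v$ has two different extensions to $Z(A)$, then $\operatorname{gr}_g(A)$ is a direct product of two graded central simple $\operatorname{gr}(F)$-algebras, which are exchanged under $\tilde\sigma$. 2. If $\sigma$ is symplectic, then $\operatorname{gr}_g(A)$ is a graded central simple $\operatorname{gr}(F)$-algebra and $\tilde\sigma$ is a symplectic involution on it. 3. If $\sigma$ is orthogonal and $\operatorname{char}(\overline F)\ne2$, then $\operatorname{gr}_g(A)$ is a graded central simple $\operatorname{gr}(F)$-algebra and $\tilde\sigma$ is an orthogonal involution on it. -/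

import Mathlib

open scoped DirectSum TensorProduct

universe u

/-! ### Surmultiplicative value functions on rings and their associated graded rings -/

/-- A surmultiplicative map `R → Γ ∪ {∞}` satisfying the axioms of a value function that only
involve the ring structure of `R`.  (For value functions on an algebra over a valued field,
`map_neg'` is a consequence of `map_smul'` below.) -/
structure RingValue (R : Type*) [Ring R] (Γ : Type*) [AddCommGroup Γ] [LinearOrder Γ]
    [IsOrderedAddMonoid Γ] where
  toFun : R → WithTop Γ
  map_eq_top_iff' : ∀ x, toFun x = ⊤ ↔ x = 0
  map_neg' : ∀ x, toFun (-x) = toFun x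
  min_le_map_add' : ∀ x y, min (toFun x) (toFun y) ≤ toFun (x + y)
  map_one' : toFun 1 = 0
  add_le_map_mul' : ∀ x y, toFun x + toFun y ≤ toFun (x * y)

namespace RingValue

variable {Γ : Type*} [AddCommGroup Γ] [LinearOrder Γ] [IsOrderedAddMonoid Γ]

/-- A valuation on a field, as a value function on the ring `F`. -/
def ofAddValuation {F : Type*} [Field F] (v : AddValuation F (WithTop Γ)) : RingValue F Γ where
  toFun := v
  map_eq_top_iff' _ := v.top_iff
  map_neg' x := v.map_neg x
  min_le_map_add' x y := v.map_add x y
  map_one' := v.map_one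
  add_le_map_mul' x y := (v.map_mul x y).ge

variable {R : Type*} [Ring R] (g : RingValue R Γ)

instance : CoeFun (RingValue R Γ) (fun _ => R → WithTop Γ) := ⟨RingValue.toFun⟩

/-- `R^{≥ γ}` -/
def ge (γ : Γ) : AddSubgroup R where
  carrier := {x | (γ : WithTop Γ) ≤ g x}
  zero_mem' := by
    have : g 0 = ⊤ := (g.map_eq_top_iff' 0).2 rfl
    simp [this]
  add_mem' {x y} hx hy := le_trans (le_min hx hy) (g.min_le_map_add' x y)
  neg_mem' {x} hx := by
    simpa only [Set.mem_ofPred_eq, g.map_neg'] using hx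

/-- `R^{> γ}` -/
def gt (γ : Γ) : AddSubgroup R where
  carrier := {x | (γ : WithTop Γ) < g x}
  zero_mem' := by
    have : g 0 = ⊤ := (g.map_eq_top_iff' 0).2 rfl
    simp [this]
  add_mem' {x y} hx hy := lt_of_lt_of_le (lt_min hx hy) (g.min_le_map_add' x y)
  neg_mem' {x} hx := by
    simpa only [Set.mem_ofPred_eq, g.map_neg'] using hx

theorem mem_ge {γ : Γ} {x : R} : x ∈ g.ge γ ↔ (γ : WithTop Γ) ≤ g x := Iff.rfl

theorem mem_gt {γ : Γ} {x : R} : x ∈ g.gt γ ↔ (γ : WithTop Γ) < g x := Iff.rfl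

/-- The homogeneous piece `R_γ = R^{≥ γ} / R^{> γ}`. -/
def Piece (γ : Γ) : Type _ := (g.ge γ) ⧸ (g.gt γ).addSubgroupOf (g.ge γ)

instance (γ : Γ) : AddCommGroup (g.Piece γ) :=
  inferInstanceAs (AddCommGroup ((g.ge γ) ⧸ (g.gt γ).addSubgroupOf (g.ge γ)))

/-- The class in `R_γ` of an element of `R^{≥ γ}`. -/
def cls (γ : Γ) : g.ge γ →+ g.Piece γ :=
  QuotientAddGroup.mk' ((g.gt γ).addSubgroupOf (g.ge γ))

theorem cls_surjective (γ : Γ) : Function.Surjective (g.cls γ) :=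
  QuotientAddGroup.mk'_surjective _

theorem cls_eq_zero_iff {γ : Γ} (x : g.ge γ) : g.cls γ x = 0 ↔ (x : R) ∈ g.gt γ := by
  unfold cls
  exact QuotientAddGroup.eq_zero_iff (N := (g.gt γ).addSubgroupOf (g.ge γ)) x

theorem cls_eq_cls_iff {γ : Γ} (x y : g.ge γ) : g.cls γ x = g.cls γ y ↔ (x - y : R) ∈ g.gt γ := by
  rw [← sub_eq_zero, ← map_sub, cls_eq_zero_iff]
  rfl

theorem mul_mem_ge {γ δ : Γ} {x y : R} (hx : x ∈ g.ge γ) (hy : y ∈ g.ge δ) :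
    x * y ∈ g.ge (γ + δ) := by
  rw [mem_ge, WithTop.coe_add]
  exact le_trans (add_le_add hx hy) (g.add_le_map_mul' x y)

theorem mul_mem_gt_left {γ δ : Γ} {x y : R} (hx : x ∈ g.gt γ) (hy : y ∈ g.ge δ) :
    x * y ∈ g.gt (γ + δ) := by
  rw [mem_gt] at *
  rw [mem_ge] at hy
  rw [WithTop.coe_add]
  refine lt_of_lt_of_le ?_ (g.add_le_map_mul' x y)
  exact WithTop.add_lt_add_of_lt_of_le WithTop.coe_ne_top hx hy

theorem mul_mem_gt_right {γ δ : Γ} {x y : R} (hx : x ∈ g.ge γ) (hy : y ∈ g.gt δ) :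
    x * y ∈ g.gt (γ + δ) := by
  rw [mem_gt] at *
  rw [mem_ge] at hx
  rw [WithTop.coe_add]
  refine lt_of_lt_of_le ?_ (g.add_le_map_mul' x y)
  exact WithTop.add_lt_add_of_le_of_lt WithTop.coe_ne_top hx hy

/-- Multiplication `R_γ × R_δ → R_{γ + δ}` induced by the multiplication of `R`. -/
def pieceMul {γ δ : Γ} (a : g.Piece γ) (b : g.Piece δ) : g.Piece (γ + δ) :=
  Quotient.map₂ (fun (x : g.ge γ) (y : g.ge δ) =>
      (⟨x * y, g.mul_mem_ge x.2 y.2⟩ : g.ge (γ + δ))) (by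
    intro x x' hx y y' hy
    have hx' : (x - x' : R) ∈ g.gt γ := (g.cls_eq_cls_iff x x').1 (Quotient.sound hx)
    have hy' : (y - y' : R) ∈ g.gt δ := (g.cls_eq_cls_iff y y').1 (Quotient.sound hy)
    refine Quotient.exact ((g.cls_eq_cls_iff _ _).2 ?_)
    have h := add_mem (g.mul_mem_gt_left hx' y.2) (g.mul_mem_gt_right x'.2 hy')
    convert h using 1
    noncomm_ring) a b

theorem pieceMul_mk {γ δ : Γ} (x : g.ge γ) (y : g.ge δ) :
    g.pieceMul (g.cls γ x) (g.cls δ y) = g.cls (γ + δ) ⟨x * y, g.mul_mem_ge x.2 y.2⟩ := rfl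

theorem one_mem_ge : (1 : R) ∈ g.ge 0 := by
  rw [mem_ge, g.map_one']; rfl

/-- The unit, `1̃ ∈ R_0`. -/
def pieceOne : g.Piece 0 := g.cls 0 ⟨1, g.one_mem_ge⟩

theorem gradedMk_eq {γ δ : Γ} (h : γ = δ) (x : g.ge γ) (y : g.ge δ) (hxy : (x : R) = y) :
    GradedMonoid.mk (A := g.Piece) γ (g.cls γ x) = GradedMonoid.mk δ (g.cls δ y) := by
  subst h
  rw [Subtype.ext hxy]

instance : GradedMonoid.GMul g.Piece := ⟨g.pieceMul⟩

instance : GradedMonoid.GOne g.Piece := ⟨g.pieceOne⟩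

instance : GradedMonoid.GMonoid g.Piece where
  one_mul := by
    rintro ⟨γ, a⟩
    obtain ⟨x, rfl⟩ := g.cls_surjective γ a
    exact g.gradedMk_eq (zero_add γ) _ _ (one_mul _)
  mul_one := by
    rintro ⟨γ, a⟩
    obtain ⟨x, rfl⟩ := g.cls_surjective γ a
    exact g.gradedMk_eq (add_zero γ) _ _ (mul_one _)
  mul_assoc := by
    rintro ⟨γ, a⟩ ⟨δ, b⟩ ⟨ε, c⟩
    obtain ⟨x, rfl⟩ := g.cls_surjective γ a
    obtain ⟨y, rfl⟩ := g.cls_surjective δ b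
    obtain ⟨z, rfl⟩ := g.cls_surjective ε c
    exact g.gradedMk_eq (add_assoc γ δ ε) _ _ (mul_assoc _ _ _)

theorem gmul_mk {γ δ : Γ} (x : g.ge γ) (y : g.ge δ) :
    GradedMonoid.GMul.mul (g.cls γ x) (g.cls δ y)
      = g.cls (γ + δ) ⟨x * y, g.mul_mem_ge x.2 y.2⟩ := rfl

instance : DirectSum.GRing g.Piece where
  mul_zero {γ δ} a := by
    obtain ⟨x, rfl⟩ := g.cls_surjective γ a
    rw [← map_zero (g.cls δ), gmul_mk, cls_eq_zero_iff]
    simp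
  zero_mul {γ δ} b := by
    obtain ⟨y, rfl⟩ := g.cls_surjective δ b
    rw [← map_zero (g.cls γ), gmul_mk, cls_eq_zero_iff]
    simp
  mul_add {γ δ} a b c := by
    obtain ⟨x, rfl⟩ := g.cls_surjective γ a
    obtain ⟨y, rfl⟩ := g.cls_surjective δ b
    obtain ⟨z, rfl⟩ := g.cls_surjective δ c
    rw [← map_add, gmul_mk, gmul_mk, gmul_mk, ← map_add]
    congr 1
    exact Subtype.ext (mul_add _ _ _)
  add_mul {γ δ} a b c := by
    obtain ⟨x, rfl⟩ := g.cls_surjective γ a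
    obtain ⟨y, rfl⟩ := g.cls_surjective γ b
    obtain ⟨z, rfl⟩ := g.cls_surjective δ c
    rw [← map_add, gmul_mk, gmul_mk, gmul_mk, ← map_add]
    congr 1
    exact Subtype.ext (add_mul _ _ _)
  natCast n := n • g.pieceOne
  natCast_zero := zero_smul _ _
  natCast_succ n := succ_nsmul _ n
  intCast n := n • g.pieceOne
  intCast_ofNat n := natCast_zsmul _ n
  intCast_negSucc_ofNat n := negSucc_zsmul _ n

instance {S : Type*} [CommRing S] (g : RingValue S Γ) : DirectSum.GCommRing g.Piece where
  mul_comm := by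
    rintro ⟨γ, a⟩ ⟨δ, b⟩
    obtain ⟨x, rfl⟩ := g.cls_surjective γ a
    obtain ⟨y, rfl⟩ := g.cls_surjective δ b
    exact g.gradedMk_eq (add_comm γ δ) _ _ (mul_comm _ _)
  natCast n := n • g.pieceOne
  natCast_zero := zero_smul _ _
  natCast_succ n := succ_nsmul _ n
  intCast n := n • g.pieceOne
  intCast_ofNat n := natCast_zsmul _ n
  intCast_negSucc_ofNat n := negSucc_zsmul _ n

/-- The associated graded ring `gr_g(R) = ⨁_γ R^{≥ γ} / R^{> γ}`. -/
abbrev Gr : Type _ := ⨁ γ : Γ, g.Piece γ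

/-- The homogeneous component of degree `γ` of `gr_g(R)`, as a subgroup of `gr_g(R)`. -/
def comp (γ : Γ) : AddSubgroup g.Gr := (DirectSum.of g.Piece γ).range

instance : SetLike.GradedMonoid g.comp where
  one_mem := ⟨g.pieceOne, rfl⟩
  mul_mem := by
    rintro γ δ _ _ ⟨a, rfl⟩ ⟨b, rfl⟩
    exact ⟨g.pieceMul a b, (DirectSum.of_mul_of a b).symm⟩

/-- The inclusion of `R_γ` in `gr_g(R)`, with values in the component of degree `γ`. -/
def toComp (γ : Γ) : g.Piece γ →+ g.comp γ := (DirectSum.of g.Piece γ).rangeRestrict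

theorem coe_toComp (γ : Γ) (a : g.Piece γ) :
    (g.toComp γ a : g.Gr) = DirectSum.of g.Piece γ a := rfl

theorem toComp_surjective (γ : Γ) : Function.Surjective (g.toComp γ) :=
  AddMonoidHom.rangeRestrict_surjective _

instance : GradedRing g.comp where
  decompose' := DirectSum.map g.toComp
  left_inv x := by
    induction x using DirectSum.induction_on with
    | zero => rw [map_zero, map_zero]
    | of γ a => rw [DirectSum.map_of, DirectSum.coeAddMonoidHom_of, coe_toComp]
    | add x y hx hy => rw [map_add, map_add, hx, hy]
  right_inv x := by
    induction x using DirectSum.induction_on with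
    | zero => rw [map_zero, map_zero]
    | of γ a =>
      obtain ⟨b, rfl⟩ := g.toComp_surjective γ a
      rw [DirectSum.coeAddMonoidHom_of, coe_toComp, DirectSum.map_of]
    | add x y hx hy => rw [map_add, map_add, hx, hy]

section map

variable {g} {S T : Type*} [Ring S] [Ring T] {h : RingValue S Γ} {k : RingValue T Γ}

/-- The map `R_γ → S_γ` induced by an additive map that does not decrease values. -/
def pieceMap (f : R →+ S) (hf : ∀ x, g x ≤ h (f x)) (γ : Γ) : g.Piece γ →+ h.Piece γ :=
  QuotientAddGroup.map _ _
    ((f.comp (g.ge γ).subtype).codRestrict (h.ge γ) (fun x => le_trans x.2 (hf x)))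
    (fun x hx => lt_of_lt_of_le hx (hf x))

theorem pieceMap_mk (f : R →+ S) (hf : ∀ x, g x ≤ h (f x)) (γ : Γ) (x : g.ge γ) :
    pieceMap f hf γ (g.cls γ x) = h.cls γ ⟨f x, le_trans x.2 (hf x)⟩ := rfl

/-- The additive map `gr_g(R) → gr_h(S)` induced by an additive map that does not decrease
values. -/
def grMapAdd (f : R →+ S) (hf : ∀ x, g x ≤ h (f x)) : g.Gr →+ h.Gr :=
  DirectSum.map (pieceMap f hf)

theorem grMapAdd_of_mk (f : R →+ S) (hf : ∀ x, g x ≤ h (f x)) (γ : Γ) (x : g.ge γ) :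
    grMapAdd f hf (DirectSum.of g.Piece γ (g.cls γ x)) =
      DirectSum.of h.Piece γ (h.cls γ ⟨f x, le_trans x.2 (hf x)⟩) := by
  rw [grMapAdd, DirectSum.map_of, pieceMap_mk]

theorem of_mk_mul_of_mk {γ δ : Γ} (x : g.ge γ) (y : g.ge δ) :
    DirectSum.of g.Piece γ (g.cls γ x) * DirectSum.of g.Piece δ (g.cls δ y) =
      DirectSum.of g.Piece (γ + δ) (g.cls (γ + δ) ⟨x * y, g.mul_mem_ge x.2 y.2⟩) :=
  DirectSum.of_mul_of _ _

/-- Induction on `gr_g(R)`: it is additively generated by the classes of elements of `R`. -/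
theorem gr_induction {p : g.Gr → Prop} (x : g.Gr) (zero : p 0)
    (of_mk : ∀ γ (a : g.ge γ), p (DirectSum.of g.Piece γ (g.cls γ a)))
    (add : ∀ x y, p x → p y → p (x + y)) : p x := by
  induction x using DirectSum.induction_on with
  | zero => exact zero
  | of γ a =>
    obtain ⟨a, rfl⟩ := g.cls_surjective γ a
    exact of_mk γ a
  | add x y hx hy => exact add x y hx hy

/-- The graded ring homomorphism induced by a ring homomorphism that does not decrease values. -/
def grMap (f : R →+* S) (hf : ∀ x, g x ≤ h (f x)) : g.Gr →+* h.Gr where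
  __ := grMapAdd f.toAddMonoidHom hf
  map_one' := by
    have : (1 : g.Gr) = DirectSum.of g.Piece 0 (g.cls 0 ⟨1, g.one_mem_ge⟩) := rfl
    have h1 : (1 : h.Gr) = DirectSum.of h.Piece 0 (h.cls 0 ⟨1, h.one_mem_ge⟩) := rfl
    change grMapAdd f.toAddMonoidHom hf 1 = 1
    rw [this, grMapAdd_of_mk, h1]
    congr 2
    exact Subtype.ext f.map_one
  map_mul' x y := by
    change grMapAdd f.toAddMonoidHom hf (x * y) =
      grMapAdd f.toAddMonoidHom hf x * grMapAdd f.toAddMonoidHom hf y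
    induction x using gr_induction with
    | zero => simp
    | add x x' hx hx' => rw [add_mul, map_add, map_add, hx, hx', add_mul]
    | of_mk γ a =>
      induction y using gr_induction with
      | zero => simp
      | add y y' hy hy' => rw [mul_add, map_add, map_add, hy, hy', mul_add]
      | of_mk δ b =>
        rw [of_mk_mul_of_mk, grMapAdd_of_mk, grMapAdd_of_mk, grMapAdd_of_mk, of_mk_mul_of_mk]
        congr 2
        exact Subtype.ext (f.map_mul _ _)

theorem grMap_of_mk (f : R →+* S) (hf : ∀ x, g x ≤ h (f x)) (γ : Γ) (x : g.ge γ) :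
    grMap f hf (DirectSum.of g.Piece γ (g.cls γ x)) =
      DirectSum.of h.Piece γ (h.cls γ ⟨f x, le_trans x.2 (hf x)⟩) :=
  grMapAdd_of_mk f.toAddMonoidHom hf γ x

end map

end RingValue

/-! ### Value functions on algebras over a valued field -/

/-- A surmultiplicative `v`-value function on an algebra `A` over the valued field `(F, v)`. -/
structure SurmultValueFunction {Γ : Type*} [AddCommGroup Γ] [LinearOrder Γ]
    [IsOrderedAddMonoid Γ] {F : Type*} [Field F] (v : AddValuation F (WithTop Γ))
    (A : Type*) [Ring A] [Algebra F A] extends RingValue A Γ where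
  map_smul' : ∀ (c : F) (x : A), toFun (c • x) = toFun x + v c

/-- The associated graded ring `gr(F)` of a valued field `(F, v)`. -/
abbrev grField {Γ : Type*} [AddCommGroup Γ] [LinearOrder Γ] [IsOrderedAddMonoid Γ]
    {F : Type*} [Field F] (v : AddValuation F (WithTop Γ)) : Type _ :=
  (RingValue.ofAddValuation v).Gr

/-- The homogeneous components of `gr(F)`. -/
abbrev grFieldComp {Γ : Type*} [AddCommGroup Γ] [LinearOrder Γ] [IsOrderedAddMonoid Γ]
    {F : Type*} [Field F] (v : AddValuation F (WithTop Γ)) (γ : Γ) : AddSubgroup (grField v) :=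
  (RingValue.ofAddValuation v).comp γ

/-- The extensions of `v` to a valuation on the `F`-algebra `K`, with values in `Γ ∪ {∞}`. -/
def valuationExtensions {Γ : Type*} [AddCommGroup Γ] [LinearOrder Γ] [IsOrderedAddMonoid Γ]
    {F : Type*} [Field F] (v : AddValuation F (WithTop Γ)) (K : Type*) [CommRing K]
    [Algebra F K] : Set (AddValuation K (WithTop Γ)) :=
  {w | ∀ c : F, w (algebraMap F K c) = v c}

/-- The residue field of a valued field `(F, v)`. -/
abbrev residueFieldOf {Γ : Type*} [AddCommGroup Γ] [LinearOrder Γ] [IsOrderedAddMonoid Γ]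
    {F : Type*} [Field F] (v : AddValuation F (WithTop Γ)) : Type _ :=
  IsLocalRing.ResidueField (AddValuation.toValuation v).valuationSubring

/-! ### Graded simple algebras, separable algebras, involutions -/

/-- The commutative `R`-algebra `S` is separable: it has a separability idempotent
(equivalently, `S` is a projective `S ⊗[R] S`-module). -/
def IsSeparableAlgebra (R S : Type*) [CommRing R] [CommRing S] [Algebra R S] : Prop :=
  ∃ e : S ⊗[R] S, (∀ s : S, (s ⊗ₜ[R] (1 : S)) * e = ((1 : S) ⊗ₜ[R] s) * e) ∧
    Algebra.TensorProduct.lmul' R e = 1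

section Graded

variable {Γ : Type*} [AddCommGroup Γ] [LinearOrder Γ]

/-- A graded ring without nonzero nilpotent homogeneous two-sided ideal. -/
def IsGradedSemisimple {A : Type*} [Ring A] (𝒜 : Γ → AddSubgroup A) [GradedRing 𝒜] : Prop :=
  ∀ I : Ideal A, I.IsTwoSided → I.IsHomogeneous 𝒜 → (∃ n : ℕ, I ^ n = ⊥) → I = ⊥

/-- A nonzero graded ring without nontrivial homogeneous two-sided ideals. -/
def IsGradedSimpleRing {A : Type*} [Ring A] (𝒜 : Γ → AddSubgroup A) [GradedRing 𝒜] : Prop :=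
  Nontrivial A ∧ ∀ I : Ideal A, I.IsTwoSided → I.IsHomogeneous 𝒜 → I = ⊥ ∨ I = ⊤

/-- `A` is a finite-dimensional graded simple algebra over the graded ring `K` (meant for graded
fields `K`). -/
structure IsGradedSimpleAlgebra {K A : Type*} [CommRing K] [Ring A] [Algebra K A]
    (𝒦 : Γ → AddSubgroup K) (𝒜 : Γ → AddSubgroup A) [GradedRing 𝒜] : Prop where
  algebraMap_mem : ∀ γ, ∀ c ∈ 𝒦 γ, algebraMap K A c ∈ 𝒜 γ
  finite : Module.Finite K A
  simple : IsGradedSimpleRing 𝒜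

/-- `A` is a finite-dimensional graded central simple algebra over the graded ring `K`. -/
structure IsGradedCentralSimple {K A : Type*} [CommRing K] [Ring A] [Algebra K A]
    (𝒦 : Γ → AddSubgroup K) (𝒜 : Γ → AddSubgroup A) [GradedRing 𝒜] : Prop extends
    IsGradedSimpleAlgebra 𝒦 𝒜 where
  center_eq : ∀ z : A, z ∈ Subalgebra.center K A ↔ ∃ c : K, algebraMap K A c = z

end Graded

/-- A `K`-linear involution on the `K`-algebra `A`. -/
structure LinearInvolution (K A : Type*) [CommRing K] [Ring A] [Algebra K A] extends
    A →ₗ[K] A where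
  map_mul' : ∀ x y, toFun (x * y) = toFun y * toFun x
  involutive' : ∀ x, toFun (toFun x) = x

namespace LinearInvolution

variable {K A : Type*} [CommRing K] [Ring A] [Algebra K A] (σ : LinearInvolution K A)

instance : CoeFun (LinearInvolution K A) (fun _ => A → A) := ⟨fun σ => σ.toLinearMap⟩

theorem map_mul (x y : A) : σ (x * y) = σ y * σ x := σ.map_mul' x y

theorem involutive (x : A) : σ (σ x) = x := σ.involutive' x

theorem map_one : σ 1 = 1 := by
  have h := σ.map_mul (σ 1) 1
  rw [mul_one, σ.involutive, mul_one] at h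
  exact h.symm

theorem map_algebraMap (c : K) : σ (algebraMap K A c) = algebraMap K A c := by
  rw [Algebra.algebraMap_eq_smul_one]
  exact (σ.toLinearMap.map_smul c 1).trans (by rw [σ.map_one])

/-- `σ` is the identity on `Z(A)`. -/
def IsFirstKind : Prop := ∀ z ∈ Subalgebra.center K A, σ z = z

/-- Unitary involutions are the involutions of the second kind. -/
def IsUnitary : Prop := ¬ σ.IsFirstKind

/-- The `Z(A)`-space `Sym(A, σ)` of symmetric elements, for `σ` of the first kind. -/
def sym (h : σ.IsFirstKind) : Submodule (Subalgebra.center K A) A where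
  carrier := {x | σ x = x}
  zero_mem' := σ.toLinearMap.map_zero
  add_mem' {x y} hx hy := (σ.toLinearMap.map_add x y).trans (congrArg₂ (· + ·) hx hy)
  smul_mem' z x hx := by
    have hz := Subalgebra.mem_center_iff.1 z.2
    change σ ((z : A) * x) = (z : A) * x
    rw [σ.map_mul, h z z.2, show σ x = x from hx, hz]

/-- The set `Symd(A, σ)` of symmetrized elements. -/
def symd : Set A := {y | ∃ x, y = x + σ x}

/-- Symplectic involutions on an algebra `A` of degree `n`, i.e. of dimension `n ^ 2` over
`Z(A)`. -/
def IsSymplectic : Prop :=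
  ∃ h : σ.IsFirstKind,
    (ringChar A ≠ 2 ∧ ∃ n : ℕ, Module.finrank (Subalgebra.center K A) A = n ^ 2 ∧
      2 * Module.finrank (Subalgebra.center K A) (σ.sym h) = n * (n - 1)) ∨
    (ringChar A = 2 ∧ (1 : A) ∈ σ.symd)

/-- Orthogonal involutions are the involutions of the first kind that are not symplectic. -/
def IsOrthogonal : Prop := σ.IsFirstKind ∧ ¬ σ.IsSymplectic

end LinearInvolution

/-- The graded `K`-algebra `A` is a direct product of two graded central simple `K`-algebras,
and the involution `σ` exchanges the two factors. -/
def IsProductExchanged {Γ : Type*} [AddCommGroup Γ] [LinearOrder Γ] {K : Type*} {A : Type u}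
    [CommRing K] [Ring A] [Algebra K A] (𝒦 : Γ → AddSubgroup K) (𝒜 : Γ → AddSubgroup A)
    (σ : LinearInvolution K A) : Prop :=
  ∃ (B₁ B₂ : Type u) (_ : Ring B₁) (_ : Ring B₂) (_ : Algebra K B₁) (_ : Algebra K B₂)
    (ℬ₁ : Γ → AddSubgroup B₁) (ℬ₂ : Γ → AddSubgroup B₂)
    (_ : GradedRing ℬ₁) (_ : GradedRing ℬ₂) (ψ : A ≃ₐ[K] B₁ × B₂),
    IsGradedCentralSimple 𝒦 ℬ₁ ∧ IsGradedCentralSimple 𝒦 ℬ₂ ∧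
    (∀ γ x, x ∈ 𝒜 γ ↔ (ψ x).1 ∈ ℬ₁ γ ∧ (ψ x).2 ∈ ℬ₂ γ) ∧
    (∀ x, (ψ x).2 = 0 ↔ (ψ (σ x)).1 = 0)

/-! ### Gauges -/

namespace SurmultValueFunction

open RingValue

variable {Γ : Type*} [AddCommGroup Γ] [LinearOrder Γ] [IsOrderedAddMonoid Γ]
  {F : Type*} [Field F] {v : AddValuation F (WithTop Γ)} {A : Type*} [Ring A] [Algebra F A]
  (g : SurmultValueFunction v A)

instance : CoeFun (SurmultValueFunction v A) (fun _ => A → WithTop Γ) := ⟨fun g => g.toFun⟩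

theorem map_algebraMap (c : F) : g (algebraMap F A c) = v c := by
  rw [Algebra.algebraMap_eq_smul_one, g.map_smul', g.map_one', zero_add]

/-- The associated graded ring `gr_g(A)`. -/
abbrev gr : Type _ := g.toRingValue.Gr

/-- The homogeneous components of `gr_g(A)`. -/
abbrev grComp (γ : Γ) : AddSubgroup g.gr := g.toRingValue.comp γ

theorem le_map_algebraMap (c : F) :
    (RingValue.ofAddValuation v) c ≤ g.toRingValue (algebraMap F A c) :=
  (g.map_algebraMap c).ge

/-- The graded ring homomorphism `gr(F) → gr_g(A)` induced by `F → A`. -/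
def grAlgebraMap : grField v →+* g.gr :=
  grMap (algebraMap F A) g.le_map_algebraMap

theorem grAlgebraMap_of_cls (γ : Γ) (c : (ofAddValuation v).ge γ) :
    g.grAlgebraMap (DirectSum.of (ofAddValuation v).Piece γ ((ofAddValuation v).cls γ c)) =
      DirectSum.of g.Piece γ (g.cls γ ⟨algebraMap F A c, le_trans c.2 (g.le_map_algebraMap c)⟩) :=
  grMap_of_mk (algebraMap F A) g.le_map_algebraMap γ c

instance : Algebra (grField v) g.gr where
  algebraMap := g.grAlgebraMap
  smul c x := g.grAlgebraMap c * x
  smul_def' _ _ := rfl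
  commutes' c x := by
    induction c using gr_induction with
    | zero => simp
    | add c c' hc hc' => rw [map_add, add_mul, hc, hc', mul_add]
    | of_mk γ a =>
      induction x using gr_induction with
      | zero => simp
      | add y y' hy hy' => rw [mul_add, hy, hy', add_mul]
      | of_mk δ b =>
        rw [grAlgebraMap_of_cls, of_mk_mul_of_mk, of_mk_mul_of_mk]
        exact DirectSum.of_eq_of_gradedMonoid_eq
          (g.toRingValue.gradedMk_eq (add_comm γ δ) _ _ (Algebra.commutes (a : F) (b : A)))

/-- The restriction of a value function to a subalgebra. -/
def restrict (B : Subalgebra F A) : SurmultValueFunction v B where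
  toFun x := g (x : A)
  map_eq_top_iff' x := (g.map_eq_top_iff' x).trans ⟨fun h => Subtype.ext h, fun h => by rw [h]; rfl⟩
  map_neg' x := g.map_neg' x
  min_le_map_add' x y := g.min_le_map_add' x y
  map_one' := g.map_one'
  add_le_map_mul' x y := g.add_le_map_mul' x y
  map_smul' c x := g.map_smul' c x

/-- The canonical (injective) homomorphism `gr_g(B) → gr_g(A)` for a subalgebra `B` of `A`. -/
def grInclusion (B : Subalgebra F A) : (g.restrict B).gr →+* g.gr :=
  grMap B.val.toRingHom (fun _ => le_rfl)

/-- `g` is a `v`-norm: `A` is finite-dimensional and has a splitting base. -/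
def IsNorm : Prop :=
  ∃ (n : ℕ) (e : Module.Basis (Fin n) F A), ∀ c : Fin n → F,
    g (∑ i, c i • e i) = Finset.univ.inf (fun i => g (c i • e i))

/-- `g` is a `v`-gauge. -/
def IsGauge : Prop := g.IsNorm ∧ IsGradedSemisimple g.grComp

/-- `g` is a tame `v`-gauge: it is a gauge, `Z(gr_g(A)) = gr_g(Z(A))`, and `Z(gr_g(A))` is
separable over `gr(F)`. -/
def IsTameGauge : Prop :=
  g.IsGauge ∧
  (∀ x : g.gr, x ∈ Subalgebra.center (grField v) g.gr ↔
    x ∈ (g.grInclusion (Subalgebra.center F A)).range) ∧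
  IsSeparableAlgebra (grField v) (Subalgebra.center (grField v) g.gr)

/-- The value function `g` is invariant under `σ`. -/
def IsInvariant (σ : LinearInvolution F A) : Prop := ∀ x, g (σ x) = g x

variable {g} {σ : LinearInvolution F A}

theorem IsInvariant.le (h : g.IsInvariant σ) (x : A) :
    g.toRingValue x ≤ g.toRingValue (σ.toLinearMap.toAddMonoidHom x) := (h x).ge

/-- The additive map on `gr_g(A)` sending the class of `x` in `A_γ` to the class of `σ(x)`. -/
def IsInvariant.grAdd (h : g.IsInvariant σ) : g.gr →+ g.gr :=
  grMapAdd σ.toLinearMap.toAddMonoidHom h.le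

theorem IsInvariant.grAdd_of_cls (h : g.IsInvariant σ) (γ : Γ) (x : g.toRingValue.ge γ) :
    h.grAdd (DirectSum.of g.Piece γ (g.cls γ x)) =
      DirectSum.of g.Piece γ (g.cls γ ⟨σ x, le_trans x.2 (h.le x)⟩) :=
  grMapAdd_of_mk _ _ _ _

theorem IsInvariant.grAdd_mul (h : g.IsInvariant σ) (x y : g.gr) :
    h.grAdd (x * y) = h.grAdd y * h.grAdd x := by
  induction x using gr_induction with
  | zero => simp
  | add x x' hx hx' => rw [add_mul, map_add, map_add, hx, hx', mul_add]
  | of_mk γ a =>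
    induction y using gr_induction with
    | zero => simp
    | add y y' hy hy' => rw [mul_add, map_add, map_add, hy, hy', add_mul]
    | of_mk δ b =>
      rw [of_mk_mul_of_mk, grAdd_of_cls, grAdd_of_cls, grAdd_of_cls, of_mk_mul_of_mk]
      exact DirectSum.of_eq_of_gradedMonoid_eq
        (g.toRingValue.gradedMk_eq (add_comm γ δ) _ _ (σ.map_mul (a : A) (b : A)))

theorem IsInvariant.grAdd_algebraMap (h : g.IsInvariant σ) (c : grField v) :
    h.grAdd (algebraMap (grField v) g.gr c) = algebraMap (grField v) g.gr c := by
  change h.grAdd (g.grAlgebraMap c) = g.grAlgebraMap c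
  induction c using gr_induction with
  | zero => simp
  | add c c' hc hc' => rw [map_add, map_add, hc, hc']
  | of_mk γ a =>
    rw [grAlgebraMap_of_cls, grAdd_of_cls]
    congr 2
    exact Subtype.ext (σ.map_algebraMap (a : F))

variable (g) (σ) in
/-- The involution `σ̃` on `gr_g(A)` induced by an involution `σ` leaving `g` invariant: it maps
the class of `x` in `A_γ` to the class of `σ(x)`. -/
def grInvolution (h : g.IsInvariant σ) : LinearInvolution (grField v) g.gr where
  toFun := h.grAdd
  map_add' := map_add h.grAdd
  map_smul' c x := by
    rw [Algebra.smul_def, h.grAdd_mul, h.grAdd_algebraMap, ← Algebra.commutes,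
      ← Algebra.smul_def]
    rfl
  map_mul' := h.grAdd_mul
  involutive' x := by
    induction x using gr_induction with
    | zero => simp
    | add x y hx hy => rw [map_add, map_add, hx, hy]
    | of_mk γ a =>
      rw [h.grAdd_of_cls, h.grAdd_of_cls]
      congr 2
      exact Subtype.ext (σ.involutive (a : A))

end SurmultValueFunction

/-! The center controls everything. In the graded semisimple algebra gr_g(A), every homogeneous
two-sided ideal is generated by a central idempotent of degree 0
(`IsGradedSemisimple.exists_central_idempotent`), and tameness lifts this idempotent to some z in
Z(A) with g(z² - z) > 0. If σ is of the first kind, then Z(A) = F, where v is multiplicative, so z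
or z - 1 has positive value: the ideal is trivial, and gr_g(A) is graded central simple.

If σ is unitary, let s and h be the restrictions of σ and g to Z(A). Semisimplicity gives h(z²) =
2h(z) (`IsTameGauge.isQuadraticConj`). If h(z s(z)) = 2h(z) for all z, then h is multiplicative and
is the only extension of v, and the argument above again shows graded simplicity. Otherwise some z
violates this equality, and dividing z by its trace yields e with e + s(e) = 1 and h(e s(e)) > 0,
whose class is a nontrivial idempotent. Then v has exactly two extensions, exchanged by s, and the
class of e cuts gr_g(A) into two factors exchanged by σ̃. Moreover σ̃ is not the identity on the
center of gr_g(A): otherwise a central class ỹ outside gr(F) would have both 2ỹ (a trace) and ỹ² (a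
norm) in gr(F). The former is absurd if v(2) = 0; the latter makes the center inseparable if v(2) ≠
0, against tameness (`IsTameGauge.isUnitary`).

For involutions of the first kind the type is read from dimensions, since gr(W) has the dimension of
W for each subspace W (`IsNorm.finrank_grSub`). If v(2) = 0, the symmetric elements of gr_g(A) form
gr(Sym(A)), so the type is preserved. If v(2) ≠ 0 and σ is symplectic, let W be Symd(A) in
characteristic 2 and Sym(A) otherwise. Then W contains 1 and Symd(A), and dim W ≤ n(n-1)/2. But
gr(W) contains Symd(gr_g(A)), which has dimension at least n(n-1)/2: over an algebraically closed
field containing gr(F), the algebra becomes a matrix algebra whose symmetrized elements correspond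
to alternating matrices. Nested homogeneous submodules of equal rank coincide, so 1 lies in
Symd(gr_g(A)) (`IsTameGauge.one_mem_symd`). -/

/-! ### Homogeneous ideals of graded semisimple algebras over a graded field -/

section GradedIdeals

open DirectSum

variable {Γ : Type*} [AddCommGroup Γ] [LinearOrder Γ] {B : Type*} [Ring B]
  {ℬ : Γ → AddSubgroup B} [GradedRing ℬ]

theorem eq_of_forall_homogeneous {p : B → Prop} (hadd : ∀ x y, p x → p y → p (x + y))
    (hzero : p 0) (h : ∀ γ, ∀ x ∈ ℬ γ, p x) (x : B) : p x := by
  induction x using DirectSum.Decomposition.inductionOn ℬ with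
  | zero => exact hzero
  | homogeneous x => exact h _ _ x.2
  | add x y hx hy => exact hadd x y hx hy

/-- Homogeneous elements `x` with `x B x = 0` vanish in a graded semisimple ring. -/
theorem IsGradedSemisimple.eq_zero_of_mul_mul_self (hB : IsGradedSemisimple ℬ) {γ : Γ} {x : B}
    (hx : x ∈ ℬ γ) (h : ∀ b, x * b * x = 0) : x = 0 := by
  -- `I` is the two-sided ideal BxB; it is homogeneous and has square zero.
  set I : Ideal B := Ideal.span {y | ∃ δ, ∃ b ∈ ℬ δ, y = x * b} with hI
  have hxI : ∀ b, x * b ∈ I := by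
    refine eq_of_forall_homogeneous (ℬ := ℬ) (fun a b ha hb => ?_) ?_ (fun δ b hb => ?_)
    · rw [mul_add]; exact I.add_mem ha hb
    · simp
    · exact Ideal.subset_span ⟨δ, b, hb, rfl⟩
  have htwo : I.IsTwoSided := by
    refine ⟨fun {a} b ha => ?_⟩
    induction ha using Submodule.span_induction with
    | zero => simp
    | add x y _ _ hx hy => rw [add_mul]; exact I.add_mem hx hy
    | smul c x _ hx => rw [smul_eq_mul, mul_assoc]; exact I.mul_mem_left c hx
    | mem y hy =>
      obtain ⟨δ, c, hc, rfl⟩ := hy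
      rw [mul_assoc]
      exact hxI _
  have hhom : I.IsHomogeneous ℬ := by
    apply Ideal.homogeneous_span
    rintro _ ⟨δ, b, hb, rfl⟩
    exact ⟨γ + δ, SetLike.mul_mem_graded hx hb⟩
  have hsq : ∀ a ∈ I, ∀ b ∈ I, a * b = 0 := by
    intro a ha b hb
    have h1 : ∀ b ∈ I, ∀ c, x * c * b = 0 := by
      intro b hb
      induction hb using Submodule.span_induction with
      | zero => simp
      | add y z _ _ hy hz => intro c; rw [mul_add, hy, hz, add_zero]
      | smul d y _ hy =>
        intro c
        rw [smul_eq_mul, ← mul_assoc, mul_assoc x c d]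
        exact hy _
      | mem y hy =>
        intro c
        obtain ⟨δ, c', hc, rfl⟩ := hy
        rw [← mul_assoc, h, zero_mul]
    induction ha using Submodule.span_induction with
    | zero => simp
    | add y z _ _ hy hz => rw [add_mul, hy, hz, add_zero]
    | smul d y _ hy => rw [smul_eq_mul, mul_assoc, hy, mul_zero]
    | mem y hy =>
      obtain ⟨δ, c', hc, rfl⟩ := hy
      exact h1 b hb c'
  have hbot := hB I htwo hhom ⟨2, by
    rw [Submodule.pow_succ, Submodule.pow_one, eq_bot_iff, Ideal.mul_le]
    intro a ha b hb
    exact hsq a ha b hb⟩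
  have := hxI 1
  rwa [mul_one, hbot, Ideal.mem_bot] at this

variable {K : Type*} [CommRing K] [Algebra K B] {𝒦 : Γ → AddSubgroup K} [GradedRing 𝒦]

section

variable (hKB : ∀ γ, ∀ c ∈ 𝒦 γ, algebraMap K B c ∈ ℬ γ)

include hKB in
theorem decompose_algebraMap_apply (c : K) (γ : Γ) :
    (decompose ℬ (algebraMap K B c) γ : B) = algebraMap K B (decompose 𝒦 c γ) := by
  induction c using DirectSum.Decomposition.inductionOn 𝒦 with
  | zero => simp
  | add x y hx hy => simp [hx, hy]
  | @homogeneous i x =>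
    by_cases h : i = γ
    · subst h
      rw [decompose_of_mem_same _ (hKB _ _ x.2), decompose_of_mem_same _ x.2]
    · rw [decompose_of_mem_ne _ (hKB _ _ x.2) h, decompose_of_mem_ne _ x.2 h, map_zero]

include hKB in
theorem decompose_smul_add (c : K) {x : B} {δ : Γ} (hx : x ∈ ℬ δ) (γ : Γ) :
    (decompose ℬ (c • x) (γ + δ) : B) = (decompose 𝒦 c γ : K) • x := by
  rw [Algebra.smul_def, coe_decompose_mul_add_of_right_mem _ hx, decompose_algebraMap_apply hKB,
    Algebra.smul_def]

include hKB in
/-- Submodules spanned by homogeneous elements are homogeneous. -/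
theorem decompose_mem_span {s : Set B} (hs : ∀ x ∈ s, ∃ γ, x ∈ ℬ γ) :
    ∀ x ∈ Submodule.span K s, ∀ γ, (decompose ℬ x γ : B) ∈ Submodule.span K s := by
  intro x hx
  induction hx using Submodule.span_induction with
  | zero => intro γ; rw [decompose_zero]; exact zero_mem _
  | add x y _ _ hx hy =>
    intro γ
    rw [decompose_add, DirectSum.add_apply]
    exact add_mem (hx γ) (hy γ)
  | mem x hx =>
    obtain ⟨γ, hγ⟩ := hs x hx
    intro δ
    by_cases h : γ = δ
    · subst h
      rw [decompose_of_mem_same _ hγ]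
      exact Submodule.subset_span hx
    · rw [decompose_of_mem_ne _ hγ h]
      exact zero_mem _
  | smul c x _ hx =>
    induction c using DirectSum.Decomposition.inductionOn 𝒦 with
    | zero => intro γ; rw [zero_smul, decompose_zero]; exact zero_mem _
    | add c d hc hd =>
      intro γ
      rw [add_smul, decompose_add, DirectSum.add_apply]
      exact add_mem (hc γ) (hd γ)
    | @homogeneous δ c =>
      intro γ
      have := coe_decompose_mul_add_of_left_mem ℬ (j := γ - δ) (b := x) (hKB δ c c.2)
      rw [add_sub_cancel] at this
      rw [Algebra.smul_def, this, ← Algebra.smul_def]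
      exact Submodule.smul_mem _ _ (hx _)

variable (hK : ∀ γ, ∀ c ∈ 𝒦 γ, c ≠ 0 → IsUnit c)

include hKB hK in
/-- Homogeneous submodules over a graded field are saturated. -/
theorem mem_of_smul_mem {N : Submodule K B}
    (hN : ∀ x ∈ N, ∀ γ, (decompose ℬ x γ : B) ∈ N) {c : K} (hc : c ≠ 0) {δ : Γ} {x : B}
    (hx : x ∈ ℬ δ) (h : c • x ∈ N) : x ∈ N := by
  obtain ⟨γ, hγ⟩ : ∃ γ, (decompose 𝒦 c γ : K) ≠ 0 := by
    by_contra! h0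
    apply hc
    rw [← (decompose 𝒦).injective.eq_iff, decompose_zero]
    ext γ
    exact h0 γ
  have h1 := hN _ h (γ + δ)
  rw [decompose_smul_add hKB _ hx] at h1
  obtain ⟨u, hu⟩ := hK γ _ (decompose 𝒦 c γ).2 hγ
  rw [← hu] at h1
  have := N.smul_mem (↑u⁻¹ : K) h1
  rwa [smul_smul, Units.inv_mul, one_smul] at this

theorem exists_homogeneous_notMem {N N' : Submodule K B}
    (hN' : ∀ x ∈ N', ∀ γ, (decompose ℬ x γ : B) ∈ N') (h : N < N') :
    ∃ γ, ∃ x ∈ ℬ γ, x ∈ N' ∧ x ∉ N := by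
  by_contra! h0
  refine h.not_ge fun x hx => ?_
  classical
  rw [← sum_support_decompose ℬ x]
  exact Submodule.sum_mem _ fun γ _ => h0 γ _ (decompose ℬ x γ).2 (hN' x hx γ)

include hKB hK in
-- Over a mere domain a proper inclusion may preserve the rank. Here a homogeneous element of `N'`
-- outside `N` has a torsion-free class modulo `N`, by saturation, so the quotient has positive
-- rank. This replaces the usual dimension argument for graded fields.
theorem finrank_lt_finrank_of_homogeneous [IsDomain K] [Module.Finite K B] {N N' : Submodule K B}
    (hN : ∀ x ∈ N, ∀ γ, (decompose ℬ x γ : B) ∈ N)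
    (hN' : ∀ x ∈ N', ∀ γ, (decompose ℬ x γ : B) ∈ N') (h : N < N') :
    Module.finrank K N < Module.finrank K N' := by
  obtain ⟨γ, x, hx, hxN', hxN⟩ := exists_homogeneous_notMem hN' h
  have hfin : ∀ P : Submodule K B, Module.rank K P < Cardinal.aleph0 := fun P =>
    (Submodule.rank_le P).trans_lt (Module.rank_lt_aleph0 K B)
  set N₁ : Submodule K N' := N.comap N'.subtype
  have e : N₁ ≃ₗ[K] N := Submodule.comapSubtypeEquivOfLe h.le
  have h1 : Module.rank K (N' ⧸ N₁) + Module.rank K N₁ = Module.rank K N' :=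
    N₁.rank_quotient_add_rank
  have h2 : Module.rank K (N' ⧸ N₁) ≠ 0 := by
    intro h0
    rw [rank_eq_zero_iff] at h0
    obtain ⟨c, hc, hcx⟩ := h0 (N₁.mkQ ⟨x, hxN'⟩)
    rw [← map_smul, Submodule.mkQ_apply, Submodule.Quotient.mk_eq_zero] at hcx
    exact hxN (mem_of_smul_mem hKB hK hN hc hx hcx)
  rw [e.rank_eq] at h1
  rw [Module.finrank, Module.finrank, Cardinal.toNat_lt_iff_lt_of_lt_aleph0 (hfin _) (hfin _), ← h1]
  have h3 := hfin N'
  rw [← h1, Cardinal.add_lt_aleph0_iff] at h3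
  lift Module.rank K N to ℕ using hfin N with m
  lift Module.rank K (N' ⧸ N₁) to ℕ using h3.1 with k
  norm_cast at h2 ⊢
  omega

end

section

variable [Module.Finite K B] [IsDomain K]
  (hKB : ∀ γ, ∀ c ∈ 𝒦 γ, algebraMap K B c ∈ ℬ γ)
  (hK : ∀ γ, ∀ c ∈ 𝒦 γ, c ≠ 0 → IsUnit c)

include hKB hK in
theorem finrank_lt_of_isHomogeneous {I J : Ideal B} (hI : I.IsHomogeneous ℬ)
    (hJ : J.IsHomogeneous ℬ) (h : I < J) :
    Module.finrank K (I.restrictScalars K) < Module.finrank K (J.restrictScalars K) :=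
  finrank_lt_finrank_of_homogeneous hKB hK (fun _ hx γ => hI γ hx) (fun _ hx γ => hJ γ hx) h

/-- The elements of a left ideal annihilated by right multiplication by `a`. -/
def Ideal.annRight (I : Ideal B) (a : B) : Ideal B where
  carrier := {x | x ∈ I ∧ x * a = 0}
  zero_mem' := ⟨I.zero_mem, zero_mul _⟩
  add_mem' hx hy := ⟨I.add_mem hx.1 hy.1, by rw [add_mul, hx.2, hy.2, add_zero]⟩
  smul_mem' c x hx := ⟨I.mul_mem_left c hx.1, by rw [smul_eq_mul, mul_assoc, hx.2, mul_zero]⟩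

theorem Ideal.mem_annRight {I : Ideal B} {a x : B} : x ∈ I.annRight a ↔ x ∈ I ∧ x * a = 0 :=
  Iff.rfl

theorem Ideal.IsHomogeneous.annRight {I : Ideal B} (hI : I.IsHomogeneous ℬ) {a : B} {γ : Γ}
    (ha : a ∈ ℬ γ) : (I.annRight a).IsHomogeneous ℬ := by
  intro δ x hx
  refine ⟨hI δ hx.1, ?_⟩
  rw [← coe_decompose_mul_add_of_right_mem ℬ ha, hx.2]
  simp

/-- The left ideal `I a`. -/
def Ideal.mapMulRight (I : Ideal B) (a : B) : Ideal B where
  carrier := {y | ∃ x ∈ I, y = x * a}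
  zero_mem' := ⟨0, I.zero_mem, (zero_mul _).symm⟩
  add_mem' := by
    rintro _ _ ⟨x, hx, rfl⟩ ⟨y, hy, rfl⟩
    exact ⟨x + y, I.add_mem hx hy, (add_mul _ _ _).symm⟩
  smul_mem' := by
    rintro c _ ⟨x, hx, rfl⟩
    exact ⟨c * x, I.mul_mem_left c hx, (mul_assoc _ _ _).symm⟩

theorem Ideal.IsHomogeneous.mapMulRight {I : Ideal B} (hI : I.IsHomogeneous ℬ) {a : B} {γ : Γ}
    (ha : a ∈ ℬ γ) : (I.mapMulRight a).IsHomogeneous ℬ := by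
  rintro δ _ ⟨x, hx, rfl⟩
  refine ⟨_, hI (δ - γ) hx, ?_⟩
  rw [← coe_decompose_mul_add_of_right_mem ℬ ha, sub_add_cancel]

include hKB hK in
theorem exists_minimal_homogeneous {I : Ideal B} (hI : I.IsHomogeneous ℬ) (h0 : I ≠ ⊥) :
    ∃ L : Ideal B, L ≤ I ∧ L.IsHomogeneous ℬ ∧ L ≠ ⊥ ∧
      ∀ J : Ideal B, J.IsHomogeneous ℬ → J ≤ L → J ≠ ⊥ → J = L := by
  obtain ⟨L, ⟨hLI, hLh, hL0⟩, hmin⟩ := WellFounded.has_min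
    (InvImage.wf (fun J : Ideal B => Module.finrank K (J.restrictScalars K)) Nat.lt_wfRel.wf)
    {L : Ideal B | L ≤ I ∧ L.IsHomogeneous ℬ ∧ L ≠ ⊥} ⟨I, le_rfl, hI, h0⟩
  refine ⟨L, hLI, hLh, hL0, fun J hJ hJL hJ0 => ?_⟩
  by_contra hne
  exact hmin J ⟨hJL.trans hLI, hJ, hJ0⟩
    (finrank_lt_of_isHomogeneous hKB hK hJ hLh (lt_of_le_of_ne hJL hne))

include hKB hK in
-- Graded form of Brauer's lemma. A minimal homogeneous left ideal L has nonzero square by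
-- semisimplicity, so La = L for some homogeneous a in L, and no nonzero element of L kills a on the
-- left. Writing a = ea with e in L, the degree 0 part f of e also satisfies fa = a; then f² - f
-- kills a and vanishes.
theorem IsGradedSemisimple.exists_idempotent_mem (hB : IsGradedSemisimple ℬ) {I : Ideal B}
    (hI : I.IsHomogeneous ℬ) (h0 : I ≠ ⊥) : ∃ f ∈ I, f ∈ ℬ 0 ∧ f * f = f ∧ f ≠ 0 := by
  obtain ⟨L, hLI, hLh, hL0, hmin⟩ := exists_minimal_homogeneous hKB hK hI h0
  obtain ⟨γ, a, haγ, haL, b, hbL, hba⟩ : ∃ γ, ∃ a ∈ ℬ γ, a ∈ L ∧ ∃ b ∈ L, b * a ≠ 0 := by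
    by_contra! h
    refine hL0 ((Submodule.eq_bot_iff _).2 fun x hx => ?_)
    have key : ∀ δ, (decompose ℬ x δ : B) = 0 := fun δ =>
      hB.eq_zero_of_mul_mul_self (decompose ℬ x δ).2 <|
        eq_of_forall_homogeneous (ℬ := ℬ) (fun b c hb hc => by rw [mul_add, add_mul, hb, hc, add_zero])
          (by simp) fun ε b hb => by
          rw [mul_assoc]
          exact h _ _ (SetLike.mul_mem_graded hb (decompose ℬ x δ).2)
            (L.mul_mem_left b (hLh δ hx)) _ (hLh δ hx)
    classical
    rw [← sum_support_decompose ℬ x]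
    exact Finset.sum_eq_zero fun δ _ => key δ
  have hLa : L.mapMulRight a = L := by
    refine hmin _ (hLh.mapMulRight haγ) ?_ ?_
    · rintro _ ⟨x, _, rfl⟩
      exact L.mul_mem_left x haL
    · intro h
      apply hba
      rw [← Ideal.mem_bot, ← h]
      exact ⟨b, hbL, rfl⟩
  obtain ⟨e, heL, hea⟩ : a ∈ L.mapMulRight a := by rw [hLa]; exact haL
  have hann : L.annRight a = ⊥ := by
    by_contra hne
    have := hmin _ (hLh.annRight haγ) (fun x hx => hx.1) hne
    apply hba
    rw [← this] at hbL
    exact hbL.2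
  obtain ⟨f, hf⟩ : ∃ f : B, f = (decompose ℬ e 0 : B) := ⟨_, rfl⟩
  have hfL : f ∈ L := hf ▸ hLh 0 heL
  have hfa : f * a = a := by
    rw [hf, ← coe_decompose_mul_add_of_right_mem ℬ haγ, ← hea, zero_add,
      decompose_of_mem_same _ haγ]
  refine ⟨f, hLI hfL, hf ▸ SetLike.coe_mem _, ?_, ?_⟩
  · rw [← sub_eq_zero, ← Ideal.mem_bot, ← hann]
    exact ⟨L.sub_mem (L.mul_mem_left _ hfL) hfL, by rw [sub_mul, mul_assoc, hfa, hfa, sub_self]⟩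
  · intro h
    rw [h, zero_mul] at hfa
    rw [← hfa, mul_zero] at hba
    exact hba rfl

include hKB hK in
/-- Every homogeneous left ideal of a graded semisimple ring is generated by an idempotent. -/
theorem IsGradedSemisimple.exists_idempotent (hB : IsGradedSemisimple ℬ) {I : Ideal B}
    (hI : I.IsHomogeneous ℬ) : ∃ e ∈ I, e ∈ ℬ 0 ∧ e * e = e ∧ ∀ x ∈ I, x * e = x := by
  -- Take an idempotent e of `I` whose annihilator in `I` has least rank. A nonzero idempotent f of
  -- that annihilator would give the idempotent e + f - ef, with a strictly smaller annihilator.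
  obtain ⟨e, ⟨heI, he0, hee⟩, hmin⟩ := WellFounded.has_min
    (InvImage.wf (fun e : B => Module.finrank K ((I.annRight e).restrictScalars K))
      Nat.lt_wfRel.wf)
    {e : B | e ∈ I ∧ e ∈ ℬ 0 ∧ e * e = e} ⟨0, I.zero_mem, zero_mem _, zero_mul _⟩
  have hbot : I.annRight e = ⊥ := by
    by_contra hne
    obtain ⟨f, hfe, hf0, hff, hfne⟩ := hB.exists_idempotent_mem hKB hK (hI.annRight he0) hne
    obtain ⟨hfI, hfe⟩ := hfe
    set e' := e + f - e * f with he'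
    have h00 : e * f ∈ ℬ 0 := by simpa using SetLike.mul_mem_graded he0 hf0
    have he'e : e' * e = e := by
      rw [he', sub_mul, add_mul, hee, hfe, mul_assoc, hfe, mul_zero, add_zero, sub_zero]
    have he'f : e' * f = f := by
      rw [he', sub_mul, add_mul, hff, mul_assoc, hff]; abel
    have he'0 : e' ∈ ℬ 0 := sub_mem (add_mem he0 hf0) h00
    have hfe' : f * e' = f := by
      rw [he', mul_sub, mul_add, hfe, ← mul_assoc, hfe, hff]; simp
    refine hmin e' ⟨I.sub_mem (I.add_mem heI hfI) (I.mul_mem_left _ hfI), he'0, ?_⟩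
      (finrank_lt_of_isHomogeneous hKB hK (hI.annRight he'0) (hI.annRight he0) ?_)
    · nth_rewrite 2 [he']
      rw [mul_sub, mul_add, he'e, he'f, ← mul_assoc, he'e]
    · refine lt_of_le_of_ne (fun x hx => ⟨hx.1, ?_⟩) ?_
      · rw [← he'e, ← mul_assoc, hx.2, zero_mul]
      · intro heq
        have : f ∈ I.annRight e' := by rw [heq]; exact ⟨hfI, hfe⟩
        rw [Ideal.mem_annRight, hfe'] at this
        exact hfne this.2
  refine ⟨e, heI, he0, hee, fun x hx => ?_⟩
  rw [← sub_eq_zero, ← Ideal.mem_bot, ← hbot]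
  exact ⟨I.sub_mem (I.mul_mem_left _ heI) hx, by rw [sub_mul, mul_assoc, hee, sub_self]⟩

include hKB hK in
/-- Every homogeneous two-sided ideal of a graded semisimple ring is generated by a central
idempotent of degree `0`. -/
theorem IsGradedSemisimple.exists_central_idempotent (hB : IsGradedSemisimple ℬ) {I : Ideal B}
    (hI : I.IsHomogeneous ℬ) (htwo : I.IsTwoSided) :
    ∃ e ∈ I, e ∈ ℬ 0 ∧ e * e = e ∧ (∀ x ∈ I, x * e = x) ∧ ∀ b, b * e = e * b := by
  obtain ⟨e, heI, he0, hee, he⟩ := hB.exists_idempotent hKB hK hI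
  refine ⟨e, heI, he0, hee, he, ?_⟩
  have h1 : ∀ b, e * b * e = e * b := fun b => he _ (I.mul_mem_right b heI)
  refine eq_of_forall_homogeneous (ℬ := ℬ) (fun x y hx hy => ?_) ?_ (fun δ b hb => ?_)
  · rw [add_mul, mul_add, hx, hy]
  · simp
  · rw [← sub_eq_zero]
    -- For d = be - eb, the relations d = de and ecd = 0 give dcd = 0 for every c.
    refine hB.eq_zero_of_mul_mul_self (γ := δ) (sub_mem ?_ ?_) fun c => ?_
    · simpa using SetLike.mul_mem_graded hb he0
    · simpa using SetLike.mul_mem_graded he0 hb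
    · have h2 : e * c * (b * e - e * b) = 0 := by
        rw [mul_sub, ← mul_assoc, ← mul_assoc, h1 c, mul_assoc e c b, h1, sub_self]
      have h3 : e * (b * e - e * b) = 0 := by
        rw [mul_sub, ← mul_assoc, ← mul_assoc, h1, hee, sub_self]
      have h4 : b * e - e * b = (b * e - e * b) * e := by
        rw [sub_mul, mul_assoc, hee, h1]
      rw [h4, mul_assoc _ e c, mul_assoc, ← h4, h2, mul_zero]

end

end GradedIdeals

/-! ### Involutions of matrix algebras in characteristic 2 -/

section CharTwoInvolution

open Matrix

variable {L : Type*} [Field L]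

/-- An anti-automorphism of order two of a matrix algebra in characteristic `2` is the transpose
twisted by a symmetric matrix. -/
theorem Matrix.exists_symm_of_antiInvolution {n : ℕ} [NeZero n] (h2 : (2 : L) = 0)
    (t : Matrix (Fin n) (Fin n) L →ₗ[L] Matrix (Fin n) (Fin n) L)
    (hmul : ∀ x y, t (x * y) = t y * t x) (hinv : ∀ x, t (t x) = x) :
    ∃ P P' : Matrix (Fin n) (Fin n) L, P * P' = 1 ∧ P' * P = 1 ∧ Pᵀ = P ∧
      ∀ X, t X = P * Xᵀ * P' := by
  have hone : t 1 = 1 := by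
    have h := hmul (t 1) 1
    rw [mul_one, hinv, mul_one] at h
    exact h.symm
  let φ : Matrix (Fin n) (Fin n) L →ₐ[L] Matrix (Fin n) (Fin n) L :=
    AlgHom.ofLinearMap (t ∘ₗ (Matrix.transposeLinearEquiv (Fin n) (Fin n) L L).toLinearMap)
      (by simp [hone]) (fun x y => by simp [hmul])
  have hφ : ∀ X, φ X = t Xᵀ := fun X => rfl
  have hbij : Function.Bijective φ := by
    constructor
    · intro x y hxy
      rw [hφ, hφ] at hxy
      have := congrArg t hxy
      rw [hinv, hinv] at this
      exact Matrix.transpose_injective this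
    · intro y
      exact ⟨(t y)ᵀ, by rw [hφ, transpose_transpose, hinv]⟩
  let e := AlgEquiv.ofBijective φ hbij
  let c : Matrix (Fin n) (Fin n) L ≃ₐ[L] Module.End L (Fin n → L) := Matrix.toLinAlgEquiv'
  -- Skolem–Noether: the automorphism X ↦ t(Xᵀ) is conjugation by some P.
  obtain ⟨T, hT⟩ := ((c.symm.trans e).trans c).eq_linearEquivConjAlgEquiv
  set P := c.symm T.toLinearMap with hP
  set P' := c.symm T.symm.toLinearMap with hP'
  have hPP' : P * P' = 1 := by
    rw [hP, hP', ← map_mul]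
    convert map_one c.symm
    ext x
    simp
  have hP'P : P' * P = 1 := by
    rw [hP, hP', ← map_mul]
    convert map_one c.symm
    ext x
    simp
  have hφP : ∀ X, φ X = P * X * P' := by
    intro X
    have h := congrArg (fun f => c.symm (f (c X))) hT
    simp only [AlgEquiv.trans_apply, AlgEquiv.symm_apply_apply] at h
    refine (show φ X = e X from rfl).trans (h.trans ?_)
    rw [hP, hP', ← c.symm_apply_apply X, ← map_mul, ← map_mul, c.symm_apply_apply]
    rfl
  have ht : ∀ X, t X = P * Xᵀ * P' := fun X => by rw [← hφP, hφ, transpose_transpose]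
  refine ⟨P, P', hPP', hP'P, ?_, ht⟩
  have hPP't : P'ᵀ * Pᵀ = 1 := by rw [← transpose_mul, hPP', transpose_one]
  have hP'Pt : Pᵀ * P'ᵀ = 1 := by rw [← transpose_mul, hP'P, transpose_one]
  -- Since t is involutive, conjugation by P(Pᵀ)⁻¹ is trivial. Hence P = l Pᵀ with l² = 1, and
  -- characteristic 2 leaves only l = 1.
  have hcen : P * P'ᵀ ∈ Subalgebra.center L (Matrix (Fin n) (Fin n) L) := by
    rw [Subalgebra.mem_center_iff]
    intro X
    have h := hinv X
    rw [ht, ht] at h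
    simp only [transpose_mul, transpose_transpose] at h
    calc X * (P * P'ᵀ) = P * P'ᵀ * X * ((Pᵀ * (P' * P)) * P'ᵀ) := by
          nth_rewrite 1 [← h]
          simp only [mul_assoc]
      _ = P * P'ᵀ * X := by rw [hP'P, mul_one, hP'Pt, mul_one]
  obtain ⟨l, hl⟩ := Algebra.mem_bot.1 (Algebra.IsCentral.out hcen)
  have hPl : P = l • Pᵀ := by
    rw [Algebra.smul_def, hl, mul_assoc, hPP't, mul_one]
  have hll : (l * l) • P = P := by
    have h := congrArg transpose hPl
    rw [transpose_smul, transpose_transpose] at h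
    rw [mul_smul, ← h, ← hPl]
  have hP0 : P ≠ 0 := by
    intro h
    rw [h, zero_mul] at hPP'
    exact zero_ne_one hPP'
  have hl1 : l = 1 := by
    have h1 : (l * l - 1) • P = 0 := by rw [sub_smul, hll, one_smul, sub_self]
    have h3 := (smul_eq_zero.1 h1).resolve_right hP0
    have h4 : (l - 1) ^ 2 = 0 := by linear_combination h3 - (l - 1) * h2
    exact sub_eq_zero.1 (pow_eq_zero_iff (two_ne_zero) |>.1 h4)
  rw [hl1, one_smul] at hPl
  exact hPl.symm

/-- The space of alternating matrices `Y + Yᵀ` in characteristic `2`. -/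
theorem Matrix.two_mul_finrank_range_add_transpose (n : ℕ) (h2 : (2 : L) = 0) :
    2 * Module.finrank L (LinearMap.range (LinearMap.id +
      (Matrix.transposeLinearEquiv (Fin n) (Fin n) L L).toLinearMap)) = n * (n - 1) := by
  set D : Matrix (Fin n) (Fin n) L →ₗ[L] Matrix (Fin n) (Fin n) L :=
    LinearMap.id + (Matrix.transposeLinearEquiv (Fin n) (Fin n) L L).toLinearMap with hD
  have hDa : ∀ Y i j, D Y i j = Y i j + Y j i := fun Y i j => rfl
  -- In characteristic 2 the matrices Y + Yᵀ have zero diagonal, so they are determined by their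
  -- entries strictly above it, which are arbitrary.
  let ρ : Matrix (Fin n) (Fin n) L →ₗ[L] ((Σ j : Fin n, Fin j) → L) :=
    { toFun := fun Y p => Y (Fin.castLE p.1.2.le p.2) p.1
      map_add' := fun _ _ => rfl
      map_smul' := fun _ _ => rfl }
  have hinj : Function.Injective (ρ.domRestrict (LinearMap.range D)) := by
    rw [← LinearMap.ker_eq_bot, LinearMap.ker_eq_bot']
    rintro ⟨_, Y, rfl⟩ h
    have h' : ∀ (j : Fin n) (i : Fin j), D Y (Fin.castLE j.2.le i) j = 0 := fun j i =>
      congrFun h ⟨j, i⟩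
    ext i j
    change D Y i j = 0
    rcases lt_trichotomy i j with hij | rfl | hij
    · exact h' j ⟨i, hij⟩
    · rw [hDa]; linear_combination (Y i i) * h2
    · rw [hDa, add_comm, ← hDa]
      exact h' i ⟨j, hij⟩
  have hsurj : Function.Surjective (ρ.domRestrict (LinearMap.range D)) := by
    intro f
    let Y : Matrix (Fin n) (Fin n) L := fun i j => if h : i < j then f ⟨j, ⟨i, h⟩⟩ else 0
    refine ⟨⟨D Y, Y, rfl⟩, ?_⟩
    funext ⟨j, i⟩
    change Y (Fin.castLE j.2.le i) j + Y j (Fin.castLE j.2.le i) = f ⟨j, i⟩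
    have h1 : Fin.castLE j.2.le i < j := i.2
    simp only [Y, h1, h1.asymm, dif_pos, not_false_iff, dif_neg, add_zero]
    rfl
  rw [(LinearEquiv.ofBijective _ ⟨hinj, hsurj⟩).finrank_eq, Module.finrank_fintype_fun_eq_card,
    Fintype.card_sigma]
  simp only [Fintype.card_fin]
  rw [Fin.sum_univ_eq_sum_range (fun i => i), mul_comm, Finset.sum_range_id_mul_two]

/-- The dimension of the space of symmetrized elements for an involution of the first kind of a
central simple algebra over an algebraically closed field of characteristic `2`. -/
theorem LinearInvolution.two_mul_finrank_range_of_isAlgClosed [IsAlgClosed L] (h2 : (2 : L) = 0)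
    {M : Type*} [Ring M] [Algebra L M] [IsSimpleRing M] [FiniteDimensional L M]
    (τ : LinearInvolution L M) :
    ∃ n : ℕ, Module.finrank L M = n ^ 2 ∧
      2 * Module.finrank L (LinearMap.range (LinearMap.id + τ.toLinearMap)) = n * (n - 1) := by
  obtain ⟨n, _, ⟨e⟩⟩ := IsSimpleRing.exists_algEquiv_matrix_of_isAlgClosed L M
  refine ⟨n, ?_, ?_⟩
  · rw [e.toLinearEquiv.finrank_eq, Module.finrank_matrix]
    simp [pow_two]
  obtain ⟨P, P', hPP', hP'P, hP, ht⟩ := Matrix.exists_symm_of_antiInvolution h2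
    (e.toLinearMap ∘ₗ τ.toLinearMap ∘ₗ e.symm.toLinearMap)
    (fun x y => by
      change e (τ (e.symm (x * y))) = e (τ (e.symm y)) * e (τ (e.symm x))
      rw [_root_.map_mul, τ.map_mul, _root_.map_mul])
    (fun x => by
      change e (τ (e.symm (e (τ (e.symm x))))) = x
      rw [e.symm_apply_apply, τ.involutive, e.apply_symm_apply])
  -- Right multiplication by the symmetric matrix P turns X + P Xᵀ P⁻¹ into XP + (XP)ᵀ, so
  -- symmetrized elements correspond to alternating matrices.
  let r : Matrix (Fin n) (Fin n) L ≃ₗ[L] Matrix (Fin n) (Fin n) L :=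
    LinearEquiv.ofLinearMap (LinearMap.mulRight L P) (LinearMap.mulRight L P')
      (by ext1 X; simp [mul_assoc, hP'P]) (by ext1 X; simp [mul_assoc, hPP'])
  let E : M ≃ₗ[L] Matrix (Fin n) (Fin n) L := e.toLinearEquiv.trans r
  have hE : ∀ x, E x = e x * P := fun x => rfl
  rw [← Matrix.two_mul_finrank_range_add_transpose n h2, ← E.finrank_map_eq, ← LinearMap.range_comp]
  have hcomp : E.toLinearMap ∘ₗ (LinearMap.id + τ.toLinearMap) = (LinearMap.id +
      (Matrix.transposeLinearEquiv (Fin n) (Fin n) L L).toLinearMap) ∘ₗ E.toLinearMap := by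
    ext1 x
    change E (x + τ x) = E x + (E x)ᵀ
    have h1 : e (τ x) = P * (e x)ᵀ * P' := by
      rw [← ht]
      change _ = e (τ (e.symm (e x)))
      rw [e.symm_apply_apply]
    rw [hE, hE, map_add, add_mul, h1, mul_assoc, hP'P, mul_one, transpose_mul, hP]
  rw [hcomp, LinearMap.range_comp, LinearEquiv.range, Submodule.map_top]

end CharTwoInvolution

/-! ### Simplicity of scalar extensions of graded central simple algebras -/

section TensorSimple

variable {Γ : Type*} [AddCommGroup Γ] {K L B : Type*} [CommRing K] [Field L] [Algebra K L]
  [Ring B] [Algebra K B] {𝒜 : Γ → AddSubgroup B}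

/-- A linear endomorphism of `B`, homogeneous of degree `ε`, whose scalar extension leaves an ideal
of `L ⊗[K] B` invariant. -/
structure IsShift (𝒜 : Γ → AddSubgroup B) (I : TwoSidedIdeal (L ⊗[K] B)) (ε : Γ)
    (T : B →ₗ[K] B) : Prop where
  mem : ∀ δ, ∀ b ∈ 𝒜 δ, T b ∈ 𝒜 (δ + ε)
  map_mem : ∀ x ∈ I, T.lTensor L x ∈ I

namespace IsShift

variable {I : TwoSidedIdeal (L ⊗[K] B)} {ε ε' : Γ} {T T' : B →ₗ[K] B}

theorem zero : IsShift 𝒜 I ε 0 :=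
  ⟨fun _ _ _ => zero_mem _, fun x _ => by rw [LinearMap.lTensor_zero]; exact I.zero_mem⟩

theorem add (h : IsShift 𝒜 I ε T) (h' : IsShift 𝒜 I ε T') : IsShift 𝒜 I ε (T + T') :=
  ⟨fun δ b hb => add_mem (h.mem δ b hb) (h'.mem δ b hb), fun x hx => by
    rw [LinearMap.lTensor_add]; exact I.add_mem (h.map_mem x hx) (h'.map_mem x hx)⟩

theorem neg (h : IsShift 𝒜 I ε T) : IsShift 𝒜 I ε (-T) :=
  ⟨fun δ b hb => neg_mem (h.mem δ b hb), fun x hx => by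
    rw [LinearMap.lTensor_neg]; exact I.neg_mem (h.map_mem x hx)⟩

theorem comp (h : IsShift 𝒜 I ε T) (h' : IsShift 𝒜 I ε' T') : IsShift 𝒜 I (ε' + ε) (T ∘ₗ T') :=
  ⟨fun δ b hb => by rw [← add_assoc]; exact h.mem _ _ (h'.mem δ b hb), fun x hx => by
    rw [LinearMap.lTensor_comp]; exact h.map_mem _ (h'.map_mem x hx)⟩

variable [SetLike.GradedMonoid 𝒜]

theorem mulLeft {a : B} (ha : a ∈ 𝒜 ε) : IsShift 𝒜 I ε (LinearMap.mulLeft K a) := by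
  refine ⟨fun δ b hb => by rw [add_comm]; exact SetLike.mul_mem_graded ha hb, fun x hx => ?_⟩
  have : ∀ x, (LinearMap.mulLeft K a).lTensor L x = ((1 : L) ⊗ₜ[K] a) * x := by
    intro x
    induction x using TensorProduct.induction_on with
    | zero => simp
    | tmul l b => simp
    | add x y hx hy => rw [map_add, mul_add, hx, hy]
  rw [this]
  exact I.mul_mem_left _ _ hx

theorem mulRight {a : B} (ha : a ∈ 𝒜 ε) : IsShift 𝒜 I ε (LinearMap.mulRight K a) := by
  refine ⟨fun δ b hb => SetLike.mul_mem_graded hb ha, fun x hx => ?_⟩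
  have : ∀ x, (LinearMap.mulRight K a).lTensor L x = x * ((1 : L) ⊗ₜ[K] a) := by
    intro x
    induction x using TensorProduct.induction_on with
    | zero => simp
    | tmul l b => simp
    | add x y hx hy => rw [map_add, add_mul, hx, hy]
  rw [this]
  exact I.mul_mem_right _ _ hx

/-- Each generator abc is the image of b under a two-sided multiplication, which preserves ideals of
the scalar extension and shifts degrees by α + β = -γ. -/
theorem exists_of_mem_closure {γ : Γ} {b y : B} (hy : y ∈ AddSubgroup.closure
    {y | ∃ α β, ∃ a ∈ 𝒜 α, ∃ c ∈ 𝒜 β, α + γ + β = 0 ∧ y = a * b * c}) :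
    ∃ T : B →ₗ[K] B, IsShift 𝒜 I (-γ) T ∧ T b = y := by
  induction hy using AddSubgroup.closure_induction with
  | zero => exact ⟨0, zero, rfl⟩
  | add x y _ _ hx hy =>
    obtain ⟨T, hT, rfl⟩ := hx
    obtain ⟨T', hT', rfl⟩ := hy
    exact ⟨T + T', hT.add hT', rfl⟩
  | neg x _ hx =>
    obtain ⟨T, hT, rfl⟩ := hx
    exact ⟨-T, hT.neg, rfl⟩
  | mem y hy =>
    obtain ⟨α, β, a, ha, c, hc, h0, rfl⟩ := hy
    refine ⟨LinearMap.mulRight K c ∘ₗ LinearMap.mulLeft K a, ?_, ?_⟩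
    · have := (mulRight (I := I) hc).comp (mulLeft ha)
      rwa [show α + β = -γ by rw [eq_neg_iff_add_eq_zero, ← h0]; abel] at this
    · simp

end IsShift

/-- The tensor product of a field with a graded central simple algebra is simple. -/
theorem isSimpleRing_tensorProduct [SetLike.GradedMonoid 𝒜] [Nontrivial (L ⊗[K] B)]
    (hspan : AddSubgroup.closure (⋃ γ, (𝒜 γ : Set B)) = ⊤)
    (hsimple : ∀ γ, ∀ b ∈ 𝒜 γ, b ≠ 0 → (1 : B) ∈ AddSubgroup.closure
      {y | ∃ α β, ∃ a ∈ 𝒜 α, ∃ c ∈ 𝒜 β, α + γ + β = 0 ∧ y = a * b * c})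
    (hcenter : ∀ γ, ∀ b ∈ 𝒜 γ, (∀ δ, ∀ c ∈ 𝒜 δ, c * b = b * c) → ∃ k, algebraMap K B k = b) :
    IsSimpleRing (L ⊗[K] B) := by
  refine IsSimpleRing.of_eq_bot_or_eq_top fun I => or_iff_not_imp_left.2 fun hI => ?_
  -- `E n x` says that x is a sum of n tensors with homogeneous second factors. The proof studies a
  -- nonzero element of `I` for which n is least.
  let E : ℕ → L ⊗[K] B → Prop := fun n x => ∃ (l : Fin n → L) (b : Fin n → B) (δ : Fin n → Γ),
    (∀ i, b i ∈ 𝒜 (δ i)) ∧ x = ∑ i, l i ⊗ₜ[K] b i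
  have hEadd : ∀ x y, (∃ n, E n x) → (∃ n, E n y) → ∃ n, E n (x + y) := by
    rintro _ _ ⟨n, l, b, δ, hb, rfl⟩ ⟨n', l', b', δ', hb', rfl⟩
    refine ⟨n + n', Fin.append l l', Fin.append b b', Fin.append δ δ', ?_, ?_⟩
    · refine Fin.addCases (fun i => ?_) (fun i => ?_)
      · simpa using hb i
      · simpa using hb' i
    · simp [Fin.sum_univ_add]
  have hE : ∀ x, ∃ n, E n x := by
    intro x
    induction x using TensorProduct.induction_on with
    | zero => exact ⟨0, Fin.elim0, Fin.elim0, Fin.elim0, fun i => i.elim0, by simp⟩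
    | add x y hx hy => exact hEadd x y hx hy
    | tmul l b =>
      have hb : b ∈ AddSubgroup.closure (⋃ γ, (𝒜 γ : Set B)) := by rw [hspan]; trivial
      induction hb using AddSubgroup.closure_induction with
      | zero => exact ⟨0, Fin.elim0, Fin.elim0, Fin.elim0, fun i => i.elim0, by simp⟩
      | add x y _ _ hx hy => rw [TensorProduct.tmul_add]; exact hEadd _ _ hx hy
      | neg x _ hx =>
        obtain ⟨n, l', b, δ, hb, h⟩ := hx
        exact ⟨n, l', fun i => -b i, δ, fun i => neg_mem (hb i), by
          simp [TensorProduct.tmul_neg, h]⟩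
      | mem x hx =>
        obtain ⟨γ, hγ⟩ := Set.mem_iUnion.1 hx
        exact ⟨1, fun _ => l, fun _ => x, fun _ => γ, fun _ => hγ, by simp⟩
  obtain ⟨x₀, hx₀I, hx₀⟩ : ∃ x ∈ I, x ≠ 0 := by
    by_contra! h
    exact hI (le_bot_iff.1 fun x hx => (TwoSidedIdeal.mem_bot _).2 (h x hx))
  classical
  have hex : ∃ n, ∃ x ∈ I, x ≠ 0 ∧ E n x := by
    obtain ⟨n, hn⟩ := hE x₀
    exact ⟨n, x₀, hx₀I, hx₀, hn⟩
  obtain ⟨x, hxI, hx0, l, b, δ, hb, hx⟩ := Nat.find_spec hex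
  have hmin : ∀ m < Nat.find hex, ∀ y ∈ I, E m y → y = 0 := fun m hm y hyI hy => by
    by_contra hy0
    exact Nat.find_min hex hm ⟨y, hyI, hy0, hy⟩
  generalize Nat.find hex = n at *
  obtain _ | m := n
  · simp [hx] at hx0
  rw [Fin.sum_univ_succ] at hx
  have hb0 : b 0 ≠ 0 := by
    intro h
    refine hx0 (hmin m m.lt_succ_self x hxI ⟨fun i => l i.succ, _, _, fun i => hb i.succ, ?_⟩)
    rw [hx, h, TensorProduct.tmul_zero, zero_add]
  -- `T` normalizes the factor `b 0` to 1 while staying in `I`. If the resulting `y` vanished, its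
  -- equation would express `l 0 ⊗ 1` through the other terms and shorten `x`.
  obtain ⟨T, hT, hT1⟩ := IsShift.exists_of_mem_closure (I := I) (hsimple _ _ (hb 0) hb0)
  set y := T.lTensor L x with hy
  have hyI : y ∈ I := hT.map_mem x hxI
  have hysum : y = l 0 ⊗ₜ[K] 1 + ∑ i : Fin m, l i.succ ⊗ₜ[K] T (b i.succ) := by
    rw [hy, hx, map_add, map_sum]
    simp [hT1]
  have hy0 : y ≠ 0 := by
    intro h0
    refine hx0 (hmin m m.lt_succ_self x hxI ⟨fun i => l i.succ,
      fun i => b i.succ - T (b i.succ) * b 0, fun i => δ i.succ, fun i => ?_, ?_⟩)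
    · refine sub_mem (hb _) ?_
      have := SetLike.mul_mem_graded (hT.mem _ _ (hb i.succ)) (hb 0)
      rwa [neg_add_cancel_right] at this
    · have h1 : l 0 ⊗ₜ[K] b 0 = (l 0 ⊗ₜ[K] (1 : B)) * ((1 : L) ⊗ₜ[K] b 0) := by simp
      rw [h0] at hysum
      rw [hx, h1, eq_neg_of_add_eq_zero_left hysum.symm, neg_mul, Finset.sum_mul, ← sub_eq_neg_add,
        ← Finset.sum_sub_distrib]
      simp [TensorProduct.tmul_sub]
  have hfin : ∀ l' : L, y = l' ⊗ₜ[K] (1 : B) → I = ⊤ := by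
    intro l' hl'
    have hl0 : l' ≠ 0 := by
      rintro rfl
      exact hy0 (by rw [hl', TensorProduct.zero_tmul])
    rw [← TwoSidedIdeal.one_mem_iff]
    have := I.mul_mem_left (l'⁻¹ ⊗ₜ[K] 1) y hyI
    rwa [hl', Algebra.TensorProduct.tmul_mul_tmul, inv_mul_cancel₀ hl0, mul_one,
      ← Algebra.TensorProduct.one_def] at this
  obtain _ | k := m
  · exact hfin (l 0) (by simpa using hysum)
  exfalso
  apply hy0
  set d : Fin (k + 1) → B := fun i => T (b i.succ) with hd
  have hdm : ∀ i, d i ∈ 𝒜 (δ i.succ + -δ 0) := fun i => hT.mem _ _ (hb _)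
  change y = _ + ∑ i : Fin (k + 1), l i.succ ⊗ₜ[K] d i at hysum
  rw [Fin.sum_univ_succ] at hysum
  by_cases hcom : ∀ ε, ∀ c ∈ 𝒜 ε, c * d 0 = d 0 * c
  -- Here `d 0` is central, hence a scalar, and its term merges with the first one.
  · obtain ⟨κ, hκ⟩ := hcenter _ _ (hdm 0) hcom
    refine hmin (k + 1) (Nat.lt_succ_self _) y hyI
      ⟨Fin.cons (l 0 + κ • l 1) fun i => l i.succ.succ, Fin.cons 1 fun i => d i.succ,
        Fin.cons 0 fun i => δ i.succ.succ + -δ 0, ?_, ?_⟩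
    · refine Fin.cases ?_ fun i => ?_
      · exact SetLike.GradedOne.one_mem
      · exact hdm i.succ
    · rw [hysum, Fin.sum_univ_succ, ← add_assoc]
      simp only [Fin.cons_zero, Fin.cons_succ]
      rw [← hκ, TensorProduct.add_tmul, Algebra.algebraMap_eq_smul_one, TensorProduct.tmul_smul,
        TensorProduct.smul_tmul']
      rfl
  · push Not at hcom
    obtain ⟨ε, c, hc, hne⟩ := hcom
    have hcd : c * d 0 - d 0 * c ∈ 𝒜 (ε + (δ 1 + -δ 0)) := by
      refine sub_mem (SetLike.mul_mem_graded hc (hdm 0)) ?_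
      rw [add_comm]
      exact SetLike.mul_mem_graded (hdm 0) hc
    -- A commutator with `c` followed by `S` kills 1 and sends `d 0` to 1. The image of `y` under
    -- this map is therefore shorter and vanishes; multiplied by `1 ⊗ d 0`, this relation removes
    -- the term of `d 0` from `y`, contradicting minimality.
    obtain ⟨S, hS, hS1⟩ := IsShift.exists_of_mem_closure (I := I)
      (hsimple _ _ hcd (sub_ne_zero.2 hne))
    have hcomm : IsShift 𝒜 I ε (LinearMap.mulLeft K c + -LinearMap.mulRight K c) :=
      (IsShift.mulLeft hc).add (IsShift.mulRight hc).neg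
    have hU := hS.comp hcomm
    set U := S ∘ₗ (LinearMap.mulLeft K c + -LinearMap.mulRight K c) with hUdef
    have hU1 : U 1 = 0 := by simp [hUdef]
    have hUd : U (d 0) = 1 := by rw [← hS1]; simp [hUdef, sub_eq_add_neg]
    have hUy : U.lTensor L y = l 1 ⊗ₜ[K] 1 + ∑ i : Fin k, l i.succ.succ ⊗ₜ[K] U (d i.succ) := by
      rw [hysum, map_add, map_add, map_sum]
      simp [hU1, hUd]
    have hUm : ∀ i, U (d i) ∈ 𝒜 (δ i.succ - δ 1) := fun i => by
      have := hU.mem _ _ (hdm i)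
      rwa [show δ i.succ + -δ 0 + (ε + -(ε + (δ 1 + -δ 0))) = δ i.succ - δ 1 by abel] at this
    have hUy0 : U.lTensor L y = 0 := by
      refine hmin (k + 1) (Nat.lt_succ_self _) _ (hU.map_mem _ hyI)
        ⟨Fin.cons (l 1) fun i => l i.succ.succ, Fin.cons 1 fun i => U (d i.succ),
        Fin.cons 0 fun i => δ i.succ.succ - δ 1, ?_, ?_⟩
      · refine Fin.cases ?_ fun i => ?_
        · exact SetLike.GradedOne.one_mem
        · exact hUm i.succ
      · rw [hUy, Fin.sum_univ_succ]
        simp only [Fin.cons_zero, Fin.cons_succ]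
    refine hmin (k + 1) (Nat.lt_succ_self _) y hyI
      ⟨Fin.cons (l 0) fun i => l i.succ.succ, Fin.cons 1 fun i => d i.succ - U (d i.succ) * d 0,
        Fin.cons 0 fun i => δ i.succ.succ + -δ 0, ?_, ?_⟩
    · refine Fin.cases ?_ fun i => ?_
      · exact SetLike.GradedOne.one_mem
      · refine sub_mem (hdm i.succ) ?_
        have := SetLike.mul_mem_graded (hUm i.succ) (hdm 0)
        rwa [show δ i.succ.succ - δ 1 + (δ (Fin.succ 0) + -δ 0) = δ i.succ.succ + -δ 0 by
          rw [Fin.succ_zero_eq_one]; abel] at this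
    · rw [Fin.sum_univ_succ, hysum]
      simp only [Fin.cons_zero, Fin.cons_succ]
      congr 1
      have h1 : l (Fin.succ 0) ⊗ₜ[K] d 0 = (l 1 ⊗ₜ[K] (1 : B)) * ((1 : L) ⊗ₜ[K] d 0) := by simp
      rw [hUy] at hUy0
      rw [h1, eq_neg_of_add_eq_zero_left hUy0, neg_mul, Finset.sum_mul, ← sub_eq_neg_add,
        ← Finset.sum_sub_distrib]
      simp [TensorProduct.tmul_sub]

end TensorSimple

/-! ### From graded simplicity to simplicity after extension to a field -/

section GradedCentralSimple

open DirectSum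

variable {Γ : Type*} [AddCommGroup Γ] [LinearOrder Γ] {K B : Type*} [CommRing K] [Ring B]
  [Algebra K B] {𝒦 : Γ → AddSubgroup K} {ℬ : Γ → AddSubgroup B} [GradedRing ℬ]

theorem closure_iUnion_eq_top : AddSubgroup.closure (⋃ γ, (ℬ γ : Set B)) = ⊤ := by
  rw [eq_top_iff]
  intro x _
  classical
  rw [← sum_support_decompose ℬ x]
  exact AddSubgroup.sum_mem _ fun γ _ => AddSubgroup.subset_closure
    (Set.mem_iUnion.2 ⟨γ, (decompose ℬ x γ).2⟩)

/-- The elements whose component in each degree ε is a sum of products abc of total degree ε form a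
homogeneous two-sided ideal containing b. By graded simplicity it contains 1, which has degree 0. -/
theorem IsGradedSimpleRing.one_mem_closure (h : IsGradedSimpleRing ℬ) {γ : Γ} {b : B}
    (hb : b ∈ ℬ γ) (hb0 : b ≠ 0) : (1 : B) ∈ AddSubgroup.closure
      {y | ∃ α β, ∃ a ∈ ℬ α, ∃ c ∈ ℬ β, α + γ + β = 0 ∧ y = a * b * c} := by
  let S : Γ → Set B := fun ε => {y | ∃ α β, ∃ a ∈ ℬ α, ∃ c ∈ ℬ β, α + γ + β = ε ∧ y = a * b * c}
  have hleft : ∀ δ, ∀ c ∈ ℬ δ, ∀ ε, ∀ y ∈ AddSubgroup.closure (S ε),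
      c * y ∈ AddSubgroup.closure (S (δ + ε)) := by
    intro δ c hc ε y hy
    induction hy using AddSubgroup.closure_induction with
    | zero => simp
    | add x y _ _ hx hy => rw [mul_add]; exact add_mem hx hy
    | neg x _ hx => rw [mul_neg]; exact neg_mem hx
    | mem x hx =>
      obtain ⟨α, β, a, ha, d, hd, rfl, rfl⟩ := hx
      exact AddSubgroup.subset_closure ⟨δ + α, β, c * a, SetLike.mul_mem_graded hc ha, d, hd,
        by abel, by simp only [mul_assoc]⟩
  have hright : ∀ δ, ∀ c ∈ ℬ δ, ∀ ε, ∀ y ∈ AddSubgroup.closure (S ε),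
      y * c ∈ AddSubgroup.closure (S (ε + δ)) := by
    intro δ c hc ε y hy
    induction hy using AddSubgroup.closure_induction with
    | zero => simp
    | add x y _ _ hx hy => rw [add_mul]; exact add_mem hx hy
    | neg x _ hx => rw [neg_mul]; exact neg_mem hx
    | mem x hx =>
      obtain ⟨α, β, a, ha, d, hd, rfl, rfl⟩ := hx
      exact AddSubgroup.subset_closure ⟨α, β + δ, a, ha, d * c, SetLike.mul_mem_graded hd hc,
        by abel, by simp only [mul_assoc]⟩
  let I : Ideal B :=
    { carrier := {x | ∀ ε, (decompose ℬ x ε : B) ∈ AddSubgroup.closure (S ε)}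
      zero_mem' := fun ε => by simp
      add_mem' := fun hx hy ε => by
        rw [decompose_add, DirectSum.add_apply]; exact add_mem (hx ε) (hy ε)
      smul_mem' := fun c x hx => by
        refine eq_of_forall_homogeneous (ℬ := ℬ) (p := fun c => ∀ ε, (decompose ℬ (c • x) ε : B) ∈
          AddSubgroup.closure (S ε)) (fun c d hc hd ε => ?_) (fun ε => by simp)
          (fun δ c hc ε => ?_) c
        · rw [add_smul, decompose_add, DirectSum.add_apply]; exact add_mem (hc ε) (hd ε)
        · have := coe_decompose_mul_add_of_left_mem ℬ (j := ε - δ) (b := x) hc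
          rw [add_sub_cancel] at this
          rw [smul_eq_mul, this]
          have h1 := hleft δ c hc _ _ (hx (ε - δ))
          rwa [add_sub_cancel] at h1 }
  have hItwo : I.IsTwoSided := by
    refine ⟨fun {x} c hx => ?_⟩
    refine eq_of_forall_homogeneous (ℬ := ℬ) (p := fun c => ∀ ε, (decompose ℬ (x * c) ε : B) ∈
      AddSubgroup.closure (S ε)) (fun c d hc hd ε => ?_) (fun ε => by simp)
      (fun δ c hc ε => ?_) c
    · rw [mul_add, decompose_add, DirectSum.add_apply]; exact add_mem (hc ε) (hd ε)
    · have := coe_decompose_mul_add_of_right_mem ℬ (i := ε - δ) (a := x) hc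
      rw [sub_add_cancel] at this
      rw [this]
      have h1 := hright δ c hc _ _ (hx (ε - δ))
      rwa [sub_add_cancel] at h1
  have hcomp : ∀ δ, ∀ x ∈ ℬ δ, x ∈ AddSubgroup.closure (S δ) → x ∈ I := by
    intro δ x hxδ hx ε
    by_cases h : δ = ε
    · subst h; rwa [decompose_of_mem_same _ hxδ]
    · rw [decompose_of_mem_ne _ hxδ h]; exact zero_mem _
  have hIhom : I.IsHomogeneous ℬ := fun ε x hx => hcomp ε _ (decompose ℬ x ε).2 (hx ε)
  have hbI : b ∈ I := hcomp γ b hb (AddSubgroup.subset_closure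
    ⟨0, 0, 1, SetLike.GradedOne.one_mem, 1, SetLike.GradedOne.one_mem, by simp, by simp⟩)
  rcases h.2 I hItwo hIhom with hI | hI
  · rw [hI, Ideal.mem_bot] at hbI
    exact absurd hbI hb0
  · have h1 : (1 : B) ∈ I := by rw [hI]; trivial
    have := h1 0
    rwa [decompose_of_mem_same _ (SetLike.GradedOne.one_mem : (1 : B) ∈ ℬ 0)] at this

theorem IsGradedCentralSimple.isSimpleRing_tensorProduct (h : IsGradedCentralSimple 𝒦 ℬ)
    (L : Type*) [Field L] [Algebra K L] [Nontrivial (L ⊗[K] B)] : IsSimpleRing (L ⊗[K] B) := by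
  refine _root_.isSimpleRing_tensorProduct (𝒜 := ℬ) closure_iUnion_eq_top
    (fun γ b hb hb0 => h.simple.one_mem_closure hb hb0) fun γ b _ hcom => (h.center_eq b).1 ?_
  rw [Subalgebra.mem_center_iff]
  exact eq_of_forall_homogeneous (ℬ := ℬ) (fun x y hx hy => by rw [add_mul, mul_add, hx, hy])
    (by simp) hcom

end GradedCentralSimple

/-- The ungraded case, obtained from the trivial grading by a one-element group. -/
theorem IsSimpleRing.tensorProduct_of_center {F A L : Type*} [Field F] [Ring A] [IsSimpleRing A]
    [Algebra F A] [Field L] [Algebra F L]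
    (hZ : ∀ z ∈ Subalgebra.center F A, ∃ c, algebraMap F A c = z) : IsSimpleRing (L ⊗[F] A) := by
  let 𝒜 : Unit → AddSubgroup A := fun _ => ⊤
  have : SetLike.GradedMonoid 𝒜 :=
    { one_mem := AddSubgroup.mem_top _
      mul_mem := fun _ _ _ _ _ _ => AddSubgroup.mem_top _ }
  refine isSimpleRing_tensorProduct (𝒜 := 𝒜) ?_ (fun _ b _ hb => ?_) fun _ b _ hcom => hZ b ?_
  · rw [eq_top_iff]
    exact fun x _ => AddSubgroup.subset_closure (Set.mem_iUnion.2 ⟨(), AddSubgroup.mem_top _⟩)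
  · let I : TwoSidedIdeal A := TwoSidedIdeal.span {b}
    have hI := IsSimpleRing.one_mem_of_ne_zero_mem I hb (TwoSidedIdeal.subset_span rfl)
    rw [TwoSidedIdeal.mem_span_iff_mem_addSubgroup_closure] at hI
    refine AddSubgroup.closure_mono ?_ hI
    rintro _ ⟨_, ⟨a, _, _, rfl, rfl⟩, c, _, rfl⟩
    exact ⟨(), (), a, AddSubgroup.mem_top _, c, AddSubgroup.mem_top _, rfl, rfl⟩
  · rw [Subalgebra.mem_center_iff]
    exact fun c => hcom () c (AddSubgroup.mem_top _)

/-! ### Full-rank independent subfamilies over a domain -/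

section Rank

/-- Over a domain a spanning family need not contain a basis, but a maximal independent subfamily
spans a submodule with torsion quotient, hence one of full rank. -/
theorem exists_linearIndependent_comp_of_span_eq_top {K M ι : Type*} [CommRing K] [IsDomain K]
    [AddCommGroup M] [Module K M] (hfin : Module.rank K M < Cardinal.aleph0) (v : ι → M)
    (hv : Submodule.span K (Set.range v) = ⊤) :
    ∃ f : Fin (Module.finrank K M) → ι, LinearIndependent K (v ∘ f) := by
  obtain ⟨s, hs, hmax⟩ := exists_maximal_linearIndepOn K v
  set P := Submodule.span K (v '' s) with hP
  have htors : ∀ x : M, ∃ a : K, a ≠ 0 ∧ a • x ∈ P := by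
    intro x
    have hx : x ∈ Submodule.span K (Set.range v) := by rw [hv]; trivial
    induction hx using Submodule.span_induction with
    | zero => exact ⟨1, one_ne_zero, by simp⟩
    | add x y _ _ hx hy =>
      obtain ⟨a, ha, hax⟩ := hx
      obtain ⟨b, hb, hby⟩ := hy
      refine ⟨a * b, mul_ne_zero ha hb, ?_⟩
      rw [smul_add]
      refine P.add_mem ?_ ?_
      · rw [mul_comm, mul_smul]; exact P.smul_mem _ hax
      · rw [mul_smul]; exact P.smul_mem _ hby
    | smul c x _ hx =>
      obtain ⟨a, ha, hax⟩ := hx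
      exact ⟨a, ha, by rw [smul_comm]; exact P.smul_mem _ hax⟩
    | mem x hx =>
      obtain ⟨i, rfl⟩ := hx
      by_cases hi : i ∈ s
      · exact ⟨1, one_ne_zero, by rw [one_smul]; exact Submodule.subset_span ⟨i, hi, rfl⟩⟩
      · exact hmax i hi
  have h0 : Module.rank K (M ⧸ P) = 0 := by
    rw [rank_eq_zero_iff]
    intro x
    obtain ⟨x, rfl⟩ := P.mkQ_surjective x
    obtain ⟨a, ha, hax⟩ := htors x
    exact ⟨a, ha, by
      rwa [← map_smul, Submodule.mkQ_apply, Submodule.Quotient.mk_eq_zero]⟩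
  have hrank : Module.finrank K P = Module.finrank K M := by
    have := P.rank_quotient_add_rank
    rw [h0, zero_add] at this
    rw [Module.finrank, this, Module.finrank]
  have hsli : LinearIndependent K (fun i : s => v i) := hs
  have hsfin : Finite s := by
    have := hsli.cardinal_lift_le_rank
    rw [← Cardinal.mk_lt_aleph0_iff]
    refine Cardinal.lift_lt_aleph0.1 (this.trans_lt ?_)
    exact Cardinal.lift_lt_aleph0.2 hfin
  have := Fintype.ofFinite s
  have hcard : Module.finrank K M = Fintype.card s := by
    rw [← hrank, ← finrank_span_eq_card hsli, hP, Set.image_eq_range]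
  let e := Fintype.equivFinOfCardEq hcard.symm
  exact ⟨fun i => e.symm i, hsli.comp _ e.symm.injective⟩

end Rank

/-! ### Classes of elements in the associated graded ring -/

namespace RingValue

variable {Γ : Type*} [AddCommGroup Γ] [LinearOrder Γ] [IsOrderedAddMonoid Γ]
  {R : Type*} [Ring R] (g : RingValue R Γ)

open Classical in
/-- The class of `x` in degree `γ`, or `0` if `g x < γ`. -/
noncomputable def lead (γ : Γ) (x : R) : g.Gr :=
  if h : x ∈ g.ge γ then DirectSum.of g.Piece γ (g.cls γ ⟨x, h⟩) else 0

variable {g} {γ δ : Γ} {x y : R}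

theorem lead_of_mem (h : x ∈ g.ge γ) :
    g.lead γ x = DirectSum.of g.Piece γ (g.cls γ ⟨x, h⟩) := dif_pos h

theorem lead_mem (γ : Γ) (x : R) : g.lead γ x ∈ g.comp γ := by
  unfold lead
  split_ifs with h
  · exact ⟨_, rfl⟩
  · exact zero_mem _

theorem lead_eq_zero_iff (h : x ∈ g.ge γ) : g.lead γ x = 0 ↔ x ∈ g.gt γ := by
  rw [lead_of_mem h, ← cls_eq_zero_iff g ⟨x, h⟩]
  exact ⟨fun h0 => DirectSum.of_injective γ (by rw [h0, map_zero]), fun h0 => by rw [h0, map_zero]⟩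

theorem lead_eq_zero_of_mem_gt (h : x ∈ g.gt γ) : g.lead γ x = 0 :=
  (lead_eq_zero_iff (g := g) (x := x) (le_of_lt (show (γ : WithTop Γ) < g x from h))).2 h

@[simp]
theorem lead_zero : g.lead γ 0 = 0 := lead_eq_zero_of_mem_gt (zero_mem _)

theorem lead_add (hx : x ∈ g.ge γ) (hy : y ∈ g.ge γ) :
    g.lead γ (x + y) = g.lead γ x + g.lead γ y := by
  rw [lead_of_mem hx, lead_of_mem hy, lead_of_mem (add_mem hx hy), ← map_add, ← map_add]
  rfl

theorem lead_neg (hx : x ∈ g.ge γ) : g.lead γ (-x) = -g.lead γ x := by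
  rw [lead_of_mem hx, lead_of_mem (neg_mem hx), ← map_neg, ← map_neg]
  rfl

theorem lead_sub (hx : x ∈ g.ge γ) (hy : y ∈ g.ge γ) :
    g.lead γ (x - y) = g.lead γ x - g.lead γ y := by
  rw [sub_eq_add_neg, lead_add hx (neg_mem hy), lead_neg hy, sub_eq_add_neg]

theorem lead_sum {ι : Type*} (s : Finset ι) (f : ι → R) (hf : ∀ i ∈ s, f i ∈ g.ge γ) :
    g.lead γ (∑ i ∈ s, f i) = ∑ i ∈ s, g.lead γ (f i) := by
  classical
  induction s using Finset.induction_on with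
  | empty => simp
  | insert a s ha ih =>
    have hs : ∀ i ∈ s, f i ∈ g.ge γ := fun i hi => hf i (Finset.mem_insert_of_mem hi)
    rw [Finset.sum_insert ha, Finset.sum_insert ha, lead_add (hf a (Finset.mem_insert_self _ _))
      (AddSubgroup.sum_mem _ hs), ih hs]

theorem lead_eq_lead_iff (hx : x ∈ g.ge γ) (hy : y ∈ g.ge γ) :
    g.lead γ x = g.lead γ y ↔ x - y ∈ g.gt γ := by
  rw [← lead_eq_zero_iff (sub_mem hx hy), lead_sub hx hy, sub_eq_zero]

theorem lead_mul (hx : x ∈ g.ge γ) (hy : y ∈ g.ge δ) :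
    g.lead γ x * g.lead δ y = g.lead (γ + δ) (x * y) := by
  rw [lead_of_mem hx, lead_of_mem hy, lead_of_mem (g.mul_mem_ge hx hy), of_mk_mul_of_mk]

theorem lead_zero_one : g.lead 0 1 = 1 := lead_of_mem g.one_mem_ge

theorem exists_eq_lead {b : g.Gr} (hb : b ∈ g.comp γ) : ∃ x ∈ g.ge γ, b = g.lead γ x := by
  obtain ⟨p, rfl⟩ := hb
  obtain ⟨x, rfl⟩ := g.cls_surjective γ p
  exact ⟨x, x.2, (lead_of_mem x.2).symm⟩

theorem ne_zero_of_lead_ne_zero (h : g.lead γ x ≠ 0) : x ≠ 0 := by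
  rintro rfl
  exact h lead_zero

theorem eq_of_lead_ne_zero (h : g.lead γ x ≠ 0) : g x = γ := by
  by_cases hx : x ∈ g.ge γ
  · exact le_antisymm (not_lt.1 fun h' => h (lead_eq_zero_of_mem_gt h')) hx
  · exact absurd (dif_neg hx) h

theorem lead_ne_zero (h : g x = γ) : g.lead γ x ≠ 0 := by
  rw [Ne, lead_eq_zero_iff (show (γ : WithTop Γ) ≤ g x from h.ge), mem_gt, h]
  exact lt_irrefl _

theorem lead_induction {p : g.Gr → Prop} (b : g.Gr) (zero : p 0)
    (lead : ∀ γ, ∀ x ∈ g.ge γ, p (g.lead γ x)) (add : ∀ x y, p x → p y → p (x + y)) : p b :=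
  gr_induction b zero (fun γ a => by rw [← lead_of_mem a.2]; exact lead γ a a.2) add

theorem exists_coe_eq (hx : x ≠ 0) : ∃ γ : Γ, g x = γ := by
  have : g x ≠ ⊤ := fun h => hx ((g.map_eq_top_iff' x).1 h)
  exact ⟨(g x).untop this, (WithTop.coe_untop _ this).symm⟩

theorem grMap_lead {S : Type*} [Ring S] {h : RingValue S Γ} (f : R →+* S)
    (hf : ∀ x, g x ≤ h (f x)) (hx : x ∈ g.ge γ) : grMap f hf (g.lead γ x) = h.lead γ (f x) := by
  rw [lead_of_mem hx, grMap_of_mk, lead_of_mem (show f x ∈ h.ge γ from le_trans hx (hf x))]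

end RingValue

/-! ### The graded field gr(F) and dimensions over it -/

namespace SurmultValueFunction

open RingValue

variable {Γ : Type*} [AddCommGroup Γ] [LinearOrder Γ] [IsOrderedAddMonoid Γ]
  {F : Type*} [Field F] {v : AddValuation F (WithTop Γ)}

section Field

theorem exists_grField_inv {γ : Γ} {c : grField v} (hc : c ∈ grFieldComp v γ) (h0 : c ≠ 0) :
    ∃ d ∈ grFieldComp v (-γ), c * d = 1 := by
  obtain ⟨x, hx, rfl⟩ := exists_eq_lead hc
  have hv : v x = γ := eq_of_lead_ne_zero h0
  have hx0 : x ≠ 0 := ne_zero_of_lead_ne_zero h0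
  have hinv : v x⁻¹ = ((-γ : Γ) : WithTop Γ) := by
    have h1 : v x + v x⁻¹ = 0 := by rw [← v.map_mul, mul_inv_cancel₀ hx0, v.map_one]
    have hne : v x⁻¹ ≠ ⊤ := fun h => by rw [h] at h1; simp at h1
    obtain ⟨β, hβ⟩ := WithTop.ne_top_iff_exists.1 hne
    rw [hv, ← hβ, ← WithTop.coe_add] at h1
    have : γ + β = 0 := WithTop.coe_injective h1
    rw [← hβ, eq_neg_of_add_eq_zero_right this]
  have hmem : x⁻¹ ∈ (ofAddValuation v).ge (-γ) := hinv.ge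
  refine ⟨(ofAddValuation v).lead (-γ) x⁻¹, lead_mem _ _, ?_⟩
  rw [lead_mul hx hmem, mul_inv_cancel₀ hx0, add_neg_cancel, lead_zero_one]

theorem isUnit_of_mem_grFieldComp (γ : Γ) (c : grField v) (hc : c ∈ grFieldComp v γ)
    (h0 : c ≠ 0) : IsUnit c := by
  obtain ⟨d, _, hd⟩ := exists_grField_inv hc h0
  exact IsUnit.of_mul_eq_one d hd

instance : Nontrivial (grField v) := by
  refine ⟨1, 0, ?_⟩
  rw [← lead_zero_one]
  exact lead_ne_zero v.map_one

/-- As Γ is ordered, primeness of the zero ideal can be tested on homogeneous elements, and the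
nonzero ones are units. -/
instance : IsDomain (grField v) := by
  have : (⊥ : Ideal (grField v)).IsPrime := by
    refine (Ideal.IsHomogeneous.bot (grFieldComp v)).isPrime_of_homogeneous_mem_or_mem
      bot_ne_top ?_
    rintro x y ⟨γ, hx⟩ - hxy
    rw [Ideal.mem_bot, Ideal.mem_bot, or_iff_not_imp_left]
    intro h0
    exact (isUnit_of_mem_grFieldComp γ x hx h0).mul_right_eq_zero.1 hxy
  have : NoZeroDivisors (grField v) := ⟨fun {a b} h => by
    simpa using this.mem_or_mem (x := a) (y := b) (by simpa using h)⟩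
  exact NoZeroDivisors.to_isDomain _

end Field

variable {A : Type*} [Ring A] [Algebra F A] {g : SurmultValueFunction v A}

theorem algebraMap_lead {γ : Γ} {c : F} (hc : c ∈ (ofAddValuation v).ge γ) :
    algebraMap (grField v) g.gr ((ofAddValuation v).lead γ c) = g.lead γ (algebraMap F A c) :=
  grMap_lead (algebraMap F A) g.le_map_algebraMap hc

theorem algebraMap_mem_grComp (γ : Γ) (c : grField v) (hc : c ∈ grFieldComp v γ) :
    algebraMap (grField v) g.gr c ∈ g.grComp γ := by
  obtain ⟨x, hx, rfl⟩ := exists_eq_lead hc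
  rw [algebraMap_lead hx]
  exact lead_mem _ _

theorem algebraMap_mem_ge {γ : Γ} {c : F} (hc : c ∈ (ofAddValuation v).ge γ) :
    algebraMap F A c ∈ g.ge γ := by
  rw [mem_ge]
  exact le_trans hc (g.le_map_algebraMap c)

theorem smul_mem_ge {γ δ : Γ} {c : F} {x : A} (hc : c ∈ (ofAddValuation v).ge γ)
    (hx : x ∈ g.ge δ) : c • x ∈ g.ge (γ + δ) := by
  rw [Algebra.smul_def]
  exact g.mul_mem_ge (algebraMap_mem_ge hc) hx

theorem lead_smul {γ δ : Γ} {c : F} {x : A} (hc : c ∈ (ofAddValuation v).ge γ)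
    (hx : x ∈ g.ge δ) :
    (ofAddValuation v).lead γ c • g.lead δ x = g.lead (γ + δ) (c • x) := by
  rw [Algebra.smul_def, algebraMap_lead hc, lead_mul (algebraMap_mem_ge hc) hx, ← Algebra.smul_def]

/-- Elements with linearly independent classes are linearly independent. -/
theorem linearIndependent_of_lead {ι : Type*} [Finite ι] {x : ι → A} {γ : ι → Γ}
    (hx : ∀ i, x i ∈ g.ge (γ i)) {M : Type*} [AddCommGroup M] [Module (grField v) M]
    (π : g.gr →ₗ[grField v] M) {U : Type*} [AddCommGroup U] [Module F U] (φ : A →ₗ[F] U)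
    (hπ : ∀ δ, ∀ y ∈ g.ge δ, φ y = 0 → π (g.lead δ y) = 0)
    (hli : LinearIndependent (grField v) (fun i => π (g.lead (γ i) (x i)))) :
    LinearIndependent F (fun i => φ (x i)) := by
  classical
  have := Fintype.ofFinite ι
  rw [Fintype.linearIndependent_iff] at hli ⊢
  intro c hc
  by_contra! hne
  have hs : (Finset.univ.filter fun i => c i ≠ 0).Nonempty := by
    obtain ⟨i, hi⟩ := hne
    exact ⟨i, by simp [hi]⟩
  have hfin : ∀ i, c i ≠ 0 → ∃ β : Γ, v (c i) = β := fun i hi =>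
    exists_coe_eq (g := ofAddValuation v) hi
  -- With ε the least value of the terms, taking classes in degree ε turns the relation over F into
  -- one over gr(F) whose j-th coefficient is nonzero.
  obtain ⟨j, hj, hmin⟩ := Finset.exists_min_image _ (fun i => v (c i) + (γ i : WithTop Γ)) hs
  rw [Finset.mem_filter] at hj
  obtain ⟨β, hβ⟩ := hfin j hj.2
  set ε := β + γ j with hε
  have hcm : ∀ i, c i ∈ (ofAddValuation v).ge (ε - γ i) := by
    intro i
    by_cases hi : c i = 0
    · rw [hi]; exact zero_mem _
    · have h1 := hmin i (by simp [hi])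
      obtain ⟨β', hβ'⟩ := hfin i hi
      change ((ε - γ i : Γ) : WithTop Γ) ≤ v (c i)
      simp only [hβ, hβ'] at h1 ⊢
      norm_cast at h1 ⊢
      rw [hε]
      exact sub_le_iff_le_add.2 h1
  have hsm : ∀ i, c i • x i ∈ g.ge ε := fun i => by
    have := smul_mem_ge (hcm i) (hx i)
    rwa [sub_add_cancel] at this
  have hk := hli (fun i => (ofAddValuation v).lead (ε - γ i) (c i)) (by
    simp_rw [← map_smul, lead_smul (hcm _) (hx _), sub_add_cancel]
    rw [← map_sum, ← lead_sum _ _ fun i _ => hsm i]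
    refine hπ ε _ (AddSubgroup.sum_mem _ fun i _ => hsm i) ?_
    rw [map_sum]
    simpa using hc) j
  rw [hε, add_sub_cancel_right] at hk
  exact lead_ne_zero (g := ofAddValuation v) hβ hk

variable (g) in
/-- The `gr(F)`-submodule `gr(W)` of `gr_g(A)` spanned by the classes of the elements of `W`. -/
def grSub (W : Submodule F A) : Submodule (grField v) g.gr :=
  Submodule.span (grField v) {b | ∃ γ, ∃ x ∈ W, x ∈ g.ge γ ∧ b = g.lead γ x}

theorem lead_mem_grSub {W : Submodule F A} {γ : Γ} {x : A} (hx : x ∈ W) :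
    g.lead γ x ∈ g.grSub W := by
  by_cases h : x ∈ g.ge γ
  · exact Submodule.subset_span ⟨γ, x, hx, h, rfl⟩
  · rw [lead, dif_neg h]
    exact zero_mem _

open DirectSum in
theorem decompose_mem_grSub (W : Submodule F A) :
    ∀ x ∈ g.grSub W, ∀ γ, (decompose g.grComp x γ : g.gr) ∈ g.grSub W :=
  decompose_mem_span (𝒦 := grFieldComp v) algebraMap_mem_grComp (by
    rintro _ ⟨γ, x, -, -, rfl⟩
    exact ⟨γ, lead_mem _ _⟩)

section Norm

/-- The classes of a splitting base form a base: the value of a sum is the least value of its terms,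
so a homogeneous relation between the classes lifts to a sum whose terms all have too large a value,
and an element of value at least δ expands in terms of value at least δ. -/
theorem exists_basis_of_isNorm (hg : g.IsNorm) :
    ∃ (n : ℕ), Module.finrank F A = n ∧ Nonempty (Module.Basis (Fin n) (grField v) g.gr) := by
  obtain ⟨n, e, he⟩ := hg
  refine ⟨n, by rw [Module.finrank_eq_card_basis e, Fintype.card_fin], ?_⟩
  choose γ hγ using fun i => exists_coe_eq (g := g.toRingValue) (e.ne_zero i)
  have hmem : ∀ i, e i ∈ g.ge (γ i) := fun i => (hγ i).ge
  have hge : ∀ (c : Fin n → F) (δ : Γ), ∑ i, c i • e i ∈ g.ge δ →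
      ∀ i, c i ∈ (ofAddValuation v).ge (δ - γ i) := by
    intro c δ h i
    rw [mem_ge] at h ⊢
    have h1 : (δ : WithTop Γ) ≤ g (c i • e i) :=
      h.trans ((he c).le.trans (Finset.inf_le (Finset.mem_univ i)))
    rw [g.map_smul', hγ] at h1
    change _ ≤ v (c i)
    by_cases hc : c i = 0
    · simp [hc]
    · obtain ⟨β, hβ⟩ := exists_coe_eq (g := ofAddValuation v) hc
      change v (c i) = β at hβ
      rw [hβ] at h1 ⊢
      norm_cast at h1 ⊢
      exact sub_le_iff_le_add.2 (h1.trans_eq (add_comm _ _))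
  have hgt : ∀ (c : Fin n → F) (δ : Γ), ∑ i, c i • e i ∈ g.gt δ →
      ∀ i, c i ∈ (ofAddValuation v).gt (δ - γ i) := by
    intro c δ h i
    rw [mem_gt] at h ⊢
    have h1 : (δ : WithTop Γ) < g (c i • e i) :=
      h.trans_le ((he c).le.trans (Finset.inf_le (Finset.mem_univ i)))
    rw [g.map_smul', hγ] at h1
    change _ < v (c i)
    by_cases hc : c i = 0
    · rw [hc, v.map_zero]; exact WithTop.coe_lt_top _
    · obtain ⟨β, hβ⟩ := exists_coe_eq (g := ofAddValuation v) hc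
      change v (c i) = β at hβ
      rw [hβ] at h1 ⊢
      norm_cast at h1 ⊢
      exact sub_lt_iff_lt_add.2 (h1.trans_eq (add_comm _ _))
  refine ⟨Module.Basis.mk (v := fun i => g.lead (γ i) (e i)) ?_ ?_⟩
  · rw [Fintype.linearIndependent_iff]
    intro k hk
    have hcomp : ∀ δ i, ((DirectSum.decompose (grFieldComp v) (k i) (δ - γ i)) : grField v) = 0 := by
      intro δ
      choose c hc hkc using fun i => exists_eq_lead
        (SetLike.coe_mem (DirectSum.decompose (grFieldComp v) (k i) (δ - γ i)))
      have h1 : ∑ i, g.lead δ (c i • e i) = 0 := by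
        have h2 := congrArg (fun b => (DirectSum.decompose g.grComp b δ : g.gr)) hk
        simp only [DirectSum.decompose_sum, DirectSum.decompose_zero] at h2
        rw [DFinsupp.finsetSum_apply] at h2
        simp only [AddSubmonoidClass.coe_finsetSum, DirectSum.zero_apply,
          ZeroMemClass.coe_zero] at h2
        rw [← h2]
        refine Finset.sum_congr rfl fun i _ => ?_
        have h3 := decompose_smul_add (ℬ := g.grComp) (𝒦 := grFieldComp v) algebraMap_mem_grComp
          (k i) (lead_mem (g := g.toRingValue) (γ i) (e i)) (δ - γ i)
        rw [sub_add_cancel] at h3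
        rw [h3, hkc, lead_smul (hc i) (hmem i), sub_add_cancel]
      have hsm : ∀ i, c i • e i ∈ g.ge δ := fun i => by
        have := smul_mem_ge (hc i) (hmem i)
        rwa [sub_add_cancel] at this
      rw [← lead_sum _ _ fun i _ => hsm i, lead_eq_zero_iff (AddSubgroup.sum_mem _ fun i _ => hsm i)]
        at h1
      intro i
      rw [hkc]
      exact lead_eq_zero_of_mem_gt (hgt c δ h1 i)
    intro i
    rw [← (DirectSum.decompose (grFieldComp v)).injective.eq_iff, DirectSum.decompose_zero]
    ext δ : 2
    have := hcomp (δ + γ i) i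
    rwa [add_sub_cancel_right] at this
  · intro b _
    induction b using lead_induction with
    | zero => exact zero_mem _
    | add x y hx hy => exact add_mem (hx trivial) (hy trivial)
    | lead δ x hx =>
      rw [← e.sum_repr x] at hx ⊢
      have hc := hge _ _ hx
      have hsm : ∀ i, e.repr x i • e i ∈ g.ge δ := fun i => by
        have := smul_mem_ge (hc i) (hmem i)
        rwa [sub_add_cancel] at this
      rw [lead_sum _ _ fun i _ => hsm i]
      refine Submodule.sum_mem _ fun i _ => ?_
      have := lead_smul (hc i) (hmem i)
      rw [sub_add_cancel] at this
      rw [← this]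
      exact Submodule.smul_mem _ _ (Submodule.subset_span ⟨i, rfl⟩)

theorem IsNorm.finite_gr (hg : g.IsNorm) : Module.Finite (grField v) g.gr := by
  obtain ⟨n, _, ⟨b⟩⟩ := exists_basis_of_isNorm hg
  exact Module.Finite.of_basis b

theorem IsNorm.free_gr (hg : g.IsNorm) : Module.Free (grField v) g.gr := by
  obtain ⟨n, _, ⟨b⟩⟩ := exists_basis_of_isNorm hg
  exact Module.Free.of_basis b

theorem IsNorm.finrank_gr (hg : g.IsNorm) :
    Module.finrank (grField v) g.gr = Module.finrank F A := by
  obtain ⟨n, hn, ⟨b⟩⟩ := exists_basis_of_isNorm hg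
  rw [hn, Module.finrank_eq_card_basis b, Fintype.card_fin]

theorem span_lead_eq_top : Submodule.span (grField v)
    (Set.range fun p : {p : Γ × A // p.2 ∈ g.ge p.1} => g.lead p.1.1 p.1.2) = ⊤ := by
  rw [eq_top_iff]
  intro b _
  induction b using lead_induction with
  | zero => exact zero_mem _
  | add x y hx hy => exact add_mem (hx trivial) (hy trivial)
  | lead δ x hx => exact Submodule.subset_span ⟨⟨(δ, x), hx⟩, rfl⟩

/-- `gr(W)` has the same dimension as `W`. -/
theorem IsNorm.finrank_grSub [FiniteDimensional F A] (hg : g.IsNorm) (W : Submodule F A) :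
    Module.finrank (grField v) (g.grSub W) = Module.finrank F W := by
  have := hg.finite_gr
  -- Elements with independent classes are independent, which bounds the rank of gr(W) and, below,
  -- that of its quotient. Since gr_g(A) and A have the same dimension, additivity makes both bounds
  -- equalities.
  have hle : Module.finrank (grField v) (g.grSub W) ≤ Module.finrank F W := by
    obtain ⟨f, hf⟩ := exists_linearIndependent_comp_of_span_eq_top (K := grField v)
      (M := g.grSub W) ((Submodule.rank_le _).trans_lt (Module.rank_lt_aleph0 _ g.gr))
      (fun p : {p : Γ × A // p.2 ∈ W ∧ p.2 ∈ g.ge p.1} =>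
        (⟨g.lead p.1.1 p.1.2, lead_mem_grSub p.2.1⟩ : g.grSub W)) (by
        apply Submodule.map_injective_of_injective (g.grSub W).injective_subtype
        rw [Submodule.map_span, Submodule.map_top, Submodule.range_subtype, ← Set.range_comp]
        refine congrArg (Submodule.span (grField v)) (?_ : _ =
          {b | ∃ γ, ∃ x ∈ W, x ∈ g.ge γ ∧ b = g.lead γ x})
        ext b
        constructor
        · rintro ⟨⟨⟨γ, x⟩, hxW, hx⟩, rfl⟩
          exact ⟨γ, x, hxW, hx, rfl⟩
        · rintro ⟨γ, x, hxW, hx, rfl⟩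
          exact ⟨⟨(γ, x), hxW, hx⟩, rfl⟩)
    have h1 := hf.map' (g.grSub W).subtype (g.grSub W).ker_subtype
    have h2 := linearIndependent_of_lead (g := g) (x := fun i => (f i).1.2) (γ := fun i => (f i).1.1)
      (fun i => (f i).2.2) LinearMap.id (LinearMap.id : A →ₗ[F] A)
      (fun δ y hy h0 => by
        rw [LinearMap.id_apply] at h0
        rw [h0, lead_zero, map_zero]) h1
    have h3 : LinearIndependent F (fun i => (⟨(f i).1.2, (f i).2.1⟩ : W)) :=
      LinearIndependent.of_comp W.subtype h2
    simpa using h3.fintype_card_le_finrank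
  have hle' : Module.finrank (grField v) (g.gr ⧸ g.grSub W) ≤ Module.finrank F (A ⧸ W) := by
    obtain ⟨f, hf⟩ := exists_linearIndependent_comp_of_span_eq_top (K := grField v)
      (M := g.gr ⧸ g.grSub W) (Module.rank_lt_aleph0 _ _)
      (fun p : {p : Γ × A // p.2 ∈ g.ge p.1} => (g.grSub W).mkQ (g.lead p.1.1 p.1.2)) (by
        rw [Set.range_comp' (g.grSub W).mkQ, ← Submodule.map_span, span_lead_eq_top,
          Submodule.map_top, Submodule.range_mkQ])
    have h2 := linearIndependent_of_lead (g := g) (x := fun i => (f i).1.2) (γ := fun i => (f i).1.1)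
      (fun i => (f i).2) (g.grSub W).mkQ W.mkQ
      (fun δ y hy h0 => by
        rw [Submodule.mkQ_apply, Submodule.Quotient.mk_eq_zero] at h0 ⊢
        exact lead_mem_grSub h0) hf
    simpa using h2.fintype_card_le_finrank
  have h1 := (g.grSub W).finrank_quotient_add_finrank
  have h2 := W.finrank_quotient_add_finrank
  rw [hg.finrank_gr] at h1
  omega

end Norm

end SurmultValueFunction

namespace RingValue

variable {Γ : Type*} [AddCommGroup Γ] [LinearOrder Γ] [IsOrderedAddMonoid Γ]
  {R : Type*} [Ring R] {g : RingValue R Γ} {γ δ : Γ} {x y : R}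

theorem gt_le_ge (h : x ∈ g.gt γ) : x ∈ g.ge γ := le_of_lt (show (γ : WithTop Γ) < g x from h)

theorem notMem_gt_iff (h : x ∈ g.ge γ) : x ∉ g.gt γ ↔ g x = γ :=
  ⟨fun h' => le_antisymm (not_lt.1 h') h, fun h' h'' => by
    rw [mem_gt, h'] at h''
    exact lt_irrefl _ h''⟩

theorem notMem_gt (h : g x = γ) : x ∉ g.gt γ := (notMem_gt_iff h.ge).2 h

theorem eq_of_sub_mem_gt (h : g x = γ) (hxy : x - y ∈ g.gt γ) : g y = γ := by
  have hx : x ∈ g.ge γ := h.ge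
  have hy : y ∈ g.ge γ := by
    have := sub_mem hx (gt_le_ge hxy)
    rwa [sub_sub_cancel] at this
  rw [← notMem_gt_iff hy]
  intro hy'
  have := add_mem hxy hy'
  rw [sub_add_cancel] at this
  exact notMem_gt h this

theorem mem_ge_of_eq (h : g x = γ) : x ∈ g.ge γ := h.ge

theorem mul_mem_ge' {ε : Γ} (hx : x ∈ g.ge γ) (hy : y ∈ g.ge δ) (h : γ + δ = ε) :
    x * y ∈ g.ge ε := h ▸ g.mul_mem_ge hx hy

end RingValue

open RingValue

/-! ### Extensions of a valuation to a quadratic extension -/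

section Quadratic

variable {Γ : Type*} [AddCommGroup Γ] [LinearOrder Γ] [IsOrderedAddMonoid Γ]
  {F : Type*} [Field F] {v : AddValuation F (WithTop Γ)} {Z : Type*} [CommRing Z]
  [Algebra F Z] {s : Z →ₐ[F] Z} {h : SurmultValueFunction v Z}

/-- The nontrivial automorphism of a quadratic extension, leaving invariant a value function
such that `h (z ^ 2) = 2 h z`. -/
structure IsQuadraticConj (s : Z →ₐ[F] Z) (h : SurmultValueFunction v Z) : Prop where
  invol : ∀ z, s (s z) = z
  fixed : ∀ z, s z = z → ∃ c : F, algebraMap F Z c = z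
  invariant : ∀ z, h (s z) = h z
  sq : ∀ z, h (z * z) = h z + h z

namespace IsQuadraticConj

variable (H : IsQuadraticConj s h)

include H

theorem exists_norm (z : Z) : ∃ c : F, algebraMap F Z c = z * s z :=
  H.fixed _ (by rw [map_mul, H.invol, mul_comm])

theorem exists_trace (z : Z) : ∃ c : F, algebraMap F Z c = z + s z :=
  H.fixed _ (by rw [map_add, H.invol, add_comm])

theorem map_ne_zero {z : Z} (hz : z ≠ 0) : s z ≠ 0 := fun h0 => hz (by
  rw [← H.invol z, h0, map_zero])

/-- Suppose w(z) < γ = h(z). The norm of z lies in F and has value at least 2γ, so w(s(z)) > w(z),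
and the trace of z has w-value w(z) < γ. But the trace also lies in F, and its value is at least γ.
-/
theorem le_extension {w : AddValuation Z (WithTop Γ)} (hw : w ∈ valuationExtensions v Z) (z : Z) :
    h z ≤ w z := by
  by_contra! hlt
  have hz : z ≠ 0 := by
    rintro rfl
    rw [w.map_zero] at hlt
    exact not_top_lt hlt
  obtain ⟨γ, hγ⟩ := exists_coe_eq (g := h.toRingValue) hz
  have hsz : h (s z) = γ := (H.invariant z).trans hγ
  obtain ⟨α, hα⟩ := WithTop.ne_top_iff_exists.1 hlt.ne_top
  obtain ⟨c, hc⟩ := H.exists_norm z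
  obtain ⟨t, ht⟩ := H.exists_trace z
  have h1 : ((γ + γ : Γ) : WithTop Γ) ≤ w z + w (s z) := by
    rw [← w.map_mul, ← hc, hw c, ← h.map_algebraMap, hc]
    exact h.mul_mem_ge (x := z) (y := s z) hγ.ge hsz.ge
  have h2 : (γ : WithTop Γ) ≤ w (z + s z) := by
    rw [← ht, hw t, ← h.map_algebraMap, ht]
    exact add_mem (mem_ge_of_eq hγ) (mem_ge_of_eq hsz)
  have h3 : w z < w (s z) := by
    rw [hγ, ← hα] at hlt
    rw [← hα] at h1 ⊢
    by_cases htop : w (s z) = ⊤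
    · rw [htop]; exact WithTop.coe_lt_top _
    · obtain ⟨β, hβ⟩ := WithTop.ne_top_iff_exists.1 htop
      rw [← hβ] at h1 ⊢
      norm_cast at h1 hlt ⊢
      grind
  rw [w.map_add_eq_of_lt_left h3, ← hγ] at h2
  exact absurd hlt h2.not_gt

/-- If `h (N z) = 2 h z` for all `z`, then `h` is the unique extension of `v`. -/
theorem map_mul_of_norm [IsDomain Z] (hN : ∀ z, h (z * s z) = h z + h z) (x y : Z) :
    h (x * y) = h x + h y := by
  by_cases hx : x = 0
  · rw [hx, zero_mul, (h.map_eq_top_iff' 0).2 rfl, top_add]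
  by_cases hy : y = 0
  · rw [hy, mul_zero, (h.map_eq_top_iff' 0).2 rfl, add_top]
  obtain ⟨α, hα⟩ := exists_coe_eq (g := h.toRingValue) hx
  obtain ⟨β, hβ⟩ := exists_coe_eq (g := h.toRingValue) hy
  obtain ⟨γ, hγ⟩ := exists_coe_eq (g := h.toRingValue) (mul_ne_zero hx hy)
  obtain ⟨a, ha⟩ := H.exists_norm x
  obtain ⟨b, hb⟩ := H.exists_norm y
  have h1 := hN (x * y)
  have h2 : x * y * s (x * y) = algebraMap F Z (a * b) := by
    rw [map_mul, map_mul, ha, hb]; ring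
  rw [h2, h.map_algebraMap, v.map_mul, ← h.map_algebraMap, ← h.map_algebraMap, ha, hb, hN, hN] at h1
  rw [hα, hβ, hγ] at h1 ⊢
  norm_cast at h1 ⊢
  grind

/-- The function h is itself an extension. Any extension w satisfies w ≥ h at z and at s(z), while
w(z) + w(s(z)) is the value of the norm, namely 2h(z); so both inequalities are equalities. -/
theorem encard_eq_one [IsDomain Z] (hN : ∀ z, h (z * s z) = h z + h z) :
    (valuationExtensions v Z).encard = 1 := by
  rw [Set.encard_eq_one]
  refine ⟨AddValuation.of h ((h.map_eq_top_iff' 0).2 rfl) h.map_one' h.min_le_map_add'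
    (H.map_mul_of_norm hN), ?_⟩
  ext w
  constructor
  · intro hw
    ext z
    change w z = h z
    by_cases hz : z = 0
    · rw [hz, w.map_zero, (h.map_eq_top_iff' 0).2 rfl]
    obtain ⟨c, hc⟩ := H.exists_norm z
    obtain ⟨γ, hγ⟩ := exists_coe_eq (g := h.toRingValue) hz
    have h1 : w z + w (s z) = h z + h z := by
      rw [← hN, ← w.map_mul, ← hc, hw c, h.map_algebraMap]
    have h2 := H.le_extension hw z
    have h3 := H.le_extension hw (s z)
    rw [H.invariant] at h3
    rw [hγ] at *
    refine le_antisymm ?_ h2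
    by_contra! hlt
    have h4 : (γ : WithTop Γ) + γ < w z + w (s z) :=
      WithTop.add_lt_add_of_lt_of_le WithTop.coe_ne_top hlt h3
    rw [h1] at h4
    exact lt_irrefl _ h4
  · rintro rfl c
    exact h.map_algebraMap c

end IsQuadraticConj

/-- An element whose class is a nontrivial idempotent of `gr(Z)`. -/
structure IsSplitting (s : Z →ₐ[F] Z) (h : SurmultValueFunction v Z) (e : Z) : Prop where
  add_conj : e + s e = 1
  mul_conj : e * s e ∈ h.gt 0
  map_eq : h e = 0

/-- If the norm of z has value above 2γ, where γ = h(z), then z² = tz - z s(z), with t the trace,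
gives h(tz) = h(z²) = 2γ. So v(t) = γ, and e = t⁻¹z has trace 1, value 0 and a norm of positive
value. -/
theorem IsQuadraticConj.exists_isSplitting (H : IsQuadraticConj s h)
    (hN : ¬ ∀ z, h (z * s z) = h z + h z) : ∃ e, IsSplitting s h e := by
  push Not at hN
  obtain ⟨z, hz⟩ := hN
  have hz0 : z ≠ 0 := by
    rintro rfl
    apply hz
    rw [zero_mul, (h.map_eq_top_iff' 0).2 rfl, top_add]
  obtain ⟨γ, hγ⟩ := exists_coe_eq (g := h.toRingValue) hz0
  have hsz : h (s z) = γ := (H.invariant z).trans hγ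
  obtain ⟨t, ht⟩ := H.exists_trace z
  have hn : z * s z ∈ h.gt (γ + γ) := by
    by_contra hn
    apply hz
    rw [(notMem_gt_iff (h.mul_mem_ge hγ.ge hsz.ge)).1 hn, hγ]
    rfl
  have h1 : h (t • z) = ((γ + γ : Γ) : WithTop Γ) := by
    have hsq := H.sq z
    rw [hγ] at hsq
    refine eq_of_sub_mem_gt (g := h.toRingValue) hsq ?_
    rw [Algebra.smul_def, ht, show z * z - (z + s z) * z = -(z * s z) by ring]
    exact neg_mem hn
  rw [h.map_smul', hγ] at h1
  have htγ : v t = γ := by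
    by_cases htop : v t = ⊤
    · rw [htop, WithTop.add_top] at h1
      exact absurd h1.symm WithTop.coe_ne_top
    · obtain ⟨β, hβ⟩ := WithTop.ne_top_iff_exists.1 htop
      rw [← hβ] at h1 ⊢
      norm_cast at h1 ⊢
      exact add_left_cancel h1
  have ht0 : t ≠ 0 := by
    rintro rfl
    rw [v.map_zero] at htγ
    simp at htγ
  have hinv : v t⁻¹ = ((-γ : Γ) : WithTop Γ) := by
    have h1 : v t + v t⁻¹ = 0 := by rw [← v.map_mul, mul_inv_cancel₀ ht0, v.map_one]
    have hne : v t⁻¹ ≠ ⊤ := fun h => by rw [h] at h1; simp at h1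
    obtain ⟨β, hβ⟩ := WithTop.ne_top_iff_exists.1 hne
    rw [htγ, ← hβ, ← WithTop.coe_add] at h1
    have : γ + β = 0 := WithTop.coe_injective h1
    rw [← hβ, eq_neg_of_add_eq_zero_right this]
  refine ⟨t⁻¹ • z, ?_, ?_, ?_⟩
  · rw [map_smul, ← smul_add, ← ht, Algebra.algebraMap_eq_smul_one, smul_smul, inv_mul_cancel₀ ht0,
      one_smul]
  · rw [map_smul, smul_mul_smul_comm, Algebra.smul_def]
    have h2 : algebraMap F Z (t⁻¹ * t⁻¹) ∈ h.ge (-γ + -γ) := by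
      rw [map_mul]
      have h3 : algebraMap F Z t⁻¹ ∈ h.ge (-γ) := by
        rw [mem_ge]
        exact ((h.map_algebraMap _).trans hinv).ge
      exact h.mul_mem_ge h3 h3
    have h4 := h.mul_mem_gt_right h2 hn
    rwa [show -γ + -γ + (γ + γ) = 0 by abel] at h4
  · rw [h.map_smul', hγ, hinv]
    norm_cast
    rw [add_neg_cancel]

namespace IsSplitting

variable {e : Z} (H : IsQuadraticConj s h) (E : IsSplitting s h e)

include E

theorem mem_ge : e ∈ h.ge 0 := E.map_eq.ge

theorem one_sub : s e = 1 - e := eq_sub_of_add_eq' E.add_conj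

theorem self_sub_mul_self_mem : e - e * e ∈ h.gt 0 := by
  have := E.mul_conj
  rwa [E.one_sub, mul_sub, mul_one] at this

include H

/-- Modulo elements of higher value, `z e` is an `F`-multiple of `e`. -/
theorem exists_smul {γ : Γ} {x : Z} (hx : x ∈ h.ge γ) :
    ∃ a ∈ (ofAddValuation v).ge γ, x * e - a • e ∈ h.gt γ := by
  -- The scalar is the trace of xe. Since e + s(e) = 1, the difference xe - ae equals (x - s(x)) e
  -- s(e), and e s(e) has positive value.
  obtain ⟨a, ha⟩ := H.exists_trace (x * e)
  have hxe : x * e ∈ h.ge γ := mul_mem_ge' hx E.mem_ge (add_zero γ)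
  refine ⟨a, ?_, ?_⟩
  · change _ ≤ v a
    rw [← h.map_algebraMap, ha]
    refine (h.ge γ).add_mem hxe ?_
    rw [RingValue.mem_ge]
    exact le_of_le_of_eq hxe (H.invariant _).symm
  · have hsx : s x ∈ h.ge γ := by
      rw [RingValue.mem_ge]
      exact le_of_le_of_eq hx (H.invariant _).symm
    have h1 := h.mul_mem_gt_right ((h.ge γ).sub_mem hx hsx) E.mul_conj
    rw [add_zero] at h1
    have h2 : x * e - a • e = (x - s x) * (e * s e) := by
      rw [Algebra.smul_def, ha, map_mul]
      linear_combination (-x * e) * E.add_conj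
    rwa [h2]

omit H in
/-- The class of `x` or that of its conjugate is not annihilated by the class of `e`. -/
theorem exists_conj_of_ne_zero (H : IsQuadraticConj s h) {x : Z} (hx : x ≠ 0) :
    h (x * e) = h x ∨ h (s x * e) = h (s x) := by
  obtain ⟨γ, hγ⟩ := exists_coe_eq (g := h.toRingValue) hx
  have hsx : h (s x) = γ := (H.invariant x).trans hγ
  rw [hγ, hsx, ← notMem_gt_iff (mul_mem_ge' (mem_ge_of_eq hγ) E.mem_ge (add_zero γ)),
    ← notMem_gt_iff (mul_mem_ge' (mem_ge_of_eq hsx) E.mem_ge (add_zero γ))]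
  by_contra! hcon
  have h1 : x * s e ∈ h.gt γ := by
    have := hcon.2
    rw [mem_gt] at this ⊢
    rwa [← H.invariant, map_mul, H.invol]
  have := add_mem hcon.1 h1
  rw [← mul_add, E.add_conj, mul_one] at this
  exact notMem_gt hγ this

theorem exists_smul_of_eq {γ : Γ} {x : Z} (hx : h x = γ) (hxe : h (x * e) = γ) :
    ∃ a, v a = γ ∧ x * e - a • e ∈ h.gt γ := by
  obtain ⟨a, -, ha⟩ := E.exists_smul H (mem_ge_of_eq hx)
  have h1 := eq_of_sub_mem_gt hxe ha
  rw [h.map_smul', E.map_eq, zero_add] at h1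
  exact ⟨a, h1, ha⟩

/-- Up to terms of higher value, xe and ye are ae and be with a, b in F, and e² is e; so xye agrees
with abe, where v is multiplicative. As h(e) = 0, the value of xy cannot exceed that of xye. -/
theorem map_mul_of_eq {α β : Γ} {x y : Z} (hx : h x = α) (hxe : h (x * e) = α)
    (hy : h y = β) (hye : h (y * e) = β) :
    h (x * y) = ((α + β : Γ) : WithTop Γ) ∧ h (x * y * e) = ((α + β : Γ) : WithTop Γ) := by
  obtain ⟨a, ha, hax⟩ := E.exists_smul_of_eq H hx hxe
  obtain ⟨b, hb, hby⟩ := E.exists_smul_of_eq H hy hye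
  have hae : h (a • e) = α := by rw [h.map_smul', E.map_eq, zero_add, ha]
  have hab : h ((a * b) • e) = ((α + β : Γ) : WithTop Γ) := by
    rw [h.map_smul', E.map_eq, zero_add, v.map_mul, ha, hb, WithTop.coe_add]
  have hxy : x * y ∈ h.ge (α + β) := h.mul_mem_ge hx.ge hy.ge
  have hab' : algebraMap F Z (a * b) ∈ h.ge (α + β) := by
    rw [RingValue.mem_ge, h.map_algebraMap, v.map_mul, ha, hb, WithTop.coe_add]
  have h1 : (a * b) • e - x * y * e ∈ h.gt (α + β) := by
    have h2 := h.mul_mem_gt_right ((h.ge (α + β)).sub_mem hab' hxy) E.self_sub_mul_self_mem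
    have h3 := h.mul_mem_gt_left hax (mem_ge_of_eq hye)
    have h4 := h.mul_mem_gt_right (mem_ge_of_eq hae) hby
    rw [add_zero] at h2
    have h5 := sub_mem (sub_mem h2 h3) h4
    convert h5 using 1
    simp only [Algebra.smul_def, map_mul]
    ring
  have h6 := eq_of_sub_mem_gt hab h1
  refine ⟨le_antisymm ?_ hxy, h6⟩
  rw [← h6]
  have := h.add_le_map_mul' (x * y) e
  rwa [E.map_eq, add_zero] at this

omit H E in
/-- The relation defining the extension of `v` attached to `e`. -/
def Rel (h : SurmultValueFunction v Z) (e x : Z) (γ : Γ) : Prop :=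
  ∃ y, ∃ β : Γ, h y = β ∧ h (y * e) = β ∧ h (x * y) = ((γ + β : Γ) : WithTop Γ) ∧
    h (x * y * e) = ((γ + β : Γ) : WithTop Γ)

/-- `Rel` writes x as a quotient (xy)/y of elements whose classes survive multiplication by the
class of e. On such elements h is multiplicative, so numerators and denominators can be multiplied.
-/
theorem rel_mul {x x' : Z} {γ γ' : Γ} (hx : Rel h e x γ) (hx' : Rel h e x' γ') :
    Rel h e (x * x') (γ + γ') := by
  obtain ⟨y, β, h1, h2, h3, h4⟩ := hx
  obtain ⟨y', β', h1', h2', h3', h4'⟩ := hx'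
  obtain ⟨h5, h6⟩ := E.map_mul_of_eq H h1 h2 h1' h2'
  obtain ⟨h7, h8⟩ := E.map_mul_of_eq H h3 h4 h3' h4'
  refine ⟨y * y', β + β', h5, h6, ?_, ?_⟩
  · rw [mul_mul_mul_comm, h7, add_add_add_comm]
  · rw [mul_mul_mul_comm, h8, add_add_add_comm]

/-- Two quotient presentations are compared by cross-multiplying. -/
theorem rel_unique {x : Z} {γ γ' : Γ} (hx : Rel h e x γ) (hx' : Rel h e x γ') : γ = γ' := by
  obtain ⟨y, β, h1, h2, h3, h4⟩ := hx
  obtain ⟨y', β', h1', h2', h3', h4'⟩ := hx'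
  have h5 := (E.map_mul_of_eq H h3 h4 h1' h2').1
  have h6 := (E.map_mul_of_eq H h3' h4' h1 h2).1
  rw [mul_right_comm, h5] at h6
  norm_cast at h6
  grind

omit H in
theorem rel_of_eq {x : Z} {γ : Γ} (hx : h x = γ) (hxe : h (x * e) = γ) : Rel h e x γ :=
  ⟨1, 0, h.map_one', by rw [one_mul]; exact E.map_eq, by rw [mul_one, add_zero, hx],
    by rw [mul_one, add_zero, hxe]⟩

omit H in
theorem rel_algebraMap {c : F} {γ : Γ} (hc : v c = γ) : Rel h e (algebraMap F Z c) γ := by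
  refine E.rel_of_eq (by rw [h.map_algebraMap, hc]) ?_
  rw [← Algebra.smul_def, h.map_smul', E.map_eq, zero_add, hc]

/-- If the class of e annihilates that of x, it does not annihilate that of s(x). Then s(x) serves
as denominator, and the numerator x s(x) is in F. -/
theorem exists_rel [IsDomain Z] {x : Z} (hx : x ≠ 0) : ∃ γ, Rel h e x γ := by
  rcases E.exists_conj_of_ne_zero H hx with hxe | hxe
  · obtain ⟨γ, hγ⟩ := exists_coe_eq (g := h.toRingValue) hx
    exact ⟨γ, E.rel_of_eq hγ (hxe.trans hγ)⟩
  · obtain ⟨γ, hγ⟩ := exists_coe_eq (g := h.toRingValue) (H.map_ne_zero hx)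
    obtain ⟨c, hc⟩ := H.exists_norm x
    have hc0 : c ≠ 0 := by
      rintro rfl
      rw [map_zero] at hc
      exact mul_ne_zero hx (H.map_ne_zero hx) hc.symm
    obtain ⟨δ, hδ⟩ := exists_coe_eq (g := ofAddValuation v) hc0
    refine ⟨δ - γ, s x, γ, hγ, hxe.trans hγ, ?_, ?_⟩
    · rw [← hc, h.map_algebraMap, sub_add_cancel]
      exact hδ
    · rw [← hc, ← Algebra.smul_def, h.map_smul', E.map_eq, zero_add, sub_add_cancel]
      exact hδ

/-- Over the common denominator yy' the two numerators have known values. A further factor `u`,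
coming from the presentation of x + x', turns the lower bound for the sum of the numerators into one
for γ''. -/
theorem rel_add {x x' : Z} {γ γ' γ'' : Γ} (hx : Rel h e x γ) (hx' : Rel h e x' γ')
    (hxx' : Rel h e (x + x') γ'') : min γ γ' ≤ γ'' := by
  obtain ⟨y, β, h1, h2, h3, h4⟩ := hx
  obtain ⟨y', β', h1', h2', h3', h4'⟩ := hx'
  obtain ⟨h5, h6⟩ := E.map_mul_of_eq H h1 h2 h1' h2'
  have h7 := (E.map_mul_of_eq H h3 h4 h1' h2').1
  have h8 := (E.map_mul_of_eq H h3' h4' h1 h2).1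
  obtain ⟨u, ε, g1, g2, g3, g4⟩ := E.rel_mul H hxx' (E.rel_of_eq h5 h6)
  have h9 := h.min_le_map_add' (x * y * y') (x' * y' * y)
  rw [h7, h8, show x * y * y' + x' * y' * y = (x + x') * (y * y') by ring] at h9
  have h10 := (add_le_add h9 g1.ge).trans (h.add_le_map_mul' ((x + x') * (y * y')) u)
  rw [g3] at h10
  norm_cast at h10
  rw [min_add, min_le_iff] at h10
  rw [min_le_iff]
  grind

omit H E in
open Classical in
/-- The extension of `v` attached to `e`. -/
noncomputable def extFun (h : SurmultValueFunction v Z) (e x : Z) : WithTop Γ :=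
  if hx : ∃ γ, Rel h e x γ then (hx.choose : WithTop Γ) else ⊤

theorem extFun_eq {x : Z} {γ : Γ} (hx : Rel h e x γ) : extFun h e x = γ := by
  have hex : ∃ γ, Rel h e x γ := ⟨γ, hx⟩
  rw [extFun, dif_pos hex, E.rel_unique H hex.choose_spec hx]

omit H E in
theorem extFun_zero : extFun h e 0 = ⊤ := by
  rw [extFun, dif_neg]
  rintro ⟨γ, y, β, -, -, h3, -⟩
  rw [zero_mul, (h.map_eq_top_iff' 0).2 rfl] at h3
  exact WithTop.coe_ne_top h3.symm

omit H E in
/-- The extension of `v` attached to `e`, as a valuation. -/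
noncomputable def ext [IsDomain Z] (H : IsQuadraticConj s h) (E : IsSplitting s h e) :
    AddValuation Z (WithTop Γ) :=
  AddValuation.of (extFun h e) extFun_zero
    (E.extFun_eq H (E.rel_of_eq (x := 1) (γ := 0) h.map_one' (by rw [one_mul]; exact E.map_eq)))
    (fun x y => by
      by_cases hx : x = 0
      · rw [hx, zero_add]; exact min_le_right _ _
      by_cases hy : y = 0
      · rw [hy, add_zero]; exact min_le_left _ _
      by_cases hxy : x + y = 0
      · rw [hxy, extFun_zero]; exact le_top
      obtain ⟨α, hα⟩ := E.exists_rel H hx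
      obtain ⟨β, hβ⟩ := E.exists_rel H hy
      obtain ⟨γ, hγ⟩ := E.exists_rel H hxy
      rw [E.extFun_eq H hα, E.extFun_eq H hβ, E.extFun_eq H hγ, ← WithTop.coe_min,
        WithTop.coe_le_coe]
      exact E.rel_add H hα hβ hγ)
    (fun x y => by
      by_cases hx : x = 0
      · rw [hx, zero_mul, extFun_zero, top_add]
      by_cases hy : y = 0
      · rw [hy, mul_zero, extFun_zero, add_top]
      obtain ⟨α, hα⟩ := E.exists_rel H hx
      obtain ⟨β, hβ⟩ := E.exists_rel H hy
      rw [E.extFun_eq H hα, E.extFun_eq H hβ, E.extFun_eq H (E.rel_mul H hα hβ), WithTop.coe_add])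

theorem ext_eq [IsDomain Z] {x : Z} {γ : Γ} (hx : Rel h e x γ) : E.ext H x = γ := E.extFun_eq H hx

theorem ext_mem [IsDomain Z] : E.ext H ∈ valuationExtensions v Z := by
  intro c
  by_cases hc : c = 0
  · rw [hc, map_zero, AddValuation.map_zero, AddValuation.map_zero]
  · obtain ⟨γ, hγ⟩ := exists_coe_eq (g := ofAddValuation v) hc
    rw [E.ext_eq H (E.rel_algebraMap hγ)]
    exact hγ.symm

/-- If the class of e does not annihilate that of x, then xe is some ae with v(a) = h(x), up to
higher value; since w ≥ h and w(e) = 0, this forces w(x) = v(a). Every nonzero element is a quotient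
of two such elements. -/
theorem eq_ext [IsDomain Z] {w : AddValuation Z (WithTop Γ)} (hw : w ∈ valuationExtensions v Z)
    (hwe : w e = 0) : w = E.ext H := by
  have key : ∀ (x : Z) (γ : Γ), h x = γ → h (x * e) = γ → w x = γ := by
    intro x γ hx hxe
    obtain ⟨a, ha, hax⟩ := E.exists_smul_of_eq H hx hxe
    have h1 : w (a • e) = γ := by
      rw [Algebra.smul_def, w.map_mul, hwe, add_zero, hw, ha]
    have h2 : w (a • e) < w (x * e - a • e) := by
      rw [h1]
      exact lt_of_lt_of_le hax (H.le_extension hw _)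
    have h3 := w.map_add_eq_of_lt_left h2
    rwa [add_sub_cancel, w.map_mul, hwe, add_zero, h1] at h3
  ext x
  by_cases hx : x = 0
  · rw [hx, AddValuation.map_zero, AddValuation.map_zero]
  obtain ⟨γ, hγ⟩ := E.exists_rel H hx
  rw [E.ext_eq H hγ]
  obtain ⟨y, β, h1, h2, h3, h4⟩ := hγ
  have h5 := key _ _ h3 h4
  rw [w.map_mul, key _ _ h1 h2] at h5
  by_cases htop : w x = ⊤
  · rw [htop, WithTop.top_add] at h5
    exact absurd h5.symm WithTop.coe_ne_top
  · obtain ⟨α, hα⟩ := WithTop.ne_top_iff_exists.1 htop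
    rw [← hα] at h5 ⊢
    norm_cast at h5 ⊢
    exact add_right_cancel h5

/-- An extension w is nonnegative at e and s(e). These sum to 1 and their product has positive
value, so exactly one of them has w-value 0. Hence w or its conjugate under s is the extension
attached to e, and the two differ at e. -/
theorem encard_eq_two [IsDomain Z] : (valuationExtensions v Z).encard = 2 := by
  have hcomap : ∀ w ∈ valuationExtensions v Z,
      w.comap s.toRingHom ∈ valuationExtensions v Z := by
    intro w hw c
    change w (s (algebraMap F Z c)) = _
    rw [AlgHom.commutes, hw]
  have hsum : ∀ w ∈ valuationExtensions v Z, 0 < w e + w (s e) := by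
    intro w hw
    rw [← w.map_mul]
    exact lt_of_lt_of_le E.mul_conj (H.le_extension hw _)
  have hse : s (s e) = e := H.invol e
  set w₁ := E.ext H with hw₁
  have hw₁m := E.ext_mem H
  have hw₁e : w₁ e = 0 := by
    refine E.ext_eq H (E.rel_of_eq E.map_eq ?_)
    rw [H.sq, E.map_eq, add_zero]
    rfl
  rw [show valuationExtensions v Z = {w₁, w₁.comap s.toRingHom} from ?_, Set.encard_pair]
  · intro heq
    have h1 := hsum w₁ hw₁m
    have h2 : w₁ e = w₁ (s e) := congrArg (fun w : AddValuation Z (WithTop Γ) => w e) heq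
    rw [← h2, hw₁e, add_zero] at h1
    exact lt_irrefl _ h1
  · ext w
    constructor
    · intro hw
      have h1 : (0 : WithTop Γ) ≤ w e := by
        have := H.le_extension hw e
        rwa [E.map_eq] at this
      have h2 : (0 : WithTop Γ) ≤ w (s e) := by
        have := H.le_extension hw (s e)
        rwa [H.invariant, E.map_eq] at this
      rcases h1.eq_or_lt with h3 | h3
      · exact Or.inl (E.eq_ext H hw h3.symm)
      · have h4 : w (s e) = 0 := by
          refine le_antisymm ?_ h2
          by_contra! h5
          have h6 := w.map_add e (s e)
          rw [E.add_conj, w.map_one] at h6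
          exact absurd h6 (lt_min h3 h5).not_ge
        right
        have h5 : w.comap s.toRingHom = w₁ := E.eq_ext H (hcomap w hw) h4
        rw [Set.mem_singleton_iff, ← h5]
        ext z
        change w z = w (s (s z))
        rw [H.invol]
    · rintro (rfl | rfl)
      · exact hw₁m
      · exact hcomap _ hw₁m

end IsSplitting

end Quadratic

/-! ### Symmetric and symmetrized elements, and scalar extension -/

namespace LinearInvolution

variable {K A : Type*} [CommRing K] [Ring A] [Algebra K A] (σ : LinearInvolution K A)

/-- The `K`-module of symmetric elements. -/
def symK : Submodule K A := LinearMap.ker (σ.toLinearMap - LinearMap.id)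

/-- The `K`-module of symmetrized elements. -/
def symdK : Submodule K A := LinearMap.range (LinearMap.id + σ.toLinearMap)

variable {σ}

theorem mem_symK {x : A} : x ∈ σ.symK ↔ σ x = x := by
  rw [symK, LinearMap.mem_ker, LinearMap.sub_apply, LinearMap.id_apply, sub_eq_zero]

theorem mem_symdK {x : A} : x ∈ σ.symdK ↔ x ∈ σ.symd := by
  constructor
  · rintro ⟨y, rfl⟩
    exact ⟨y, rfl⟩
  · rintro ⟨y, rfl⟩
    exact ⟨y, rfl⟩

theorem one_mem_symK : (1 : A) ∈ σ.symK := mem_symK.2 σ.map_one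

theorem symdK_le_symK : σ.symdK ≤ σ.symK := by
  rintro _ ⟨x, rfl⟩
  rw [mem_symK]
  change σ (x + σ x) = x + σ x
  rw [_root_.map_add, σ.involutive, add_comm]

/-- The type of an involution is defined by dimensions over the center; this allows computing them
over K. -/
theorem bijective_algebraMap_center [FaithfulSMul K A]
    (hZ : ∀ z ∈ Subalgebra.center K A, ∃ c : K, algebraMap K A c = z) :
    Function.Bijective (algebraMap K (Subalgebra.center K A)) := by
  constructor
  · intro a b hab
    exact FaithfulSMul.algebraMap_injective K A (congrArg Subtype.val hab)
  · rintro ⟨z, hz⟩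
    obtain ⟨c, hc⟩ := hZ z hz
    exact ⟨c, Subtype.ext hc⟩

theorem finrank_center [FaithfulSMul K A]
    (hZ : ∀ z ∈ Subalgebra.center K A, ∃ c : K, algebraMap K A c = z) :
    Module.finrank (Subalgebra.center K A) A = Module.finrank K A := by
  have := rank_eq_of_equiv_equiv (algebraMap K (Subalgebra.center K A)) (AddEquiv.refl A)
    (bijective_algebraMap_center hZ) (fun r m => by
      change r • m = algebraMap K A r * m
      rw [Algebra.smul_def])
  rw [Module.finrank, Module.finrank, this]

theorem finrank_sym [FaithfulSMul K A]
    (hZ : ∀ z ∈ Subalgebra.center K A, ∃ c : K, algebraMap K A c = z) (h : σ.IsFirstKind) :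
    Module.finrank (Subalgebra.center K A) (σ.sym h) = Module.finrank K σ.symK := by
  let e : σ.symK ≃+ σ.sym h :=
    { toFun := fun x => ⟨x.1, mem_symK.1 x.2⟩
      invFun := fun x => ⟨x.1, mem_symK.2 x.2⟩
      left_inv := fun _ => rfl
      right_inv := fun _ => rfl
      map_add' := fun _ _ => rfl }
  have := rank_eq_of_equiv_equiv (algebraMap K (Subalgebra.center K A)) e
    (bijective_algebraMap_center hZ) (fun r m => Subtype.ext (by
      change r • (m : A) = algebraMap K A r * m
      rw [Algebra.smul_def]))
  rw [Module.finrank, Module.finrank, this]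

theorem isFirstKind_of_center (σ : LinearInvolution K A)
    (hZ : ∀ z ∈ Subalgebra.center K A, ∃ c : K, algebraMap K A c = z) : σ.IsFirstKind := by
  intro z hz
  obtain ⟨c, rfl⟩ := hZ z hz
  exact σ.map_algebraMap c

variable (σ) in
/-- Scalar extension of an involution. -/
noncomputable def baseChange (L : Type*) [CommRing L] [Algebra K L] :
    LinearInvolution L (L ⊗[K] A) where
  __ := LinearMap.baseChange L σ.toLinearMap
  map_mul' x y := by
    change LinearMap.baseChange L σ.toLinearMap (x * y) =
      LinearMap.baseChange L σ.toLinearMap y * LinearMap.baseChange L σ.toLinearMap x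
    induction x using TensorProduct.induction_on with
    | zero => simp
    | add x x' hx hx' => rw [add_mul, _root_.map_add, _root_.map_add, hx, hx', mul_add]
    | tmul l a =>
      induction y using TensorProduct.induction_on with
      | zero => simp
      | add y y' hy hy' => rw [mul_add, _root_.map_add, _root_.map_add, hy, hy', add_mul]
      | tmul l' a' =>
        rw [Algebra.TensorProduct.tmul_mul_tmul, LinearMap.baseChange_tmul,
          LinearMap.baseChange_tmul, LinearMap.baseChange_tmul,
          Algebra.TensorProduct.tmul_mul_tmul, σ.map_mul, mul_comm l l']
  involutive' x := by
    change LinearMap.baseChange L σ.toLinearMap (LinearMap.baseChange L σ.toLinearMap x) = x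
    induction x using TensorProduct.induction_on with
    | zero => simp
    | add x x' hx hx' => rw [_root_.map_add, _root_.map_add, hx, hx']
    | tmul l a => rw [LinearMap.baseChange_tmul, LinearMap.baseChange_tmul, σ.involutive]

/-- The dimension of the space of symmetrized elements does not increase under extension to a
field. -/
theorem finrank_symdK_baseChange_le [IsDomain K] [Module.Finite K A] {L : Type*} [Field L]
    [Algebra K L] [FaithfulSMul K L] :
    Module.finrank L (σ.baseChange L).symdK ≤ Module.finrank K σ.symdK := by
  let w : A → (σ.baseChange L).symdK := fun a =>
    ⟨(1 : L) ⊗ₜ[K] (a + σ a), (1 : L) ⊗ₜ[K] a, by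
      rw [TensorProduct.tmul_add]; rfl⟩
  have hspan : Submodule.span L (Set.range w) = ⊤ := by
    have key (x : L ⊗[K] A) : (⟨x + σ.baseChange L x, x, rfl⟩ : (σ.baseChange L).symdK) ∈
        Submodule.span L (Set.range w) := by
      induction x using TensorProduct.induction_on with
      | zero =>
        have h0 : (⟨0 + σ.baseChange L 0, 0, rfl⟩ : (σ.baseChange L).symdK) = 0 :=
          Subtype.ext (show (0 : L ⊗[K] A) + σ.baseChange L 0 = 0 by rw [_root_.map_zero, add_zero])
        rw [h0]
        exact zero_mem _
      | add x y hx hy =>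
        have h0 : (⟨x + y + σ.baseChange L (x + y), x + y, rfl⟩ : (σ.baseChange L).symdK) =
            ⟨x + σ.baseChange L x, x, rfl⟩ + ⟨y + σ.baseChange L y, y, rfl⟩ :=
          Subtype.ext (by
            change x + y + σ.baseChange L (x + y) =
              x + σ.baseChange L x + (y + σ.baseChange L y)
            rw [_root_.map_add, add_add_add_comm])
        rw [h0]
        exact add_mem hx hy
      | tmul l a =>
        have h0 : (⟨l ⊗ₜ[K] a + σ.baseChange L (l ⊗ₜ[K] a), l ⊗ₜ[K] a, rfl⟩ :
            (σ.baseChange L).symdK) = l • w a := Subtype.ext (by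
          change l ⊗ₜ[K] a + l ⊗ₜ[K] σ a = l • ((1 : L) ⊗ₜ[K] (a + σ a))
          rw [TensorProduct.smul_tmul', smul_eq_mul, mul_one, TensorProduct.tmul_add])
        rw [h0]
        exact Submodule.smul_mem _ l (Submodule.subset_span ⟨a, rfl⟩)
    rw [eq_top_iff]
    rintro ⟨_, x, rfl⟩ -
    exact key x
  -- The elements 1 ⊗ (a + σ(a)) span the symmetrized elements over L. If finitely many of them are
  -- independent over L, the corresponding a + σ(a) are independent over K, because K embeds in L.
  obtain ⟨f, hf⟩ := exists_linearIndependent_comp_of_span_eq_top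
    (Module.rank_lt_aleph0 L (σ.baseChange L).symdK) w hspan
  have h1 : LinearIndependent K (fun i => (⟨f i + σ (f i), f i, rfl⟩ : σ.symdK)) := by
    rw [Fintype.linearIndependent_iff] at hf ⊢
    intro k hk i
    have h2 := hf (fun i => algebraMap K L (k i)) (by
      apply Subtype.ext
      have h3 : ∑ i, k i • (f i + σ (f i)) = 0 := by simpa using congrArg Subtype.val hk
      have h4 := congrArg (fun x => (1 : L) ⊗ₜ[K] x) h3
      simp only [TensorProduct.tmul_sum, TensorProduct.tmul_smul, TensorProduct.tmul_zero] at h4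
      rw [Submodule.coe_sum, ZeroMemClass.coe_zero, ← h4]
      refine Finset.sum_congr rfl fun i _ => ?_
      change algebraMap K L (k i) • ((1 : L) ⊗ₜ[K] (f i + σ (f i))) = _
      rw [algebraMap_smul]) i
    exact (map_eq_zero_iff _ (FaithfulSMul.algebraMap_injective K L)).1 h2
  have h5 : Module.rank K σ.symdK < Cardinal.aleph0 :=
    (Submodule.rank_le _).trans_lt (Module.rank_lt_aleph0 K A)
  have h6 := Cardinal.toNat_le_toNat h1.cardinal_lift_le_rank (Cardinal.lift_lt_aleph0.2 h5)
  simpa [Module.finrank] using h6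

/-- Over a field, flatness embeds the extension of the space of symmetrized elements, which gives
the reverse inequality. -/
theorem finrank_symdK_le_baseChange {F : Type*} [Field F] {A : Type*} [Ring A] [Algebra F A]
    [FiniteDimensional F A] {σ : LinearInvolution F A} {L : Type*} [Field L] [Algebra F L] :
    Module.finrank F σ.symdK ≤ Module.finrank L (σ.baseChange L).symdK := by
  rw [← Module.finrank_baseChange (R := L)]
  have hle : LinearMap.range (LinearMap.baseChange L σ.symdK.subtype) ≤ (σ.baseChange L).symdK := by
    rintro _ ⟨x, rfl⟩
    induction x using TensorProduct.induction_on with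
    | zero => rw [_root_.map_zero]; exact zero_mem _
    | add x y hx hy => rw [_root_.map_add]; exact add_mem hx hy
    | tmul l a =>
      obtain ⟨_, a, rfl⟩ := a
      refine ⟨l ⊗ₜ[F] a, ?_⟩
      rw [LinearMap.baseChange_tmul]
      change l ⊗ₜ[F] a + l ⊗ₜ[F] σ a = l ⊗ₜ[F] (a + σ a)
      rw [TensorProduct.tmul_add]
  have hinj : Function.Injective (LinearMap.baseChange L σ.symdK.subtype) :=
    Module.Flat.lTensor_preserves_injective_linearMap (M := L) σ.symdK.subtype
      σ.symdK.injective_subtype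
  rw [← LinearMap.finrank_range_of_inj hinj]
  exact Submodule.finrank_mono hle

/-- Upper bound for A: extension to an algebraic closure of F gives a simple algebra, where the
dimension is that of the alternating matrices. -/
theorem two_mul_finrank_symdK_le {F : Type*} [Field F] {A : Type*} [Ring A] [Algebra F A]
    [IsSimpleRing A] [FiniteDimensional F A] (σ : LinearInvolution F A) (h2 : (2 : F) = 0)
    (hZ : ∀ z ∈ Subalgebra.center F A, ∃ c : F, algebraMap F A c = z) :
    ∃ n : ℕ, Module.finrank F A = n ^ 2 ∧ 2 * Module.finrank F σ.symdK ≤ n * (n - 1) := by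
  let L := AlgebraicClosure F
  have : IsSimpleRing (L ⊗[F] A) := IsSimpleRing.tensorProduct_of_center hZ
  have h2L : (2 : L) = 0 := by
    have := congrArg (algebraMap F L) h2
    rwa [map_ofNat, _root_.map_zero] at this
  obtain ⟨n, hn, hr⟩ := (σ.baseChange L).two_mul_finrank_range_of_isAlgClosed h2L
  refine ⟨n, by rw [← hn, Module.finrank_baseChange], ?_⟩
  rw [← hr]
  exact Nat.mul_le_mul_left 2 finrank_symdK_le_baseChange

end LinearInvolution

/-- Lower bound for the graded algebra. Extending scalars to an algebraic closure of the fraction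
field of K gives a simple algebra, and rank can only drop in the extension. -/
theorem IsGradedCentralSimple.le_two_mul_finrank_symdK {Γ : Type*} [AddCommGroup Γ]
    [LinearOrder Γ] {K B : Type*} [CommRing K] [IsDomain K] [Ring B] [Algebra K B]
    [Module.Free K B] [Nontrivial B]
    {𝒦 : Γ → AddSubgroup K} {ℬ : Γ → AddSubgroup B} [GradedRing ℬ]
    (hB : IsGradedCentralSimple 𝒦 ℬ) (τ : LinearInvolution K B) (h2 : (2 : K) = 0) :
    ∃ n : ℕ, Module.finrank K B = n ^ 2 ∧ n * (n - 1) ≤ 2 * Module.finrank K τ.symdK := by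
  have := hB.finite
  let L := AlgebraicClosure (FractionRing K)
  have hinj : Function.Injective (algebraMap K L) := by
    rw [IsScalarTower.algebraMap_eq K (FractionRing K) L]
    exact (algebraMap (FractionRing K) L).injective.comp (IsFractionRing.injective K _)
  have : FaithfulSMul K L := (faithfulSMul_iff_algebraMap_injective K L).2 hinj
  have : Nontrivial (L ⊗[K] B) := by
    have : Module.finrank L (L ⊗[K] B) ≠ 0 := by
      rw [Module.finrank_baseChange]
      exact Module.finrank_pos.ne'
    by_contra hnt
    rw [not_nontrivial_iff_subsingleton] at hnt
    exact this Module.finrank_zero_of_subsingleton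
  have := hB.isSimpleRing_tensorProduct L
  have h2L : (2 : L) = 0 := by
    have := congrArg (algebraMap K L) h2
    rwa [map_ofNat, map_zero] at this
  obtain ⟨n, hn, hr⟩ := (τ.baseChange L).two_mul_finrank_range_of_isAlgClosed h2L
  refine ⟨n, by rw [← hn, Module.finrank_baseChange], ?_⟩
  rw [← hr]
  exact Nat.mul_le_mul_left 2 LinearInvolution.finrank_symdK_baseChange_le

/-! ### Quotients of graded rings by homogeneous ideals -/

section GradedQuotient

open DirectSum

variable {Γ : Type*} {B : Type*} [Ring B] (ℬ : Γ → AddSubgroup B) (I : Ideal B) [I.IsTwoSided]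

/-- The homogeneous components of a quotient of a graded ring. -/
def quotientGrading (γ : Γ) : AddSubgroup (B ⧸ I) :=
  (ℬ γ).map (Ideal.Quotient.mk I).toAddMonoidHom

variable {ℬ I}

theorem mk_mem_quotientGrading {γ : Γ} {x : B} (hx : x ∈ ℬ γ) :
    Ideal.Quotient.mk I x ∈ quotientGrading ℬ I γ := ⟨x, hx, rfl⟩

/-- The projection between homogeneous components. -/
def quotientGradingMk (γ : Γ) : ℬ γ →+ quotientGrading ℬ I γ where
  toFun x := ⟨Ideal.Quotient.mk I x, mk_mem_quotientGrading x.2⟩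
  map_zero' := Subtype.ext (map_zero _)
  map_add' _ _ := Subtype.ext (map_add _ _ _)

variable [AddCommGroup Γ] [LinearOrder Γ] [GradedRing ℬ]

/-- The decomposition of a quotient of a graded ring by a homogeneous ideal. -/
def quotientDecompose (hI : I.IsHomogeneous ℬ) : B ⧸ I →+ ⨁ γ, quotientGrading ℬ I γ :=
  QuotientAddGroup.lift I.toAddSubgroup
    ((DirectSum.map (quotientGradingMk (ℬ := ℬ) (I := I))).comp
      (decomposeAddEquiv ℬ).toAddMonoidHom) (fun x hx => by
    ext γ
    change Ideal.Quotient.mk I (decompose ℬ x γ : B) = 0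
    rw [Ideal.Quotient.eq_zero_iff_mem]
    exact hI γ hx)

theorem quotientDecompose_mk (hI : I.IsHomogeneous ℬ) (x : B) :
    quotientDecompose hI (Ideal.Quotient.mk I x) =
      DirectSum.map (quotientGradingMk (ℬ := ℬ) (I := I)) (decompose ℬ x) := rfl

/-- The quotient of a graded ring by a homogeneous ideal is graded. -/
@[reducible]
def quotientGradedRing (hI : I.IsHomogeneous ℬ) : GradedRing (quotientGrading ℬ I) where
  one_mem := ⟨1, SetLike.GradedOne.one_mem, rfl⟩
  mul_mem := by
    rintro γ δ _ _ ⟨x, hx, rfl⟩ ⟨y, hy, rfl⟩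
    exact ⟨x * y, SetLike.mul_mem_graded hx hy, rfl⟩
  toDecomposition := Decomposition.ofAddHom _ (quotientDecompose hI)
    (by
      ext x
      obtain ⟨x, rfl⟩ := Ideal.Quotient.mk_surjective x
      change DirectSum.coeAddMonoidHom _ (quotientDecompose hI (Ideal.Quotient.mk I x)) = _
      rw [quotientDecompose_mk]
      induction x using DirectSum.Decomposition.inductionOn ℬ with
      | zero => simp
      | add x y hx hy =>
        rw [decompose_add, map_add, map_add, hx, hy, map_add, map_add]
      | homogeneous x =>
        rw [decompose_coe, DirectSum.map_of, DirectSum.coeAddMonoidHom_of]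
        rfl)
    (by
      ext γ x : 2
      obtain ⟨_, x, hx, rfl⟩ := x
      change quotientDecompose hI (DirectSum.coeAddMonoidHom _ (DirectSum.of _ _ _)) = _
      rw [DirectSum.coeAddMonoidHom_of]
      change quotientDecompose hI (Ideal.Quotient.mk I x) = _
      rw [quotientDecompose_mk, decompose_of_mem _ hx, DirectSum.map_of]
      rfl)

theorem Ideal.IsHomogeneous.comap_mk (hI : I.IsHomogeneous ℬ) {J : Ideal (B ⧸ I)}
    (hJ : let _ := quotientGradedRing hI; J.IsHomogeneous (quotientGrading ℬ I)) :
    (J.comap (Ideal.Quotient.mk I)).IsHomogeneous ℬ := by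
  let _ := quotientGradedRing hI
  intro γ x hx
  have h1 := hJ γ (Ideal.mem_comap.1 hx)
  rw [Ideal.mem_comap]
  exact h1

end GradedQuotient

/-! ### The center of a tame gauge algebra and graded simplicity -/

namespace LinearInvolution

variable {K A : Type*} [CommRing K] [Ring A] [Algebra K A]

/-- The automorphism of the center induced by an involution. -/
def centerHom (σ : LinearInvolution K A) :
    Subalgebra.center K A →ₐ[K] Subalgebra.center K A where
  toFun z := ⟨σ z, Subalgebra.mem_center_iff.2 fun b => by
    have h := congrArg σ (Subalgebra.mem_center_iff.1 z.2 (σ b))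
    rw [σ.map_mul, σ.map_mul, σ.involutive] at h
    exact h.symm⟩
  map_one' := Subtype.ext σ.map_one
  map_mul' x y := Subtype.ext (by
    change σ (x * y) = σ x * σ y
    rw [← Subalgebra.mem_center_iff.1 x.2, σ.map_mul])
  map_zero' := Subtype.ext (_root_.map_zero σ.toLinearMap)
  map_add' x y := Subtype.ext (_root_.map_add σ.toLinearMap _ _)
  commutes' c := Subtype.ext (σ.map_algebraMap c)

end LinearInvolution

theorem Subalgebra.isDomain_center {F A : Type*} [Field F] [Ring A] [Algebra F A]
    [IsSimpleRing A] : IsDomain (Subalgebra.center F A) :=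
  have := (IsSimpleRing.isField_center A).isDomain
  (RingEquiv.refl (Subring.center A)).toMulEquiv.isDomain (B := Subring.center A)

namespace SurmultValueFunction

open RingValue

variable {Γ : Type*} [AddCommGroup Γ] [LinearOrder Γ] [IsOrderedAddMonoid Γ]
  {F : Type*} [Field F] {v : AddValuation F (WithTop Γ)} {A : Type*} [Ring A] [Algebra F A]
  {g : SurmultValueFunction v A} {σ : LinearInvolution F A}

theorem IsInvariant.mem_ge (hσ : g.IsInvariant σ) {γ : Γ} {x : A} (hx : x ∈ g.ge γ) :
    σ x ∈ g.ge γ := le_of_le_of_eq hx (hσ x).symm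

theorem grInvolution_lead (hσ : g.IsInvariant σ) {γ : Γ} {x : A} (hx : x ∈ g.ge γ) :
    g.grInvolution σ hσ (g.lead γ x) = g.lead γ (σ x) := by
  rw [lead_of_mem hx, lead_of_mem (hσ.mem_ge hx)]
  exact hσ.grAdd_of_cls γ ⟨x, hx⟩

theorem grInvolution_mem (hσ : g.IsInvariant σ) {γ : Γ} {b : g.gr} (hb : b ∈ g.grComp γ) :
    g.grInvolution σ hσ b ∈ g.grComp γ := by
  obtain ⟨x, hx, rfl⟩ := exists_eq_lead hb
  rw [grInvolution_lead hσ hx]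
  exact lead_mem _ _

open DirectSum in
theorem decompose_grInvolution (hσ : g.IsInvariant σ) (b : g.gr) (γ : Γ) :
    (decompose g.grComp (g.grInvolution σ hσ b) γ : g.gr) =
      g.grInvolution σ hσ (decompose g.grComp b γ) := by
  revert b
  refine eq_of_forall_homogeneous (ℬ := g.grComp) (fun x y hx hy => ?_) ?_ fun δ x hx => ?_
  · rw [map_add, decompose_add, decompose_add, DirectSum.add_apply, DirectSum.add_apply, AddSubgroup.coe_add, hx, hy,
      AddSubgroup.coe_add, map_add]
  · rw [map_zero, decompose_zero, DirectSum.zero_apply, ZeroMemClass.coe_zero, map_zero]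
  · by_cases h : δ = γ
    · subst h
      rw [decompose_of_mem_same _ hx, decompose_of_mem_same _ (grInvolution_mem hσ hx)]
    · rw [decompose_of_mem_ne _ hx h, decompose_of_mem_ne _ (grInvolution_mem hσ hx) h, map_zero]

theorem grInclusion_lead {S : Subalgebra F A} {γ : Γ} {z : S} (hz : (z : A) ∈ g.ge γ) :
    g.grInclusion S ((g.restrict S).lead γ z) = g.lead γ (z : A) :=
  grMap_lead (g := (g.restrict S).toRingValue) (h := g.toRingValue) S.val.toRingHom _ hz

open DirectSum in
theorem grInclusion_decompose {S : Subalgebra F A} (y : (g.restrict S).gr) (γ : Γ) :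
    (decompose g.grComp (g.grInclusion S y) γ : g.gr) =
      g.grInclusion S (decompose (g.restrict S).grComp y γ) := by
  revert y
  refine eq_of_forall_homogeneous (ℬ := (g.restrict S).grComp) (fun x y hx hy => ?_) ?_
    fun δ x hx => ?_
  · rw [map_add, decompose_add, decompose_add, DirectSum.add_apply, DirectSum.add_apply, AddSubgroup.coe_add, hx, hy,
      AddSubgroup.coe_add, map_add]
  · rw [map_zero, decompose_zero, decompose_zero, DirectSum.zero_apply, DirectSum.zero_apply, ZeroMemClass.coe_zero,
      ZeroMemClass.coe_zero, map_zero]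
  · have hx' : g.grInclusion S x ∈ g.grComp δ := by
      obtain ⟨z, hz, rfl⟩ := exists_eq_lead hx
      rw [grInclusion_lead hz]
      exact lead_mem _ _
    by_cases h : δ = γ
    · subst h
      rw [decompose_of_mem_same _ hx, decompose_of_mem_same _ hx']
    · rw [decompose_of_mem_ne _ hx h, decompose_of_mem_ne _ hx' h, map_zero]

section Center

local notation "Z" => Subalgebra.center F A

theorem IsTameGauge.lead_mem_center (hg : g.IsTameGauge) (γ : Γ) (z : Z) :
    g.lead γ (z : A) ∈ Subalgebra.center (grField v) g.gr := by
  by_cases hz : (z : A) ∈ g.ge γ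
  · exact (hg.2.1 _).2 ⟨_, grInclusion_lead hz⟩
  · rw [lead, dif_neg hz]
    exact zero_mem _

open DirectSum in
-- This is how tameness enters: the center of gr_g(A) is gr of the center, so its homogeneous
-- elements lift to central elements of A.
theorem IsTameGauge.exists_eq_lead (hg : g.IsTameGauge) {γ : Γ} {x : g.gr}
    (hx : x ∈ Subalgebra.center (grField v) g.gr) (hγ : x ∈ g.grComp γ) :
    ∃ z : Z, (z : A) ∈ g.ge γ ∧ x = g.lead γ (z : A) := by
  obtain ⟨y, rfl⟩ := (hg.2.1 x).1 hx
  obtain ⟨z, hz, h⟩ := RingValue.exists_eq_lead (decompose (g.restrict Z).grComp y γ).2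
  refine ⟨z, hz, ?_⟩
  rw [← decompose_of_mem_same _ hγ, grInclusion_decompose, h, grInclusion_lead hz]

/-- For the squaring identity: if g(z²) > 2g(z), the class of z would be a nonzero homogeneous
central element of square zero, which graded semisimplicity forbids. -/
theorem IsTameGauge.isQuadraticConj (hg : g.IsTameGauge)
    (hF : ∀ z ∈ Subalgebra.center F A, σ z = z → ∃ c : F, algebraMap F A c = z)
    (hσ : g.IsInvariant σ) : IsQuadraticConj σ.centerHom (g.restrict Z) where
  invol z := Subtype.ext (σ.involutive z)
  fixed z hz := by
    obtain ⟨c, hc⟩ := hF z z.2 (congrArg Subtype.val hz)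
    exact ⟨c, Subtype.ext hc⟩
  invariant z := hσ z
  sq z := by
    change g ((z : A) * z) = g (z : A) + g (z : A)
    by_cases hz : (z : A) = 0
    · rw [hz, mul_zero, (g.map_eq_top_iff' 0).2 rfl, WithTop.top_add]
    obtain ⟨γ, hγ⟩ := exists_coe_eq (g := g.toRingValue) hz
    have hz' := mem_ge_of_eq hγ
    rw [hγ]
    refine (notMem_gt_iff (g.mul_mem_ge hz' hz')).1 fun hgt => lead_ne_zero hγ ?_
    refine hg.1.2.eq_zero_of_mul_mul_self (lead_mem _ _) fun b => ?_
    rw [← Subalgebra.mem_center_iff.1 (hg.lead_mem_center γ z), mul_assoc, lead_mul hz' hz',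
      lead_eq_zero_of_mem_gt hgt, mul_zero]

instance [Nontrivial A] : Nontrivial g.gr :=
  ⟨0, 1, fun h => by
    rw [← lead_zero_one] at h
    exact lead_ne_zero g.map_one' h.symm⟩

instance [Nontrivial A] : FaithfulSMul (grField v) g.gr :=
  (faithfulSMul_iff_algebraMap_injective _ _).2 ((injective_iff_map_eq_zero _).2 fun c => by
    intro hc
    by_contra h0
    obtain ⟨γ, hγ⟩ : ∃ γ, (DirectSum.decompose (grFieldComp v) c γ : grField v) ≠ 0 := by
      by_contra! h
      refine h0 ((DirectSum.decompose (grFieldComp v)).injective ?_)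
      rw [DirectSum.decompose_zero]
      exact DFinsupp.ext fun γ => Subtype.ext (h γ)
    have h1 := decompose_algebraMap_apply (ℬ := g.grComp) algebraMap_mem_grComp c γ
    rw [hc, DirectSum.decompose_zero] at h1
    exact ((isUnit_of_mem_grFieldComp γ _ (SetLike.coe_mem _) hγ).map
      (algebraMap (grField v) g.gr)).ne_zero (by rw [← h1]; rfl))

/-- A homogeneous two-sided ideal is generated by a central idempotent of degree 0. This lifts to a
central z to which the hypothesis applies, so the idempotent is 0 or 1. -/
theorem IsTameGauge.isGradedSimpleAlgebra [Nontrivial A] (hg : g.IsTameGauge)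
    (h : ∀ z : Z, (z : A) ∈ g.ge 0 → (z * z - z : A) ∈ g.gt 0 →
      (z : A) ∈ g.gt 0 ∨ (z - 1 : A) ∈ g.gt 0) :
    IsGradedSimpleAlgebra (grFieldComp v) g.grComp := by
  have hfin := hg.1.1.finite_gr
  refine ⟨algebraMap_mem_grComp, hfin, ⟨inferInstance, ?_⟩⟩
  intro I htwo hI
  obtain ⟨e, heI, he0, hee, he, hec⟩ := hg.1.2.exists_central_idempotent
    (𝒦 := grFieldComp v) algebraMap_mem_grComp isUnit_of_mem_grFieldComp hI htwo
  obtain ⟨z, hz, rfl⟩ := hg.exists_eq_lead (Subalgebra.mem_center_iff.2 hec) he0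
  have h2 : (z * z : A) ∈ g.ge 0 := mul_mem_ge' hz hz (add_zero 0)
  rw [lead_mul hz hz, add_zero, lead_eq_lead_iff h2 hz] at hee
  rcases h z hz hee with h0 | h1
  · left
    rw [eq_bot_iff]
    intro x hx
    rw [Ideal.mem_bot, ← he x hx, lead_eq_zero_of_mem_gt h0, mul_zero]
  · right
    rw [Ideal.eq_top_iff_one, ← lead_zero_one, ← (lead_eq_lead_iff hz g.one_mem_ge).2 h1]
    exact heI

/-- When the center is F, c(c - 1) of positive value forces c or c - 1 to have positive value, so no
nontrivial idempotent survives. Homogeneous central elements of gr_g(A) lift to scalars. -/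
theorem IsTameGauge.isGradedCentralSimple [Nontrivial A] (hg : g.IsTameGauge)
    (hZ : ∀ z ∈ Subalgebra.center F A, ∃ c : F, algebraMap F A c = z) :
    IsGradedCentralSimple (grFieldComp v) g.grComp := by
  refine ⟨hg.isGradedSimpleAlgebra fun z hz hzz => ?_, fun x => ⟨fun hx => ?_, ?_⟩⟩
  · obtain ⟨c, hc⟩ := hZ z z.2
    by_contra! h
    rw [notMem_gt_iff hz, notMem_gt_iff (sub_mem hz g.one_mem_ge)] at h
    rw [← hc] at hzz h
    rw [mem_gt, ← map_mul, ← map_sub, g.map_algebraMap, show c * c - c = c * (c - 1) by ring,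
      v.map_mul, ← g.map_algebraMap (A := A), ← g.map_algebraMap (A := A), map_sub, map_one,
      h.1, h.2] at hzz
    simp at hzz
  · have key (γ : Γ) : ∃ c : grField v, algebraMap (grField v) g.gr c =
        (DirectSum.decompose g.grComp x γ : g.gr) := by
      have hxγ : (DirectSum.decompose g.grComp x γ : g.gr) ∈
          Subalgebra.center (grField v) g.gr := by
        obtain ⟨y, rfl⟩ := (hg.2.1 x).1 hx
        rw [grInclusion_decompose]
        exact (hg.2.1 _).2 ⟨_, rfl⟩
      obtain ⟨z, hz, h⟩ := hg.exists_eq_lead hxγ (SetLike.coe_mem _)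
      obtain ⟨c, hc⟩ := hZ z z.2
      refine ⟨(ofAddValuation v).lead γ c, ?_⟩
      have hcγ : c ∈ (ofAddValuation v).ge γ := by
        rw [← hc] at hz
        exact le_of_le_of_eq hz (g.map_algebraMap c)
      rw [h, algebraMap_lead hcγ, hc]
    have hx' : x ∈ (algebraMap (grField v) g.gr).range := by
      classical
      rw [← DirectSum.sum_support_decompose g.grComp x]
      exact sum_mem fun γ _ => key γ
    exact hx'
  · rintro ⟨c, rfl⟩
    exact Subalgebra.algebraMap_mem _ c

end Center

end SurmultValueFunction

/-! ### The type of the induced involution of the first kind -/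

theorem ringChar_eq_two_iff {R : Type*} [Ring R] [Nontrivial R] : ringChar R = 2 ↔ (2 : R) = 0 := by
  have h0 := ringChar.spec R 2
  rw [Nat.cast_ofNat] at h0
  rw [h0]
  constructor
  · rintro h
    rw [h]
  · intro h
    exact ((Nat.dvd_prime Nat.prime_two).1 h).resolve_left CharP.ringChar_ne_one

namespace LinearInvolution

variable {K A : Type*} [CommRing K] [Ring A] [Algebra K A] {σ : LinearInvolution K A}

theorem isSymplectic_iff_of_ringChar_ne_two [FaithfulSMul K A]
    (hZ : ∀ z ∈ Subalgebra.center K A, ∃ c : K, algebraMap K A c = z) (h2 : ringChar A ≠ 2) :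
    σ.IsSymplectic ↔ ∃ n : ℕ, Module.finrank K A = n ^ 2 ∧
      2 * Module.finrank K σ.symK = n * (n - 1) := by
  constructor
  · rintro ⟨h, ⟨-, n, h1, h3⟩ | ⟨h0, -⟩⟩
    · rw [finrank_center hZ] at h1
      rw [finrank_sym hZ] at h3
      exact ⟨n, h1, h3⟩
    · exact absurd h0 h2
  · rintro ⟨n, h1, h3⟩
    refine ⟨isFirstKind_of_center σ hZ, Or.inl ⟨h2, n, ?_, ?_⟩⟩
    · rw [finrank_center hZ, h1]
    · rw [finrank_sym hZ, h3]

end LinearInvolution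

namespace SurmultValueFunction

open RingValue

variable {Γ : Type*} [AddCommGroup Γ] [LinearOrder Γ] [IsOrderedAddMonoid Γ]
  {F : Type*} [Field F] {v : AddValuation F (WithTop Γ)}

theorem one_add_one_mem_ge : (1 + 1 : F) ∈ (ofAddValuation v).ge 0 :=
  add_mem (one_mem_ge _) (one_mem_ge _)

theorem lead_two : (ofAddValuation v).lead 0 2 = 2 := by
  rw [← one_add_one_eq_two, lead_add (one_mem_ge _) (one_mem_ge _), lead_zero_one,
    one_add_one_eq_two]

theorem isUnit_two (h : v 2 = 0) : IsUnit (2 : grField v) := by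
  rw [← lead_two]
  exact isUnit_of_mem_grFieldComp 0 _ (lead_mem _ _) (lead_ne_zero h)

theorem two_eq_zero (h : v 2 ≠ 0) : (2 : grField v) = 0 := by
  rw [← lead_two]
  by_contra h0
  exact h (eq_of_lead_ne_zero h0)

theorem map_two_of_ringChar_ne_two (h : ringChar (residueFieldOf v) ≠ 2) : v 2 = 0 := by
  by_contra h0
  refine h (ringChar_eq_two_iff.2 ?_)
  rw [← map_ofNat (IsLocalRing.residue _) 2, IsLocalRing.residue_eq_zero_iff,
    IsLocalRing.mem_maximalIdeal, mem_nonunits_iff]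
  intro hu
  obtain ⟨y, hy⟩ := hu.exists_right_inv
  have hy' : (2 : F) * y = 1 := congrArg Subtype.val hy
  have h1 : v 2 + v (y : F) = 0 := by rw [← v.map_mul, hy', v.map_one]
  have h2 : 0 ≤ v (y : F) := y.2
  have h3 : 0 ≤ v 2 := by
    have : (2 : F) ∈ (ofAddValuation v).ge 0 := one_add_one_eq_two (R := F) ▸ one_add_one_mem_ge
    exact this
  refine h0 (le_antisymm ?_ h3)
  rw [← h1]
  exact le_add_of_nonneg_right h2

variable {A : Type*} [Ring A] [Algebra F A]
  {g : SurmultValueFunction v A} {σ : LinearInvolution F A}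

theorem algebraMap_two_eq_zero_iff [Nontrivial A] : (2 : A) = 0 ↔ (2 : F) = 0 := by
  rw [← map_ofNat (algebraMap F A), map_eq_zero_iff _ (FaithfulSMul.algebraMap_injective F A)]

theorem add_grInvolution_mem_grSub (hσ : g.IsInvariant σ) (b : g.gr) :
    b + g.grInvolution σ hσ b ∈ g.grSub σ.symdK := by
  induction b using lead_induction with
  | zero => rw [map_zero, add_zero]; exact zero_mem _
  | add x y hx hy => rw [map_add, add_add_add_comm]; exact add_mem hx hy
  | lead γ x hx =>
    rw [grInvolution_lead hσ hx, ← lead_add hx (hσ.mem_ge hx)]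
    exact lead_mem_grSub ⟨x, rfl⟩

theorem symdK_grInvolution_le (hσ : g.IsInvariant σ) :
    (g.grInvolution σ hσ).symdK ≤ g.grSub σ.symdK := by
  rintro _ ⟨b, rfl⟩
  exact add_grInvolution_mem_grSub hσ b

theorem grSub_mono {W W' : Submodule F A} (h : W ≤ W') : g.grSub W ≤ g.grSub W' :=
  Submodule.span_le.2 (by
    rintro _ ⟨γ, x, hx, -, rfl⟩
    exact lead_mem_grSub (h hx))

/-- In residue characteristic different from `2`, the symmetric elements of `gr_g(A)` are the
classes of the symmetric elements of `A`. -/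
theorem grSub_symK (hσ : g.IsInvariant σ) (h2 : v 2 = 0) :
    g.grSub σ.symK = (g.grInvolution σ hσ).symK := by
  apply le_antisymm
  · refine Submodule.span_le.2 ?_
    rintro _ ⟨γ, x, hx, hxγ, rfl⟩
    refine LinearInvolution.mem_symK.2 ?_
    rw [grInvolution_lead hσ hxγ, LinearInvolution.mem_symK.1 hx]
  · intro b hb
    -- For symmetric b, 2b = b + σ̃(b) lies in gr(Symd(A)), and 2 is invertible.
    obtain ⟨κ, hκ⟩ := (isUnit_two h2).exists_left_inv
    have h := add_grInvolution_mem_grSub hσ b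
    rw [LinearInvolution.mem_symK.1 hb, ← two_smul (grField v)] at h
    have h3 := Submodule.smul_mem _ κ h
    rw [smul_smul, hκ, one_smul] at h3
    exact grSub_mono LinearInvolution.symdK_le_symK h3

section FirstKind

variable [IsSimpleRing A] [FiniteDimensional F A]

/-- Here 2 ≠ 0 in A and in gr_g(A), so both types are decided by the dimension of the symmetric
elements, and passing to gr preserves it. -/
theorem IsTameGauge.isSymplectic_iff (hg : g.IsTameGauge) (hσ : g.IsInvariant σ)
    (hZ : ∀ z ∈ Subalgebra.center F A, ∃ c : F, algebraMap F A c = z) (h2 : v 2 = 0) :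
    (g.grInvolution σ hσ).IsSymplectic ↔ σ.IsSymplectic := by
  have hA : ringChar A ≠ 2 := by
    rw [Ne, ringChar_eq_two_iff, algebraMap_two_eq_zero_iff (F := F)]
    intro h
    rw [h, v.map_zero] at h2
    exact WithTop.top_ne_zero h2
  have hB : ringChar g.gr ≠ 2 := by
    rw [Ne, ringChar_eq_two_iff, ← map_ofNat (algebraMap (grField v) g.gr)]
    exact ((isUnit_two h2).map _).ne_zero
  have hZ' := fun z => ((hg.isGradedCentralSimple hZ).center_eq z).1
  rw [LinearInvolution.isSymplectic_iff_of_ringChar_ne_two hZ' hB,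
    LinearInvolution.isSymplectic_iff_of_ringChar_ne_two hZ hA, ← grSub_symK hσ h2,
    hg.1.1.finrank_grSub, hg.1.1.finrank_gr]

/-- Squeeze: Symd(gr_g(A)) lies in gr(W), whose dimension is at most n(n-1)/2, and its own dimension
is at least that. Both are homogeneous, so they coincide, and gr(W) contains 1. -/
theorem IsTameGauge.one_mem_symd (hg : g.IsTameGauge) (hσ : g.IsInvariant σ)
    (hZ : ∀ z ∈ Subalgebra.center F A, ∃ c : F, algebraMap F A c = z) (h2 : v 2 ≠ 0)
    {W : Submodule F A} (hW : σ.symdK ≤ W) (h1 : (1 : A) ∈ W) {n : ℕ}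
    (hn : Module.finrank F A = n ^ 2) (hWn : 2 * Module.finrank F W ≤ n * (n - 1)) :
    (1 : g.gr) ∈ (g.grInvolution σ hσ).symd := by
  have hfin := hg.1.1.finite_gr
  have hfree := hg.1.1.free_gr
  have hle : (g.grInvolution σ hσ).symdK ≤ g.grSub W :=
    (symdK_grInvolution_le hσ).trans (grSub_mono hW)
  have hone : (1 : g.gr) ∈ g.grSub W := by
    rw [← lead_zero_one]
    exact lead_mem_grSub h1
  obtain ⟨m, hm, hmD⟩ := (hg.isGradedCentralSimple hZ).le_two_mul_finrank_symdK
    (g.grInvolution σ hσ) (two_eq_zero h2)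
  rw [hg.1.1.finrank_gr, hn] at hm
  obtain rfl : n = m := Nat.pow_left_injective two_ne_zero hm
  rw [← LinearInvolution.mem_symdK]
  rcases hle.eq_or_lt with h | h
  · rw [h]; exact hone
  · have hlt := finrank_lt_finrank_of_homogeneous (𝒦 := grFieldComp v) (ℬ := g.grComp)
      algebraMap_mem_grComp isUnit_of_mem_grFieldComp (by
        rintro _ ⟨b, rfl⟩ γ
        refine ⟨(DirectSum.decompose g.grComp b γ : g.gr), ?_⟩
        change _ + g.grInvolution σ hσ _ =
          (DirectSum.decompose g.grComp (b + g.grInvolution σ hσ b) γ : g.gr)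
        rw [DirectSum.decompose_add, DirectSum.add_apply, AddSubgroup.coe_add,
          decompose_grInvolution]
        rfl) (decompose_mem_grSub W) h
    rw [hg.1.1.finrank_grSub] at hlt
    omega

theorem IsTameGauge.isSymplectic (hg : g.IsTameGauge) (hσ : g.IsInvariant σ)
    (hZ : ∀ z ∈ Subalgebra.center F A, ∃ c : F, algebraMap F A c = z) (h : σ.IsSymplectic) :
    (g.grInvolution σ hσ).IsSymplectic := by
  by_cases h2 : v 2 = 0
  · exact (hg.isSymplectic_iff hσ hZ h2).2 h
  have hZ' := fun z => ((hg.isGradedCentralSimple hZ).center_eq z).1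
  refine ⟨LinearInvolution.isFirstKind_of_center _ hZ', Or.inr ⟨?_, ?_⟩⟩
  · rw [ringChar_eq_two_iff, ← map_ofNat (algebraMap (grField v) g.gr), two_eq_zero h2, map_zero]
  -- In characteristic 2, W is Symd(A), bounded by scalar extension and containing 1 as σ is
  -- symplectic. Otherwise W is Sym(A), whose dimension is given by the definition of symplectic and
  -- which always contains 1.
  by_cases hA : ringChar A = 2
  · obtain ⟨n, hn, hWn⟩ := LinearInvolution.two_mul_finrank_symdK_le σ
      (algebraMap_two_eq_zero_iff.1 (ringChar_eq_two_iff.1 hA)) hZ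
    obtain ⟨-, ⟨h0, -⟩ | ⟨-, h1⟩⟩ := h
    · exact absurd hA h0
    · exact hg.one_mem_symd hσ hZ h2 le_rfl (LinearInvolution.mem_symdK.2 h1) hn hWn
  · obtain ⟨n, hn, hWn⟩ := (LinearInvolution.isSymplectic_iff_of_ringChar_ne_two hZ hA).1 h
    exact hg.one_mem_symd hσ hZ h2 LinearInvolution.symdK_le_symK LinearInvolution.one_mem_symK hn
      hWn.le

theorem IsTameGauge.isOrthogonal (hg : g.IsTameGauge) (hσ : g.IsInvariant σ)
    (hZ : ∀ z ∈ Subalgebra.center F A, ∃ c : F, algebraMap F A c = z) (h : σ.IsOrthogonal)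
    (h2 : v 2 = 0) : (g.grInvolution σ hσ).IsOrthogonal :=
  ⟨LinearInvolution.isFirstKind_of_center _ fun z =>
    ((hg.isGradedCentralSimple hZ).center_eq z).1,
    fun h' => h.2 ((hg.isSymplectic_iff hσ hZ h2).1 h')⟩

end FirstKind

end SurmultValueFunction

/-! ### Separability of the center and the unitary case -/

/-- A commutative algebra with a map `D` such that `D (y t) = t + y D t` is not separable. -/
theorem not_isSeparableAlgebra {K S : Type*} [CommRing K] [CommRing S] [Algebra K S] [Nontrivial S]
    (D : S →ₗ[K] S) (y : S) (hD : ∀ t, D (y * t) = t + y * D t) : ¬ IsSeparableAlgebra K S := by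
  rintro ⟨e, he, he1⟩
  -- Apply s ⊗ t ↦ s D(t) to (1 ⊗ y)e = (y ⊗ 1)e: the two sides differ by the product map applied to
  -- e, which is 1.
  let m : S ⊗[K] S →ₗ[K] S :=
    (Algebra.TensorProduct.lmul' K).toLinearMap ∘ₗ (TensorProduct.map LinearMap.id D)
  have key (x : S ⊗[K] S) :
      m (((1 : S) ⊗ₜ[K] y) * x) = Algebra.TensorProduct.lmul' K x + m ((y ⊗ₜ[K] (1 : S)) * x) := by
    induction x using TensorProduct.induction_on with
    | zero => simp
    | add x x' hx hx' =>
      rw [mul_add, mul_add, map_add, map_add, map_add, hx, hx', add_add_add_comm]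
    | tmul s t =>
      rw [Algebra.TensorProduct.tmul_mul_tmul, Algebra.TensorProduct.tmul_mul_tmul, one_mul,
        one_mul, Algebra.TensorProduct.lmul'_apply_tmul]
      change s * D (y * t) = s * t + y * s * D t
      rw [hD]
      ring
  have h := key e
  rw [he, he1] at h
  exact one_ne_zero (right_eq_add.1 h)

/-- In characteristic `2`, a quadratic algebra with a generator whose square is a scalar is not
separable. -/
theorem not_isSeparableAlgebra_of_basis {K S : Type*} [CommRing K] [CommRing S] [Algebra K S]
    [Nontrivial S] (h2 : (2 : S) = 0) (b : Module.Basis (Fin 2) K S) (h0 : b 0 = 1) {n : K}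
    (hn : b 1 * b 1 = algebraMap K S n) : ¬ IsSeparableAlgebra K S := by
  -- With y = b 1 and t = t₀ + t₁y, the map D picks t₁. Then D(yt) = t₀, which equals t + t₁y
  -- because 2 = 0.
  refine not_isSeparableAlgebra (Algebra.linearMap K S ∘ₗ b.coord 1) (b 1) fun t => ?_
  have ht := b.sum_repr t
  rw [Fin.sum_univ_two, h0] at ht
  have hyt : b 1 * t = (b.repr t 1 * n) • b 0 + b.repr t 0 • b 1 := by
    conv_lhs => rw [← ht]
    rw [mul_add, mul_smul_comm, mul_smul_comm, hn, h0, mul_one, Algebra.algebraMap_eq_smul_one,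
      smul_smul, add_comm]
  have hy : b.repr (b 1 * t) 1 = b.repr t 0 := by
    rw [hyt, map_add, map_smul, map_smul, b.repr_self, b.repr_self]
    simp
  change algebraMap K S (b.repr (b 1 * t) 1) = t + b 1 * algebraMap K S (b.repr t 1)
  rw [hy]
  rw [Algebra.smul_def, Algebra.smul_def, mul_one] at ht
  linear_combination ht - (algebraMap K S (b.repr t 1) * b 1) * h2

/-- The coefficients b = (z - s(z))/(u - s(u)) and a = z - bu are fixed by s, hence lie in F. -/
theorem IsQuadraticConj.exists_coord {Γ : Type*} [AddCommGroup Γ] [LinearOrder Γ]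
    [IsOrderedAddMonoid Γ] {F : Type*} [Field F] {v : AddValuation F (WithTop Γ)} {Z : Type*}
    [CommRing Z] [Algebra F Z] {s : Z →ₐ[F] Z} {h : SurmultValueFunction v Z}
    (H : IsQuadraticConj s h) (hZ : IsField Z) {u : Z} (hu : s u ≠ u) (z : Z) :
    ∃ a b : F, a • 1 + b • u = z := by
  obtain ⟨w, hw⟩ := hZ.mul_inv_cancel (a := u - s u) fun h => hu (sub_eq_zero.1 h).symm
  have hw' : (s u - u) * s w = 1 := by
    have := congrArg s hw
    rwa [map_mul, map_sub, map_one, H.invol] at this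
  have hsw : s w = -w := by linear_combination (-s w) * hw - w * hw'
  obtain ⟨b, hb⟩ := H.fixed ((z - s z) * w) (by
    rw [map_mul, map_sub, H.invol, hsw]; ring)
  obtain ⟨a, ha⟩ := H.fixed (z - algebraMap F Z b * u) (by
    rw [map_sub, map_mul, AlgHom.commutes, hb]
    linear_combination (z - s z) * hw)
  refine ⟨a, b, ?_⟩
  rw [Algebra.smul_def, Algebra.smul_def, mul_one, ha, sub_add_cancel]

namespace SurmultValueFunction

open RingValue

variable {Γ : Type*} [AddCommGroup Γ] [LinearOrder Γ] [IsOrderedAddMonoid Γ]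
  {F : Type*} [Field F] {v : AddValuation F (WithTop Γ)} {A : Type*} [Ring A] [Algebra F A]
  {g : SurmultValueFunction v A} {σ : LinearInvolution F A}

local notation "Z" => Subalgebra.center F A

theorem IsTameGauge.center_le_grSub (hg : g.IsTameGauge) {x : g.gr}
    (hx : x ∈ Subalgebra.center (grField v) g.gr) : x ∈ g.grSub (Subalgebra.toSubmodule Z) := by
  obtain ⟨y, rfl⟩ := (hg.2.1 x).1 hx
  clear hx
  induction y using lead_induction with
  | zero => rw [map_zero]; exact zero_mem _
  | add x y hx hy => rw [map_add]; exact add_mem hx hy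
  | lead γ z hz =>
    rw [grInclusion_lead hz]
    exact lead_mem_grSub z.2

section Unitary

variable [IsSimpleRing A] [FiniteDimensional F A]

theorem IsTameGauge.finrank_center_le_two (hg : g.IsTameGauge)
    (hF : ∀ z ∈ Subalgebra.center F A, σ z = z → ∃ c : F, algebraMap F A c = z)
    (hσ : g.IsInvariant σ) {u : A} (huZ : u ∈ Z) (hu : σ u ≠ u) :
    Module.finrank F (Subalgebra.toSubmodule Z) ≤ 2 := by
  have hle : Subalgebra.toSubmodule Z ≤ Submodule.span F {1, (u : A)} := by
    intro z hz
    obtain ⟨a, b, hab⟩ := (hg.isQuadraticConj hF hσ).exists_coord (u := ⟨u, huZ⟩)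
      (IsSimpleRing.isField_center A) (fun h => hu (congrArg Subtype.val h)) ⟨z, hz⟩
    exact Submodule.mem_span_pair.2 ⟨a, b, congrArg Subtype.val hab⟩
  classical
  refine (Submodule.finrank_mono hle).trans ?_
  have := finrank_span_finset_le_card (R := F) ({1, (u : A)} : Finset A)
  rw [Finset.coe_pair] at this
  exact this.trans Finset.card_le_two

/-- By dimensions, some central y has a class outside gr(F). If σ̃ fixed it, then 2 times the class
would be the class of the trace of y and its square that of the norm, both scalars. The first is
impossible when v(2) = 0, the second contradicts separability when v(2) ≠ 0. -/
theorem IsTameGauge.isUnitary (hg : g.IsTameGauge)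
    (hF : ∀ z ∈ Subalgebra.center F A, σ z = z → ∃ c : F, algebraMap F A c = z)
    (hσ : g.IsInvariant σ) (h : σ.IsUnitary) : (g.grInvolution σ hσ).IsUnitary := by
  intro hτ
  have hfin := hg.1.1.finite_gr
  obtain ⟨u, huZ, hu⟩ : ∃ u ∈ Z, σ u ≠ u := by
    by_contra! h0
    exact h h0
  set W : Submodule F A := Submodule.span F {1} with hW
  have hWZ : W < Subalgebra.toSubmodule Z := by
    refine lt_of_le_of_ne ((Submodule.span_singleton_le_iff_mem _ _).2 (one_mem Z)) fun h0 => hu ?_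
    rw [← Subalgebra.mem_toSubmodule, ← h0] at huZ
    obtain ⟨c, rfl⟩ := Submodule.mem_span_singleton.1 huZ
    rw [← Algebra.algebraMap_eq_smul_one, σ.map_algebraMap]
  have hW1 : Module.finrank (grField v) (g.grSub W) = 1 := by
    rw [hg.1.1.finrank_grSub, finrank_span_singleton one_ne_zero]
  have hlt := Submodule.finrank_lt_finrank_of_lt hWZ
  have hgrlt : g.grSub W < g.grSub (Subalgebra.toSubmodule Z) := by
    refine lt_of_le_of_ne (grSub_mono hWZ.le) fun h0 => hlt.ne ?_
    rw [← hg.1.1.finrank_grSub, ← hg.1.1.finrank_grSub (Subalgebra.toSubmodule Z), h0]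
  obtain ⟨γ, y, hyZ, hyγ, hyW⟩ : ∃ γ, ∃ y ∈ Z, y ∈ g.ge γ ∧ g.lead γ y ∉ g.grSub W := by
    by_contra! h0
    refine hgrlt.not_ge (Submodule.span_le.2 ?_)
    rintro _ ⟨γ, y, hy, hyγ, rfl⟩
    exact h0 γ y hy hyγ
  have halg {δ : Γ} {c : F} (hc : algebraMap F A c ∈ g.ge δ) :
      g.lead δ (algebraMap F A c) = algebraMap (grField v) g.gr ((ofAddValuation v).lead δ c) := by
    rw [algebraMap_lead]
    exact le_of_le_of_eq hc (g.map_algebraMap c)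
  have hWspan : g.grSub W ≤ Submodule.span (grField v) {1} := by
    refine Submodule.span_le.2 ?_
    rintro _ ⟨δ, x, hx, hxδ, rfl⟩
    obtain ⟨c, rfl⟩ := Submodule.mem_span_singleton.1 hx
    rw [← Algebra.algebraMap_eq_smul_one] at hxδ ⊢
    rw [halg hxδ, Algebra.algebraMap_eq_smul_one]
    exact Submodule.smul_mem _ _ (Submodule.mem_span_singleton_self _)
  have hone : (1 : g.gr) ∈ g.grSub W := by
    rw [← lead_zero_one]
    exact lead_mem_grSub (Submodule.mem_span_singleton_self _)
  have hτy : g.lead γ (σ y) = g.lead γ y := by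
    rw [← grInvolution_lead hσ hyγ]
    exact hτ _ (hg.lead_mem_center γ ⟨y, hyZ⟩)
  have hsyZ : σ y ∈ Z := (σ.centerHom ⟨y, hyZ⟩).2
  by_cases h2 : v 2 = 0
  · obtain ⟨κ, hκ⟩ := (isUnit_two h2).exists_left_inv
    apply hyW
    obtain ⟨c, hc⟩ := hF (y + σ y) (add_mem hyZ hsyZ) (by rw [map_add, σ.involutive, add_comm])
    have h1 : (2 : grField v) • g.lead γ y ∈ g.grSub W := by
      rw [two_smul]
      nth_rw 2 [← hτy]
      rw [← lead_add hyγ (hσ.mem_ge hyγ), ← hc, Algebra.algebraMap_eq_smul_one]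
      exact lead_mem_grSub (Submodule.smul_mem _ _ (Submodule.mem_span_singleton_self _))
    have h3 := Submodule.smul_mem _ κ h1
    rwa [smul_smul, hκ, one_smul] at h3
  -- A chain gr(F) < span{1, ỹ} < gr(Z(A)) of homogeneous submodules would force rank at least 3,
  -- whereas Z(A) has dimension at most 2. So 1 and ỹ span the center of gr_g(A).
  · have hM : g.grSub (Subalgebra.toSubmodule Z) ≤
        Submodule.span (grField v) {1, g.lead γ y} := by
      have hle : Submodule.span (grField v) {1, g.lead γ y} ≤
          g.grSub (Subalgebra.toSubmodule Z) := by
        rw [Submodule.span_le]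
        rintro _ (rfl | rfl)
        · exact hgrlt.le hone
        · exact lead_mem_grSub hyZ
      have hhom := decompose_mem_span (𝒦 := grFieldComp v) (ℬ := g.grComp) algebraMap_mem_grComp
        (s := {1, g.lead γ y}) (by
          rintro _ (rfl | rfl)
          · exact ⟨0, SetLike.GradedOne.one_mem⟩
          · exact ⟨γ, lead_mem _ _⟩)
      have hlt1 : g.grSub W < Submodule.span (grField v) {1, g.lead γ y} := by
        refine lt_of_le_of_ne (hWspan.trans (Submodule.span_mono (by simp))) fun h0 => hyW ?_
        rw [h0]
        exact Submodule.subset_span (by simp)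
      by_contra hnle
      have h3 := finrank_lt_finrank_of_homogeneous (𝒦 := grFieldComp v) (ℬ := g.grComp)
        algebraMap_mem_grComp isUnit_of_mem_grFieldComp (decompose_mem_grSub W) hhom hlt1
      have h4 := finrank_lt_finrank_of_homogeneous (𝒦 := grFieldComp v) (ℬ := g.grComp)
        algebraMap_mem_grComp isUnit_of_mem_grFieldComp hhom (decompose_mem_grSub _)
        (lt_of_le_not_ge hle hnle)
      have h5 := hg.finrank_center_le_two hF hσ huZ hu
      rw [hg.1.1.finrank_grSub] at h4
      omega
    let S := Subalgebra.center (grField v) g.gr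
    let b : Fin 2 → S := ![1, ⟨g.lead γ y, hg.lead_mem_center γ ⟨y, hyZ⟩⟩]
    have hli : LinearIndependent (grField v) b := by
      rw [LinearIndependent.pair_iff]
      intro s t hst
      have hst' : s • (1 : g.gr) + t • g.lead γ y = 0 := congrArg Subtype.val hst
      have ht : t = 0 := by
        by_contra ht
        refine hyW (mem_of_smul_mem (𝒦 := grFieldComp v) (ℬ := g.grComp) algebraMap_mem_grComp
          isUnit_of_mem_grFieldComp (decompose_mem_grSub W) ht (lead_mem _ _) ?_)
        rw [eq_neg_of_add_eq_zero_right hst']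
        exact neg_mem (Submodule.smul_mem _ _ hone)
      refine ⟨?_, ht⟩
      rw [ht, zero_smul, add_zero, ← Algebra.algebraMap_eq_smul_one] at hst'
      exact (map_eq_zero_iff _ (FaithfulSMul.algebraMap_injective (grField v) g.gr)).1 hst'
    have hsp : ⊤ ≤ Submodule.span (grField v) (Set.range b) := by
      rintro ⟨x, hx⟩ -
      obtain ⟨s, t, hst⟩ := Submodule.mem_span_pair.1 (hM (hg.center_le_grSub hx))
      rw [Matrix.range_cons_cons_empty, Submodule.mem_span_pair]
      exact ⟨s, t, Subtype.ext hst⟩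
    obtain ⟨c, hc⟩ := hF (y * σ y) (mul_mem hyZ hsyZ) (by rw [σ.map_mul, σ.involutive])
    have hcγ : y * σ y ∈ g.ge (γ + γ) := g.mul_mem_ge hyγ (hσ.mem_ge hyγ)
    refine not_isSeparableAlgebra_of_basis (K := grField v) (S := S) ?_
      (Module.Basis.mk hli hsp) ?_ (n := (ofAddValuation v).lead (γ + γ) c) ?_ hg.2.2
    · rw [← map_ofNat (algebraMap (grField v) S), two_eq_zero h2, map_zero]
    · rw [Module.Basis.mk_apply]
      rfl
    · rw [Module.Basis.mk_apply]
      apply Subtype.ext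
      change g.lead γ y * g.lead γ y = algebraMap (grField v) g.gr _
      -- As σ̃ fixes ỹ, its square is the class of y σ(y), which lies in F.
      nth_rw 2 [← hτy]
      rw [lead_mul hyγ (hσ.mem_ge hyγ), ← hc, halg]
      rwa [hc]

end Unitary

end SurmultValueFunction

/-! ### The product decomposition in the split case -/

section Product

variable {Γ : Type*} [AddCommGroup Γ] [LinearOrder Γ] {K : Type*} {B : Type u} [CommRing K]
  [Ring B] [Algebra K B] {𝒦 : Γ → AddSubgroup K} {ℬ : Γ → AddSubgroup B} [GradedRing ℬ]

theorem mem_of_mk_mem_quotientGrading {I : Ideal B} [I.IsTwoSided] {γ : Γ} {x f : B}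
    (hI : ∀ x, x ∈ I ↔ x * f = 0) (hf : f ∈ ℬ 0)
    (hx : Ideal.Quotient.mk I x ∈ quotientGrading ℬ I γ) : x * f ∈ ℬ γ := by
  obtain ⟨y, hy, hyx⟩ := hx
  have h : (y - x) * f = 0 := (hI _).1 (Ideal.Quotient.eq.1 hyx)
  rw [sub_mul, sub_eq_zero] at h
  rw [← h]
  simpa using SetLike.mul_mem_graded hy hf

/-- A central idempotent `f` with `τ f = 1 - f` splits an algebra with involution into two
factors exchanged by the involution. -/
theorem isProductExchanged_of_idempotent (τ : LinearInvolution K B) {f : B} (hf0 : f ∈ ℬ 0)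
    (hff : f * f = f) (hfc : ∀ b, b * f = f * b) (hτ : τ f = 1 - f)
    {I₁ I₂ : Ideal B} [I₁.IsTwoSided] [I₂.IsTwoSided] (h₁ : I₁.IsHomogeneous ℬ)
    (h₂ : I₂.IsHomogeneous ℬ) (hI₁ : ∀ x, x ∈ I₁ ↔ x * f = 0)
    (hI₂ : ∀ x, x ∈ I₂ ↔ x * (1 - f) = 0)
    (hcs₁ : let _ := quotientGradedRing h₁; IsGradedCentralSimple 𝒦 (quotientGrading ℬ I₁))
    (hcs₂ : let _ := quotientGradedRing h₂; IsGradedCentralSimple 𝒦 (quotientGrading ℬ I₂)) :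
    IsProductExchanged 𝒦 ℬ τ := by
  have hadd (x : B) : x * f + x * (1 - f) = x := by rw [← mul_add, add_sub_cancel, mul_one]
  have hbij : Function.Bijective
      ((Ideal.Quotient.mkₐ K I₁).prod (Ideal.Quotient.mkₐ K I₂)) := by
    constructor
    · rw [injective_iff_map_eq_zero]
      intro x hx
      rw [← hadd x, (hI₁ x).1 (Ideal.Quotient.eq_zero_iff_mem.1 (congrArg Prod.fst hx)),
        (hI₂ x).1 (Ideal.Quotient.eq_zero_iff_mem.1 (congrArg Prod.snd hx)), add_zero]
    · rintro ⟨a, b⟩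
      obtain ⟨a, rfl⟩ := Ideal.Quotient.mk_surjective a
      obtain ⟨b, rfl⟩ := Ideal.Quotient.mk_surjective b
      refine ⟨a * f + b * (1 - f), Prod.ext ?_ ?_⟩
      · refine Ideal.Quotient.eq.2 ((hI₁ _).2 ?_)
        simp only [sub_mul, add_mul, mul_sub, mul_one, mul_assoc, hff]
        abel
      · refine Ideal.Quotient.eq.2 ((hI₂ _).2 ?_)
        simp only [sub_mul, add_mul, mul_sub, mul_one, mul_assoc, hff]
        abel
  refine ⟨B ⧸ I₁, B ⧸ I₂, inferInstance, inferInstance, inferInstance, inferInstance,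
    quotientGrading ℬ I₁, quotientGrading ℬ I₂, quotientGradedRing h₁, quotientGradedRing h₂,
    AlgEquiv.ofBijective _ hbij, hcs₁, hcs₂, fun γ x => ⟨fun hx => ?_, fun hx => ?_⟩, fun x => ?_⟩
  · exact ⟨mk_mem_quotientGrading hx, mk_mem_quotientGrading hx⟩
  · rw [← hadd x]
    exact add_mem (mem_of_mk_mem_quotientGrading hI₁ hf0 hx.1)
      (mem_of_mk_mem_quotientGrading hI₂ (sub_mem SetLike.GradedOne.one_mem hf0) hx.2)
  · change Ideal.Quotient.mk I₂ x = 0 ↔ Ideal.Quotient.mk I₁ (τ x) = 0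
    have hx : τ (x * (1 - f)) = τ x * f := by
      rw [τ.map_mul, map_sub, τ.map_one, hτ, sub_sub_cancel, hfc]
    rw [Ideal.Quotient.eq_zero_iff_mem, Ideal.Quotient.eq_zero_iff_mem, hI₁, hI₂, ← hx]
    exact ⟨fun h => by rw [h, map_zero], fun h => by rw [← τ.involutive (x * _), h, map_zero]⟩

end Product

namespace SurmultValueFunction

open RingValue

variable {Γ : Type*} [AddCommGroup Γ] [LinearOrder Γ] [IsOrderedAddMonoid Γ]
  {F : Type*} [Field F] {v : AddValuation F (WithTop Γ)} {A : Type*} [Ring A] [Algebra F A]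
  {g : SurmultValueFunction v A} {σ : LinearInvolution F A}

section Splitting

variable (hg : g.IsTameGauge)
  (hF : ∀ z ∈ Subalgebra.center F A, σ z = z → ∃ c : F, algebraMap F A c = z)
  (hσ : g.IsInvariant σ) {e : Subalgebra.center F A}
  (E : IsSplitting σ.centerHom (g.restrict (Subalgebra.center F A)) e)

include hg hF hσ E

/-- By tameness it suffices to treat classes of elements x of Z(A), and xe is an F-multiple of e up
to higher value. So the factor cut out by ẽ has no more center than gr(F). -/
theorem exists_mul_lead_eq_smul {y : g.gr} (hy : y ∈ Subalgebra.center (grField v) g.gr) :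
    ∃ κ : grField v, y * g.lead 0 (e : A) = κ • g.lead 0 (e : A) := by
  have he : (e : A) ∈ g.ge 0 := E.mem_ge
  obtain ⟨y, rfl⟩ := (hg.2.1 y).1 hy
  clear hy
  induction y using lead_induction with
  | zero => exact ⟨0, by rw [map_zero, zero_mul, zero_smul]⟩
  | add x y hx hy =>
    obtain ⟨κ, hκ⟩ := hx
    obtain ⟨κ', hκ'⟩ := hy
    exact ⟨κ + κ', by rw [map_add, add_mul, hκ, hκ', add_smul]⟩
  | lead γ z hz =>
    obtain ⟨a, ha, hza⟩ := E.exists_smul (hg.isQuadraticConj hF hσ) hz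
    have hz' : (z : A) ∈ g.ge γ := hz
    refine ⟨(ofAddValuation v).lead γ a, ?_⟩
    rw [grInclusion_lead hz', lead_mul hz' he, lead_smul ha he, lead_eq_lead_iff
      (g.mul_mem_ge hz' he) (smul_mem_ge ha he), add_zero]
    exact hza

/-- The ideal is the annihilator of ẽ. A homogeneous ideal of the quotient pulls back to one
generated by a central idempotent p, and pẽ = κẽ with κ(κ - 1) = 0 in the domain gr(F); so κ is 0 or
1. Central elements of the quotient become central in gr_g(A) after multiplication by ẽ, hence are
scalars. -/
theorem isGradedCentralSimple_quotient [Nontrivial A] {I : Ideal g.gr} [I.IsTwoSided]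
    (hI : I.IsHomogeneous g.grComp) (hIe : ∀ x, x ∈ I ↔ x * g.lead 0 (e : A) = 0) :
    let _ := quotientGradedRing hI
    IsGradedCentralSimple (grFieldComp v) (quotientGrading g.grComp I) := by
  intro _
  set f := g.lead 0 (e : A) with hf
  have hfc : ∀ b : g.gr, b * f = f * b :=
    Subalgebra.mem_center_iff.1 (hg.lead_mem_center 0 e)
  have he : (e : A) ∈ g.ge 0 := E.mem_ge
  have hf0 : f ≠ 0 := lead_ne_zero (g := g.toRingValue) E.map_eq
  have hff : f * f = f := by
    rw [hf, lead_mul he he, add_zero, eq_comm, lead_eq_lead_iff he (mul_mem_ge' he he (add_zero 0))]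
    exact E.self_sub_mul_self_mem
  have hfin := hg.1.1.finite_gr
  have hfree := hg.1.1.free_gr
  refine ⟨⟨fun γ c hc => mk_mem_quotientGrading (algebraMap_mem_grComp γ c hc), ?_, ⟨?_, ?_⟩⟩,
    fun x => ⟨fun hx => ?_, ?_⟩⟩
  · exact Module.Finite.of_surjective (Ideal.Quotient.mkₐ (grField v) I).toLinearMap
      (Ideal.Quotient.mkₐ_surjective (grField v) I)
  · refine ⟨1, 0, fun h => hf0 ?_⟩
    have := (hIe 1).1 (Ideal.Quotient.eq_zero_iff_mem.1 h)
    rwa [one_mul] at this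
  · intro J hJtwo hJ
    obtain ⟨p, hpJ, -, hpp, hp, hpc⟩ := hg.1.2.exists_central_idempotent
      (𝒦 := grFieldComp v) algebraMap_mem_grComp isUnit_of_mem_grFieldComp (hI.comap_mk hJ)
      inferInstance
    obtain ⟨κ, hκ⟩ := exists_mul_lead_eq_smul hg hF hσ E (Subalgebra.mem_center_iff.2 hpc)
    have hκκ : (κ * (κ - 1)) • f = 0 := by
      have h1 : p * (p * f) = p * f := by rw [← mul_assoc, hpp]
      rw [hκ, mul_smul_comm, hκ, smul_smul] at h1
      rw [mul_sub, sub_smul, h1, mul_one, sub_self]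
    rcases mul_eq_zero.1 ((smul_eq_zero.1 hκκ).resolve_right hf0) with h0 | h1
    · left
      rw [eq_bot_iff]
      intro x hx
      obtain ⟨x, rfl⟩ := Ideal.Quotient.mk_surjective x
      rw [Ideal.mem_bot, Ideal.Quotient.eq_zero_iff_mem, hIe, ← hp x hx, mul_assoc, hκ, h0,
        zero_smul, mul_zero]
    · right
      rw [Ideal.eq_top_iff_one]
      have h2 : Ideal.Quotient.mk I p = 1 := by
        rw [← map_one (Ideal.Quotient.mk I), Ideal.Quotient.eq, hIe, sub_mul, hκ,
          sub_eq_zero.1 h1, one_smul, one_mul, sub_self]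
      rw [← h2]
      exact hpJ
  · obtain ⟨x, rfl⟩ := Ideal.Quotient.mk_surjective x
    have hxf : x * f ∈ Subalgebra.center (grField v) g.gr := by
      refine Subalgebra.mem_center_iff.2 fun b => ?_
      have h1 := Subalgebra.mem_center_iff.1 hx (Ideal.Quotient.mk I b)
      rw [← map_mul, ← map_mul, Ideal.Quotient.eq, hIe, sub_mul, sub_eq_zero] at h1
      rw [← mul_assoc, h1, mul_assoc, hfc, mul_assoc]
    obtain ⟨κ, hκ⟩ := exists_mul_lead_eq_smul hg hF hσ E hxf
    refine ⟨κ, ?_⟩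
    change Ideal.Quotient.mk I (algebraMap (grField v) g.gr κ) = _
    rw [Ideal.Quotient.eq, hIe, sub_mul, ← Algebra.smul_def, ← hκ, mul_assoc, hff, sub_self]
  · rintro ⟨c, rfl⟩
    exact Subalgebra.algebraMap_mem _ c

/-- The conjugate s(e) is again a splitting element, with class 1 - ẽ, so both annihilators have
graded central simple quotients, and σ̃ swaps the two idempotents. -/
theorem isProductExchanged [Nontrivial A] :
    IsProductExchanged (grFieldComp v) g.grComp (g.grInvolution σ hσ) := by
  set f := g.lead 0 (e : A) with hf
  have H := hg.isQuadraticConj hF hσ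
  have hfc : ∀ b : g.gr, b * f = f * b :=
    Subalgebra.mem_center_iff.1 (hg.lead_mem_center 0 e)
  have he : (e : A) ∈ g.ge 0 := E.mem_ge
  have hff : f * f = f := by
    rw [hf, lead_mul he he, add_zero, eq_comm, lead_eq_lead_iff he (mul_mem_ge' he he (add_zero 0))]
    exact E.self_sub_mul_self_mem
  have hse : (σ.centerHom e : A) = 1 - e := congrArg Subtype.val E.one_sub
  have h1f : g.lead 0 (σ.centerHom e : A) = 1 - f := by
    rw [hse, lead_sub g.one_mem_ge he, lead_zero_one]
  have E' : IsSplitting σ.centerHom (g.restrict (Subalgebra.center F A))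
      (σ.centerHom e) :=
    ⟨by rw [H.invol, add_comm, E.add_conj], by
      rw [H.invol, mul_comm]; exact E.mul_conj, (H.invariant e).trans E.map_eq⟩
  have hf0 : f ∈ g.grComp 0 := lead_mem _ _
  have htwo (a : g.gr) (ha : ∀ b, b * a = a * b) : ((⊤ : Ideal g.gr).annRight a).IsTwoSided := by
    refine ⟨fun {x} b hx => ⟨trivial, ?_⟩⟩
    rw [mul_assoc, ha, ← mul_assoc, hx.2, zero_mul]
  have hmem (a x : g.gr) : x ∈ (⊤ : Ideal g.gr).annRight a ↔ x * a = 0 :=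
    ⟨fun h => h.2, fun h => ⟨trivial, h⟩⟩
  have hhom {a : g.gr} (ha : a ∈ g.grComp 0) :
      ((⊤ : Ideal g.gr).annRight a).IsHomogeneous g.grComp :=
    (Ideal.IsHomogeneous.top g.grComp).annRight ha
  have htwo₁ := htwo f hfc
  have htwo₂ := htwo (1 - f) fun b => by rw [mul_sub, sub_mul, hfc, mul_one, one_mul]
  have h1f0 : 1 - f ∈ g.grComp 0 := sub_mem SetLike.GradedOne.one_mem hf0
  refine isProductExchanged_of_idempotent (g.grInvolution σ hσ) hf0 hff hfc ?_ (hhom hf0)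
    (hhom h1f0) (hmem f) (hmem (1 - f)) ?_ ?_
  · rw [hf, grInvolution_lead hσ he, ← h1f]
    rfl
  · exact isGradedCentralSimple_quotient hg hF hσ E _ (hmem f)
  · refine isGradedCentralSimple_quotient hg hF hσ E' _ fun x => ?_
    rw [hmem, h1f]

end Splitting

end SurmultValueFunction

theorem mainTheorem11 {Γ : Type*} [AddCommGroup Γ] [LinearOrder Γ] [IsOrderedAddMonoid Γ]
    (hΓ : ∀ n : ℕ, n ≠ 0 → ∀ γ : Γ, ∃ δ : Γ, n • δ = γ)
    {F : Type*} [Field F] (v : AddValuation F (WithTop Γ))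
    {A : Type*} [Ring A] [Algebra F A] [IsSimpleRing A] [FiniteDimensional F A]
    (σ : LinearInvolution F A)
    (hF : ∀ z ∈ Subalgebra.center F A, σ z = z → ∃ c : F, algebraMap F A c = z)
    (g : SurmultValueFunction v A) (hg : g.IsTameGauge) (hσ : g.IsInvariant σ) :
    (σ.IsUnitary →
      ((valuationExtensions v (Subalgebra.center F A)).encard = 1 ∨
        (valuationExtensions v (Subalgebra.center F A)).encard = 2) ∧
      ((valuationExtensions v (Subalgebra.center F A)).encard = 1 →
        IsGradedSimpleAlgebra (grFieldComp v) g.grComp ∧ (g.grInvolution σ hσ).IsUnitary) ∧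
      ((valuationExtensions v (Subalgebra.center F A)).encard = 2 →
        IsProductExchanged (grFieldComp v) g.grComp (g.grInvolution σ hσ))) ∧
    (σ.IsSymplectic →
      IsGradedCentralSimple (grFieldComp v) g.grComp ∧ (g.grInvolution σ hσ).IsSymplectic) ∧
    (σ.IsOrthogonal → ringChar (residueFieldOf v) ≠ 2 →
      IsGradedCentralSimple (grFieldComp v) g.grComp ∧ (g.grInvolution σ hσ).IsOrthogonal) := by
  have hdom := Subalgebra.isDomain_center (F := F) (A := A)
  have H := hg.isQuadraticConj hF hσ
  have hZ (h : σ.IsFirstKind) (z : A) (hz : z ∈ Subalgebra.center F A) :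
      ∃ c : F, algebraMap F A c = z := hF z hz (h z hz)
  refine ⟨fun hu => ?_, fun hs => ?_, fun ho hchar => ?_⟩
  -- The alternative on values of norms decides between one extension and two.
  · by_cases hN : ∀ z, (g.restrict (Subalgebra.center F A)) (z * σ.centerHom z) =
        (g.restrict (Subalgebra.center F A)) z + (g.restrict (Subalgebra.center F A)) z
    · have h1 := H.encard_eq_one hN
      refine ⟨Or.inl h1, fun _ => ⟨hg.isGradedSimpleAlgebra fun z hz hzz => ?_,
        hg.isUnitary hF hσ hu⟩, fun h2 => ?_⟩
      · by_contra! h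
        rw [RingValue.notMem_gt_iff hz,
          RingValue.notMem_gt_iff (sub_mem hz g.one_mem_ge)] at h
        have hmul := H.map_mul_of_norm hN z (z - 1)
        change g ((z : A) * (z - 1)) = g (z : A) + g ((z : A) - 1) at hmul
        rw [RingValue.mem_gt, show (z * z - z : A) = z * (z - 1) by rw [mul_sub, mul_one], hmul,
          h.1, h.2] at hzz
        simp at hzz
      · rw [h1] at h2
        norm_num at h2
    · obtain ⟨e, E⟩ := H.exists_isSplitting hN
      have h2 := E.encard_eq_two H
      refine ⟨Or.inr h2, fun h1 => ?_, fun _ =>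
        SurmultValueFunction.isProductExchanged hg hF hσ E⟩
      rw [h2] at h1
      norm_num at h1
  · obtain ⟨h1, -⟩ := id hs
    exact ⟨hg.isGradedCentralSimple (hZ h1), hg.isSymplectic hσ (hZ h1) hs⟩
  · exact ⟨hg.isGradedCentralSimple (hZ ho.1), hg.isOrthogonal hσ (hZ ho.1) ho
      (SurmultValueFunction.map_two_of_ringChar_ne_two hchar)⟩
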